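/- **Conventions.** Let $R$ be a commutative ring (with unit). A *precubical set* $X$ consists of sets $X_n$ ($n\ge 0$) and face maps $d_i^\epsilon : X_n \to X_{n-1}$ ($1\le i\le n$, $\epsilon\in\{0,1\}$) with $d_i^\epsilon d_j^\eta = d_{j-1}^\eta d_i^\epsilon$ for $i<j$; a morphism is a family of maps commuting with all faces. For $A\subseteq\{1,\dots,n\}$, $d_A^\epsilon$ denotes the iterated face in the directions in $A$, and $d^\epsilon = d^\epsilon_{\{1,\dots,n\}} : X_n\to X_0$ gives the initial ($\epsilon=0$) and final ($\epsilon=1$) vertex of a cube. $X$ is *finite* if it has finitely many cubes in total, and *cycle-free* if no directed path of one or more edges starts and ends at the same vertex. $\mathrm{Cub}$ is the category of finite cycle-free precubical sets and morphisms injective on vertices. The tensor product is $(X\otimes Y)_n=\coprod_{p+q=n}X_p\times Y_q$ with $d_i^\epsilon(x,y)=(d_i^\epsilon x,y)$ for $i\le p$ and $(x,d_{i-p}^\epsilon y)$ for $i>p$. A *cube chain* in $X$ from a vertex $v$ to a vertex $w$, of type $(n_1,\dots,n_l)$ with all $n_k\ge1$, is a sequence $(c_1,\dots,c_l)$, $c_k\in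 X_{n_k}$, with $d^0c_1=v$, $d^1c_k=d^0c_{k+1}$ and $d^1c_l=w$ (for $l=0$: the constant chain at $v=w$); its dimension is $\sum_k (n_k-1)$. The *path algebra* $R(X)$ is the free $R$-module on the cube chains of dimension $0$, i.e. the directed edge paths including the constant ones, with multiplication by concatenation, and $0$ for non-composable paths; its unit is the sum of the constant paths. $C_i(X)$ is the free $R$-module on the $i$-dimensional cube chains, an $R(X)$-bimodule by concatenation, and $C(X)$ is the chain complex of $R(X)$-bimodules with $$\partial(c_1,\dots,c_l)=\sum_{k=1}^l\ \sum_{\emptyset\ne A\subsetneq\{1,\dots,n_k\}}(-1)^{(n_1-1)+\dots+(n_{k-1}-1)+|A|}\,\mathrm{sgn}(A)\,(c_1,\dots,c_{k-1},d^0_{\bar A}c_k,d^1_Ac_k,c_{k+1},\dots,c_l),$$ where $\bar A$ is the complement of $A$ and $\mathrm{sgn}(A)=(-1)^{\sum_{a\in A}a-\sum_{a=1}^{|A|}a}$. Write $H_i(X)=H_i(C(X))$. For $X,Y\in\mathrm{Cub}$, $C(X)\otimes C(Y)$ is the tensor product over $R$ of chain complexes, $\partial(x\otimes y)=\partial x\otimes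 y+(-1)^{\deg x}x\otimes\partial y$, a complex of $R(X)\otimes_R R(Y)$-bimodules with componentwise actions. Let $h=h_{X,Y}:R(X\otimes Y)\to R(X)\otimes_R R(Y)$ be the $R$-algebra homomorphism sending each generator $(u,v)$ (a vertex or an edge of $X\otimes Y$) to $u\otimes v$, and $h^*$ the restriction of scalars along $h$ on the left and on the right. **Theorem 6.17.** For all $X,Y\in\mathrm{Cub}$ and all $i\ge0$ there is an isomorphism $$H_i(X\otimes Y)\;\cong\;h^*H_i\bigl(C(X)\otimes C(Y)\bigr)$$ of $R(X\otimes Y)$-bimodules, natural in $X$ and $Y$: for all morphisms $f:X\to X'$ and $g:Y\to Y'$ of $\mathrm{Cub}$, these isomorphisms commute with the maps $H_i(f\otimes g):H_i(X\otimes Y)\to H_i(X'\otimes Y')$ and $H_i(C(f)\otimes C(g)):H_i(C(X)\otimes C(Y))\to H_i(C(X')\otimes C(Y'))$. -/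

import Mathlib

universe u v w

/-! The bigger part of this file consists of proofs. The definitions that matter for the statement
are `PrecubicalSet`, `faces`, `endpoint`, `IsChain`, `CubeChain`, `boundary`, `Bimodule`,
`BimoduleComplex` (with `homology`, `tensor` and `ChainMap`), `PathAlgebra`, `cubeComplex`,
`PrecubicalSet.tensor`, `pathAlgebraMap` and `Cub`. The words, the maps `raw…` and `key…` and the ring
elements `fsplit` only serve to prove `∂ ∘ ∂ = 0` and the compatibility of `∂` with concatenation. -/

open scoped TensorProduct DirectSum

/-- A precubical set, presented by the set of all its cubes (the disjoint union of the sets `Xₙ`),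
the dimension function, and the face maps `d_i^ε : Xₙ → Xₙ₋₁`, `0 ≤ i < n`
(`ε = false` is the lower face `d_i^0`, `ε = true` the upper face `d_i^1`; directions are counted
from `0`), subject to the precubical identities. -/
structure PrecubicalSet where
  cube : Type u
  dim : cube → ℕ
  face : Bool → (c : cube) → (i : ℕ) → i < dim c → cube
  dim_face : ∀ (ε : Bool) (c : cube) (i : ℕ) (h : i < dim c), dim (face ε c i h) + 1 = dim c
  face_face : ∀ (ε η : Bool) (c : cube) (i j : ℕ) (hij : i < j) (hj : j < dim c),
    face ε (face η c j hj) i (by have := dim_face η c j hj; omega) =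
      face η (face ε c i (hij.trans hj)) (j - 1)
        (by have := dim_face ε c i (hij.trans hj); omega)

namespace PrecubicalSet

/-- Vertices are the cubes of dimension `0`. -/
def Vertex (X : PrecubicalSet.{u}) : Type u := {c : X.cube // X.dim c = 0}

/-- Morphisms of precubical sets: maps preserving dimensions and faces. -/
@[ext]
structure Hom (X Y : PrecubicalSet.{u}) where
  toFun : X.cube → Y.cube
  dim_map : ∀ c, Y.dim (toFun c) = X.dim c
  map_face : ∀ (ε : Bool) (c : X.cube) (i : ℕ) (h : i < X.dim c),
    toFun (X.face ε c i h) = Y.face ε (toFun c) i (by rw [dim_map]; exact h)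

section Faces

variable (X : PrecubicalSet.{u})

/-- The face map `d_i^ε` as a total function (only ever used for `i < dim c`). -/
def tface (ε : Bool) (i : ℕ) (c : X.cube) : X.cube :=
  if h : i < X.dim c then X.face ε c i h else c

/-- Applies, in decreasing order of `i`, the faces `d_i^ε` for all `i ∈ A` with `i < n`. -/
def faceBelow (ε : Bool) (A : Finset ℕ) : ℕ → X.cube → X.cube
  | 0, c => c
  | n + 1, c => faceBelow ε A n (if n ∈ A then X.tface ε n c else c)

/-- The iterated face `d_A^ε c`, in all the directions in `A ⊆ {0, …, dim c - 1}`. -/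
def faces (ε : Bool) (A : Finset ℕ) (c : X.cube) : X.cube := X.faceBelow ε A (X.dim c) c

/-- Iterated faces along words: the `i`-th letter counted from the end (starting from `0`) is
`some ε` if the face `d_i^ε` is taken and `none` if direction `i` is kept. -/
def wface : List (Option Bool) → X.cube → X.cube
  | [], c => c
  | none :: w, c => wface w c
  | some ε :: w, c => wface w (X.tface ε w.length c)

variable {X}

theorem dim_tface {ε : Bool} {i : ℕ} {c : X.cube} (h : i < X.dim c) :
    X.dim (X.tface ε i c) + 1 = X.dim c := by
  rw [tface, dif_pos h]; exact X.dim_face ε c i h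

theorem tface_tface (ε η : Bool) (c : X.cube) {i j : ℕ} (hij : i ≤ j) (hj : j + 1 < X.dim c) :
    X.tface ε i (X.tface η (j + 1) c) = X.tface η j (X.tface ε i c) := by
  have h1 := dim_tface (X := X) (ε := η) hj
  have h2 := dim_tface (X := X) (ε := ε) (i := i) (c := c) (by omega)
  have e1 : X.tface η (j + 1) c = X.face η c (j + 1) hj := dif_pos hj
  have e2 : X.tface ε i c = X.face ε c i (by omega) := dif_pos (by omega)
  have e3 : X.tface ε i (X.tface η (j + 1) c) = X.face ε (X.tface η (j + 1) c) i (by omega) :=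
    dif_pos (by omega)
  have e4 : X.tface η j (X.tface ε i c) = X.face η (X.tface ε i c) j (by omega) :=
    dif_pos (by omega)
  rw [e3, e4]
  simp only [e1, e2]
  exact X.face_face ε η c i (j + 1) (by omega) hj

/-- The number of kept directions of a word. -/
def kept (w : List (Option Bool)) : ℕ := w.countP (· == none)

theorem dim_wface (w : List (Option Bool)) (c : X.cube) (h : w.length ≤ X.dim c) :
    X.dim (X.wface w c) + w.length = X.dim c + kept w := by
  induction w generalizing c with
  | nil => simp [wface, kept]
  | cons o w ih =>
    cases o with
    | none =>
      have := ih c (by simp at h; omega)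
      simp [wface, kept] at *; omega
    | some ε =>
      simp at h
      have h2 := dim_tface (X := X) (ε := ε) (i := w.length) (c := c) (by omega)
      have := ih (X.tface ε w.length c) (by omega)
      simp [wface, kept] at *; omega

theorem tface_wface (ε : Bool) (i : ℕ) (w : List (Option Bool)) (c : X.cube)
    (h : i + w.length < X.dim c) :
    X.tface ε (i + kept w) (X.wface w c) = X.wface w (X.tface ε (i + w.length) c) := by
  induction w generalizing c i with
  | nil => simp [wface, kept]
  | cons o w ih =>
    cases o with
    | none =>
      have := ih (i + 1) c (by simp at h; omega)
      simp [wface, kept] at *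
      rw [← add_assoc, add_right_comm, this]
      congr 2; omega
    | some η =>
      simp at h
      have h2 := dim_tface (X := X) (ε := η) (i := w.length) (c := c) (by omega)
      have := ih i (X.tface η w.length c) (by omega)
      simp only [wface, List.length_cons]
      rw [← add_assoc, tface_tface η ε c (by omega) (by omega), ← this]
      simp [kept]

theorem filterMap_kept (u : List (Option Bool ⊕ Bool)) :
    (u.filterMap (Sum.elim some fun _ => none)).length =
      kept (u.map (Sum.elim (fun _ => none) some)) := by
  induction u with
  | nil => rfl
  | cons a u ih => rcases a with _ | _ <;> simpa [kept, List.filterMap_cons] using ih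

/-- Composition of iterated faces: a letter `Sum.inr ε` stands for a face taken in the first step,
a letter `Sum.inl o` for a direction kept in the first step and with letter `o` in the second. -/
theorem wface_wface (u : List (Option Bool ⊕ Bool)) (c : X.cube) (h : u.length ≤ X.dim c) :
    X.wface (u.filterMap (Sum.elim some fun _ => none))
      (X.wface (u.map (Sum.elim (fun _ => none) some)) c) =
      X.wface (u.map (Sum.elim id some)) c := by
  induction u generalizing c with
  | nil => simp [wface]
  | cons o u ih =>
    simp at h
    rcases o with (_ | ε) | ε
    · simpa [wface] using ih c (by omega)
    · have h2 := dim_tface (X := X) (ε := ε) (i := u.length) (c := c) (by omega)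
      have := ih (X.tface ε u.length c) (by omega)
      simp only [List.filterMap_cons, List.map_cons, Sum.elim_inl, wface, List.length_map, id]
      rw [← this]
      congr 1
      have := tface_wface ε 0 (u.map (Sum.elim (fun _ => none) some)) c (by simp; omega)
      simp only [zero_add, List.length_map] at this
      rw [← this]
      congr 1
      rw [filterMap_kept]
    · have h2 := dim_tface (X := X) (ε := ε) (i := u.length) (c := c) (by omega)
      simpa [wface, List.filterMap_cons] using ih (X.tface ε u.length c) (by omega)

/-- The word of the iterated face in the directions of a set `A`. -/
def wordOf (ε : Bool) (A : Finset ℕ) : ℕ → List (Option Bool)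
  | 0 => []
  | n + 1 => (if n ∈ A then some ε else none) :: wordOf ε A n

theorem length_wordOf (ε : Bool) (A : Finset ℕ) (n : ℕ) : (wordOf ε A n).length = n := by
  induction n with
  | zero => rfl
  | succ n ih => simp [wordOf, ih]

theorem faceBelow_eq (ε : Bool) (A : Finset ℕ) (n : ℕ) (c : X.cube) :
    X.faceBelow ε A n c = X.wface (wordOf ε A n) c := by
  induction n generalizing c with
  | zero => rfl
  | succ n ih => by_cases h : n ∈ A <;> simp [faceBelow, wordOf, h, wface, ih, length_wordOf]

theorem wordOf_full (ε : Bool) (A : Finset ℕ) (n : ℕ) (h : Finset.range n ⊆ A) :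
    wordOf ε A n = List.replicate n (some ε) := by
  induction n with
  | zero => rfl
  | succ n ih =>
    rw [wordOf, if_pos (h (by simp)), ih (fun i hi => h (by simp at hi ⊢; omega)),
      List.replicate_succ]

theorem kept_replicate (ε : Bool) (n : ℕ) : kept (List.replicate n (some ε)) = 0 := by
  simp [kept, List.countP_replicate]

theorem faces_full (ε : Bool) (c : X.cube) :
    X.faces ε (Finset.range (X.dim c)) c = X.wface (List.replicate (X.dim c) (some ε)) c := by
  rw [faces, faceBelow_eq, wordOf_full _ _ _ (subset_refl _)]

theorem dim_faces_full (ε : Bool) (c : X.cube) :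
    X.dim (X.faces ε (Finset.range (X.dim c)) c) = 0 := by
  rw [faces_full]
  have := dim_wface (X := X) (List.replicate (X.dim c) (some ε)) c (by simp)
  rw [kept_replicate] at this
  simp at this; omega

variable (X)

/-- The initial vertex `d^0 c` (for `ε = false`) and the final vertex `d^1 c` (for `ε = true`)
of a cube. -/
def endpoint (ε : Bool) (c : X.cube) : X.Vertex :=
  ⟨X.faces ε (Finset.range (X.dim c)) c, dim_faces_full ε c⟩

/-- `X.IsChain v l w`: the list `l = (c₁, …, c_k)` is a cube chain from `v` to `w`, i.e. all `c_i`
have positive dimension, `d^0 c₁ = v`, `d^1 c_i = d^0 c_{i+1}` and `d^1 c_k = w`; the empty list is a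
cube chain from `v` to `v`. -/
def IsChain : X.Vertex → List X.cube → X.Vertex → Prop
  | v, [], w => v = w
  | v, c :: l, w => 1 ≤ X.dim c ∧ X.endpoint false c = v ∧ IsChain (X.endpoint true c) l w

/-- The dimension of a cube chain of type `(n₁, …, n_k)` is `(n₁ - 1) + ⋯ + (n_k - 1)`. -/
def degree (l : List X.cube) : ℕ := (l.map fun c => X.dim c - 1).sum

/-- The `n`-dimensional cube chains in `X`. Those of dimension `0` are the directed edge paths,
including a constant path at every vertex. -/
@[ext]
structure CubeChain (n : ℕ) where
  src : X.Vertex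
  tgt : X.Vertex
  cubes : List X.cube
  isChain : X.IsChain src cubes tgt
  degree_eq : X.degree cubes = n

end Faces

end PrecubicalSet

namespace PrecubicalSet

section Splitting

/-- The subsets `∅ ≠ A ⊊ {0, …, n - 1}`. -/
def properSubsets (n : ℕ) : Finset (Finset ℕ) :=
  (Finset.range n).powerset.filter fun A => A.Nonempty ∧ A ≠ Finset.range n

/-- The indicator word of a set, highest element first. -/
def setWord (A : Finset ℕ) : ℕ → List Bool
  | 0 => []
  | n + 1 => decide (n ∈ A) :: setWord A n

def loL (b : Bool) : Option Bool := if b then none else some false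

def hiL (b : Bool) : Option Bool := if b then some true else none

theorem length_setWord (A : Finset ℕ) (n : ℕ) : (setWord A n).length = n := by
  induction n with
  | zero => rfl
  | succ n ih => simp [setWord, ih]

theorem wordOf_lo (A : Finset ℕ) (N n : ℕ) (h : n ≤ N) :
    wordOf false (Finset.range N \ A) n = (setWord A n).map loL := by
  induction n with
  | zero => rfl
  | succ n ih =>
    have : n < N := h
    by_cases hA : n ∈ A <;> simp [wordOf, setWord, hA, ih (by omega), loL, this]

theorem wordOf_hi (A : Finset ℕ) (n : ℕ) :
    wordOf true A n = (setWord A n).map hiL := by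
  induction n with
  | zero => rfl
  | succ n ih => by_cases hA : n ∈ A <;> simp [wordOf, setWord, hA, ih, hiL]

theorem setWord_congr {A B : Finset ℕ} {n : ℕ} (h : ∀ i < n, i ∈ A ↔ i ∈ B) :
    setWord A n = setWord B n := by
  induction n with
  | zero => rfl
  | succ n ih => simp [setWord, h n (by omega), ih fun i hi => h i (by omega)]

theorem setWord_insert (A : Finset ℕ) (n : ℕ) : setWord (insert n A) n = setWord A n :=
  setWord_congr fun i hi => by simp [hi.ne]

theorem mem_true_setWord (A : Finset ℕ) (n : ℕ) :
    true ∈ setWord A n ↔ ∃ i < n, i ∈ A := by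
  induction n with
  | zero => simp [setWord]
  | succ n ih =>
    simp only [setWord, List.mem_cons, ih, Nat.lt_succ_iff_lt_or_eq]
    constructor
    · rintro (h | ⟨i, h, h'⟩)
      · exact ⟨n, Or.inr rfl, by simpa using h⟩
      · exact ⟨i, Or.inl h, h'⟩
    · rintro ⟨i, h | rfl, h'⟩
      · exact Or.inr ⟨i, h, h'⟩
      · exact Or.inl (by simpa using h')

theorem mem_false_setWord (A : Finset ℕ) (n : ℕ) :
    false ∈ setWord A n ↔ ∃ i < n, i ∉ A := by
  induction n with
  | zero => simp [setWord]
  | succ n ih =>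
    simp only [setWord, List.mem_cons, ih, Nat.lt_succ_iff_lt_or_eq]
    constructor
    · rintro (h | ⟨i, h, h'⟩)
      · exact ⟨n, Or.inr rfl, by simpa using h⟩
      · exact ⟨i, Or.inl h, h'⟩
    · rintro ⟨i, h | rfl, h'⟩
      · exact Or.inr ⟨i, h, h'⟩
      · exact Or.inl (by simpa using h')

theorem mem_properSubsets {n : ℕ} {A : Finset ℕ} (hA : A ⊆ Finset.range n) :
    A ∈ properSubsets n ↔ true ∈ setWord A n ∧ false ∈ setWord A n := by
  rw [mem_true_setWord, mem_false_setWord, properSubsets, Finset.mem_filter, Finset.mem_powerset]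
  constructor
  · rintro ⟨-, ⟨i, hi⟩, h⟩
    refine ⟨⟨i, by simpa using hA hi, hi⟩, ?_⟩
    by_contra! h'
    exact h (hA.antisymm fun i hi => h' i (by simpa using hi))
  · rintro ⟨⟨i, -, hi⟩, j, hj, hj'⟩
    exact ⟨hA, ⟨i, hi⟩, fun h => hj' (h ▸ Finset.mem_range.2 hj)⟩

theorem count_setWord {n : ℕ} {A : Finset ℕ} (hA : A ⊆ Finset.range n) :
    (setWord A n).count true = A.card := by
  induction n generalizing A with
  | zero => simp at hA; simp [hA, setWord]
  | succ n ih =>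
    have h1 : setWord A n = setWord (A.erase n) n :=
      setWord_congr fun i hi => by simp [hi.ne]
    have h2 : A.erase n ⊆ Finset.range n := fun i hi => by
      have := hA (Finset.mem_of_mem_erase hi)
      have := Finset.ne_of_mem_erase hi
      simp at *; omega
    rw [setWord, List.count_cons, h1, ih h2, Finset.card_erase_eq_ite]
    by_cases h : n ∈ A
    · have := Finset.card_pos.2 ⟨n, h⟩
      simp [h]; omega
    · simp [h]

theorem count_add (w : List Bool) : w.count true + w.count false = w.length := by
  induction w with
  | nil => rfl
  | cons b w ih => cases b <;> simp <;> omega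

theorem kept_lo (w : List Bool) : kept (w.map loL) = w.count true := by
  induction w with
  | nil => rfl
  | cons b w ih => cases b <;> simp [kept, loL] at ih ⊢ <;> omega

theorem kept_hi (w : List Bool) : kept (w.map hiL) = w.count false := by
  induction w with
  | nil => rfl
  | cons b w ih => cases b <;> simp [kept, hiL] at ih ⊢ <;> omega

variable {X : PrecubicalSet.{u}}

def lo (w : List Bool) (c : X.cube) : X.cube := X.wface (w.map loL) c

def hi (w : List Bool) (c : X.cube) : X.cube := X.wface (w.map hiL) c

theorem dim_lo {w : List Bool} {c : X.cube} (h : w.length = X.dim c) :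
    X.dim (lo w c) = w.count true := by
  have := dim_wface (X := X) (w.map loL) c (by simp [h])
  rw [kept_lo] at this
  simp at this; simp [lo]; omega

theorem dim_hi {w : List Bool} {c : X.cube} (h : w.length = X.dim c) :
    X.dim (hi w c) = w.count false := by
  have := dim_wface (X := X) (w.map hiL) c (by simp [h])
  rw [kept_hi] at this
  simp at this; simp [hi]; omega

theorem endpoint_wface (ε : Bool) (w : List (Option Bool)) (c : X.cube)
    (h : w.length = X.dim c) :
    (X.endpoint ε (X.wface w c)).1 = X.wface (w.map fun o => some (o.getD ε)) c := by
  have hd := dim_wface (X := X) w c h.le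
  have := wface_wface (X := X)
    (w.map fun o => o.elim (Sum.inl (some ε)) Sum.inr) c (by simp [h])
  change X.faces ε (Finset.range (X.dim (X.wface w c))) (X.wface w c) = _
  rw [faces_full, show X.dim (X.wface w c) = kept w by omega]
  have e1 : (w.map fun o => o.elim (Sum.inl (some ε)) Sum.inr).filterMap
      (Sum.elim some fun _ : Bool => none) = List.replicate (kept w) (some ε) := by
    clear this h hd
    induction w with
    | nil => rfl
    | cons o w ih =>
      cases o <;> simp [kept, List.filterMap_cons, List.replicate_succ] at ih ⊢ <;> exact ih
  have e2 : (w.map fun o => o.elim (Sum.inl (some ε)) Sum.inr).map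
      (Sum.elim (fun _ : Option Bool => none) some) = w := by
    clear this h hd e1
    induction w with
    | nil => rfl
    | cons o w ih => cases o <;> simp at ih ⊢ <;> exact ih
  have e3 : (w.map fun o => o.elim (Sum.inl (some ε)) Sum.inr).map
      (Sum.elim id some) = w.map fun o => some (o.getD ε) := by
    clear this h hd e1 e2
    induction w with
    | nil => rfl
    | cons o w ih => cases o <;> simp at ih ⊢ <;> exact ih
  rw [e1, e2, e3] at this
  exact this

theorem endpoint_eq (ε : Bool) (c : X.cube) :
    (X.endpoint ε c).1 = X.wface (List.replicate (X.dim c) (some ε)) c := faces_full ε c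

theorem endpoint_lo_false {w : List Bool} {c : X.cube} (h : w.length = X.dim c) :
    X.endpoint false (lo w c) = X.endpoint false c := by
  apply Subtype.ext
  rw [lo, endpoint_wface _ _ _ (by simp [h]), endpoint_eq, ← h]
  congr 1
  rw [List.map_map, List.eq_replicate_iff]
  refine ⟨by simp, fun b hb => ?_⟩
  obtain ⟨a, -, rfl⟩ := List.mem_map.1 hb
  cases a <;> rfl

theorem endpoint_hi_true {w : List Bool} {c : X.cube} (h : w.length = X.dim c) :
    X.endpoint true (hi w c) = X.endpoint true c := by
  apply Subtype.ext
  rw [hi, endpoint_wface _ _ _ (by simp [h]), endpoint_eq, ← h]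
  congr 1
  rw [List.map_map, List.eq_replicate_iff]
  refine ⟨by simp, fun b hb => ?_⟩
  obtain ⟨a, -, rfl⟩ := List.mem_map.1 hb
  cases a <;> rfl

theorem endpoint_lo_hi {w : List Bool} {c : X.cube} (h : w.length = X.dim c) :
    X.endpoint true (lo w c) = X.endpoint false (hi w c) := by
  apply Subtype.ext
  rw [hi, endpoint_wface _ _ _ (by simp [h]), lo, endpoint_wface _ _ _ (by simp [h])]
  congr 1
  rw [List.map_map, List.map_map]
  refine List.map_congr_left fun a _ => ?_
  cases a <;> rfl

theorem faces_lo (A : Finset ℕ) (c : X.cube) :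
    X.faces false (Finset.range (X.dim c) \ A) c = lo (setWord A (X.dim c)) c := by
  rw [faces, faceBelow_eq, wordOf_lo _ _ _ le_rfl, lo]

theorem faces_hi (A : Finset ℕ) (c : X.cube) :
    X.faces true A c = hi (setWord A (X.dim c)) c := by
  rw [faces, faceBelow_eq, wordOf_hi, hi]

theorem isChain_append {v w : X.Vertex} {l l' : List X.cube} :
    X.IsChain v (l ++ l') w ↔ ∃ x, X.IsChain v l x ∧ X.IsChain x l' w := by
  induction l generalizing v with
  | nil => simp [IsChain]
  | cons c l ih => simp [IsChain, ih]; tauto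

theorem degree_append (l l' : List X.cube) : X.degree (l ++ l') = X.degree l + X.degree l' := by
  simp [degree]

theorem degree_cons (c : X.cube) (l : List X.cube) :
    X.degree (c :: l) = (X.dim c - 1) + X.degree l := by
  simp [degree]

/-- The list in which `c_k` is replaced by the two cubes `d^0_{Aᶜ} c_k` and `d^1_A c_k`. -/
def splitList (l : List X.cube) (k : Fin l.length) (A : Finset ℕ) : List X.cube :=
  l.take k ++ X.faces false (Finset.range (X.dim l[k]) \ A) l[k] :: X.faces true A l[k] ::
    l.drop (k + 1)

theorem splitList_spec {v w : X.Vertex} {l : List X.cube} (hl : X.IsChain v l w)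
    (k : Fin l.length) {A : Finset ℕ} (hA : A ∈ properSubsets (X.dim l[k])) :
    X.IsChain v (splitList l k A) w ∧ X.degree (splitList l k A) + 1 = X.degree l := by
  have hs : A ⊆ Finset.range (X.dim l[k]) :=
    Finset.mem_powerset.1 (Finset.mem_filter.1 hA).1
  have hA' := (mem_properSubsets hs).1 hA
  have e : l = l.take k ++ l[k] :: l.drop (k + 1) := by simp
  have hlen := length_setWord A (X.dim l[k])
  have d1 := dim_lo (c := l[k]) hlen
  have d2 := dim_hi (c := l[k]) hlen
  have d3 := count_add (setWord A (X.dim l[k]))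
  have d4 : 0 < (setWord A (X.dim l[k])).count true := List.count_pos_iff.2 hA'.1
  have d5 : 0 < (setWord A (X.dim l[k])).count false := List.count_pos_iff.2 hA'.2
  constructor
  · rw [e, isChain_append] at hl
    obtain ⟨x, h1, h2, h3, h4⟩ := hl
    rw [splitList, faces_lo, faces_hi, isChain_append]
    refine ⟨x, h1, by omega, ?_, by omega, ?_, ?_⟩
    · rw [endpoint_lo_false hlen, h3]
    · rw [endpoint_lo_hi hlen]
    · rwa [endpoint_hi_true hlen]
  · conv_rhs => rw [e]
    rw [splitList, faces_lo, faces_hi, degree_append, degree_append, degree_cons, degree_cons,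
      degree_cons, d1, d2]
    omega

/-- The cube chain `(c₁, …, d^0_{Aᶜ} c_k, d^1_A c_k, …, c_l)`. -/
def CubeChain.split {n : ℕ} (c : X.CubeChain (n + 1)) (k : Fin c.cubes.length) (A : Finset ℕ)
    (hA : A ∈ properSubsets (X.dim c.cubes[k])) : X.CubeChain n where
  src := c.src
  tgt := c.tgt
  cubes := splitList c.cubes k A
  isChain := (splitList_spec c.isChain k hA).1
  degree_eq := by
    have := (splitList_spec c.isChain k hA).2
    have := c.degree_eq
    omega

end Splitting

section Boundary

variable (R : Type v) [CommRing R] (X : PrecubicalSet.{u})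

/-- `C_n(X)`: the free `R`-module on the `n`-dimensional cube chains. -/
abbrev Chains (n : ℕ) : Type (max u v) := X.CubeChain n →₀ R

/-- The exponent of the sign of the splitting of the `k`-th cube along `A`: it is
`(n₁ - 1) + ⋯ + (n_{k-1} - 1) + |A|` plus the number `∑_{i ∈ A} i - ∑_{i < |A|} i` (up to parity)
of inversions of the shuffle of `A` and its complement. -/
def signExp (l : List X.cube) (k : ℕ) (A : Finset ℕ) : ℕ :=
  X.degree (l.take k) + A.card + (∑ i ∈ A, i + ∑ i ∈ Finset.range A.card, i)

/-- The boundary map of the cube chain complex: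
`∂ c = ∑_k ∑_{∅ ≠ A ⊊ [n_k]} ± (c₁, …, d^0_{Aᶜ} c_k, d^1_A c_k, …, c_l)`. -/
noncomputable def boundary (n : ℕ) : X.Chains R (n + 1) →ₗ[R] X.Chains R n :=
  Finsupp.linearCombination R fun c : X.CubeChain (n + 1) =>
    ∑ k : Fin c.cubes.length, ∑ A ∈ (properSubsets (X.dim c.cubes[k])).attach,
      Finsupp.single (c.split k A.1 A.2) ((-1 : R) ^ X.signExp c.cubes k A.1)

end Boundary

end PrecubicalSet

namespace PrecubicalSet

section Square

/-- Sum over all binary words of length `n`. -/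
def wsum {M : Type*} [AddCommMonoid M] : ℕ → (List Bool → M) → M
  | 0, f => f []
  | n + 1, f => wsum n (fun w => f (true :: w)) + wsum n (fun w => f (false :: w))

/-- Sum over all ternary words of length `n`. -/
def wsum₃ {M : Type*} [AddCommMonoid M] : ℕ → (List (Fin 3) → M) → M
  | 0, f => f []
  | n + 1, f => wsum₃ n (fun w => f (0 :: w)) + wsum₃ n (fun w => f (1 :: w)) +
      wsum₃ n (fun w => f (2 :: w))

section

variable {M N : Type*} [AddCommMonoid M] [AddCommMonoid N]

theorem wsum_congr {n : ℕ} {f g : List Bool → M} (h : ∀ w, w.length = n → f w = g w) :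
    wsum n f = wsum n g := by
  induction n generalizing f g with
  | zero => exact h [] rfl
  | succ n ih =>
    rw [wsum, wsum, ih fun w hw => h _ (by simp [hw]), ih fun w hw => h _ (by simp [hw])]

theorem wsum₃_congr {n : ℕ} {f g : List (Fin 3) → M} (h : ∀ w, w.length = n → f w = g w) :
    wsum₃ n f = wsum₃ n g := by
  induction n generalizing f g with
  | zero => exact h [] rfl
  | succ n ih =>
    rw [wsum₃, wsum₃, ih fun w hw => h _ (by simp [hw]), ih fun w hw => h _ (by simp [hw]),
      ih fun w hw => h _ (by simp [hw])]

theorem wsum_add (n : ℕ) (f g : List Bool → M) :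
    wsum n (fun w => f w + g w) = wsum n f + wsum n g := by
  induction n generalizing f g with
  | zero => rfl
  | succ n ih => simp only [wsum, ih]; abel

theorem wsum₃_add (n : ℕ) (f g : List (Fin 3) → M) :
    wsum₃ n (fun w => f w + g w) = wsum₃ n f + wsum₃ n g := by
  induction n generalizing f g with
  | zero => rfl
  | succ n ih => simp only [wsum₃, ih]; abel

theorem map_wsum (φ : M →+ N) (n : ℕ) (f : List Bool → M) :
    φ (wsum n f) = wsum n fun w => φ (f w) := by
  induction n generalizing f with
  | zero => rfl
  | succ n ih => simp only [wsum, map_add, ih]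

theorem wsum₃_zero (n : ℕ) : wsum₃ n (fun _ => (0 : M)) = 0 := by
  induction n with
  | zero => rfl
  | succ n ih => simp only [wsum₃, ih, add_zero]

def in0 (i : Fin 3) : Option Bool := ![some true, some false, none] i

def in1 (i : Fin 3) : Option Bool := ![none, some true, some false] i

def out0 (i : Fin 3) : Bool := ![true, true, false] i

def out1 (i : Fin 3) : Bool := ![true, false, false] i

theorem wsum_wsum_true (n : ℕ) (G : List Bool → List Bool → M) :
    wsum n (fun w => wsum (w.count true) (G w)) =
      wsum₃ n fun v => G (v.map out0) (v.filterMap in0) := by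
  induction n generalizing G with
  | zero => rfl
  | succ n ih =>
    have h1 := ih fun w w' => G (true :: w) (true :: w')
    have h2 := ih fun w w' => G (true :: w) (false :: w')
    have h3 := ih fun w w' => G (false :: w) w'
    simp [wsum, wsum₃, wsum_add, out0, in0, List.filterMap_cons] at h1 h2 h3 ⊢
    rw [h1, h2, h3]

theorem wsum_wsum_false (n : ℕ) (G : List Bool → List Bool → M) :
    wsum n (fun w => wsum (w.count false) (G w)) =
      wsum₃ n fun v => G (v.map out1) (v.filterMap in1) := by
  induction n generalizing G with
  | zero => rfl
  | succ n ih =>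
    have h1 := ih fun w w' => G (true :: w) w'
    have h2 := ih fun w w' => G (false :: w) (true :: w')
    have h3 := ih fun w w' => G (false :: w) (false :: w')
    simp [wsum, wsum₃, wsum_add, out1, in1, List.filterMap_cons] at h1 h2 h3 ⊢
    rw [h1, h2, h3, add_assoc]

theorem sum_powerset_range (n : ℕ) (f : List Bool → M) :
    ∑ A ∈ (Finset.range n).powerset, f (setWord A n) = wsum n f := by
  induction n generalizing f with
  | zero => simp [setWord, wsum]
  | succ n ih =>
    rw [Finset.range_add_one, Finset.sum_powerset_insert (by simp), wsum, add_comm,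
      ← ih, ← ih]
    congr 1
    · refine Finset.sum_congr rfl fun A _ => ?_
      simp [setWord, setWord_insert]
    · refine Finset.sum_congr rfl fun A hA => ?_
      have : n ∉ A := fun h => by simpa using Finset.mem_powerset.1 hA h
      simp [setWord, this]

end

/-- The sign exponent of a binary word. -/
def wexp : List Bool → ℕ
  | [] => 0
  | true :: w => wexp w + 1 + w.count false
  | false :: w => wexp w

theorem neg_one_pow_congr {R : Type*} [Ring R] {a b : ℕ} (h : a % 2 = b % 2) :
    (-1 : R) ^ a = (-1) ^ b := by
  rw [neg_one_pow_eq_pow_mod_two, h, ← neg_one_pow_eq_pow_mod_two]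

theorem wexp_setWord {n : ℕ} {A : Finset ℕ} (hA : A ⊆ Finset.range n) :
    wexp (setWord A n) % 2 =
      (A.card + (∑ i ∈ A, i + ∑ i ∈ Finset.range A.card, i)) % 2 := by
  induction n generalizing A with
  | zero => simp at hA; simp [hA, setWord, wexp]
  | succ n ih =>
    have h1 : setWord A n = setWord (A.erase n) n :=
      setWord_congr fun i hi => by simp [hi.ne]
    have h2 : A.erase n ⊆ Finset.range n := fun i hi => by
      have := hA (Finset.mem_of_mem_erase hi)
      have := Finset.ne_of_mem_erase hi
      simp at *; omega
    have h3 := ih h2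
    have h4 := count_setWord h2
    have h5 := count_add (setWord (A.erase n) n)
    rw [length_setWord] at h5
    by_cases h : n ∈ A
    · have h6 := Finset.card_erase_add_one h
      have h7 := Finset.sum_erase_add A (fun i => i) h
      rw [setWord, h1, decide_eq_true h, wexp, ← h6, ← h7, Finset.sum_range_succ]
      omega
    · rw [Finset.erase_eq_of_notMem h] at h3 h1
      rw [setWord, decide_eq_false h, wexp, h3]

variable {X : PrecubicalSet.{u}}

theorem wface_pair (v : List (Fin 3)) (f : Fin 3 → Option Bool ⊕ Bool) (c : X.cube)
    (h : v.length = X.dim c) (w w' t : List (Option Bool))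
    (hw : w = v.map (Sum.elim (fun _ => none) some ∘ f))
    (hw' : w' = v.filterMap (Sum.elim some (fun _ => none) ∘ f))
    (ht : t = v.map (Sum.elim id some ∘ f)) :
    X.wface w' (X.wface w c) = X.wface t c := by
  have := wface_wface (X := X) (v.map f) c (by simp [h])
  rw [List.filterMap_map, List.map_map, List.map_map] at this
  rw [hw, hw', ht, this]

theorem map_filterMap_eq {α β γ : Type*} (v : List α) (f : α → Option β) (g : β → γ)
    (k : α → Option γ) (h : ∀ a, k a = (f a).map g) :
    (v.filterMap f).map g = v.filterMap k := by
  rw [List.map_filterMap]; congr 1; funext a; rw [h]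

def t0 (i : Fin 3) : Option Bool := ![none, some false, some false] i

def t1 (i : Fin 3) : Option Bool := ![some true, none, some false] i

def t2 (i : Fin 3) : Option Bool := ![some true, some true, none] i

theorem lo_lo (v : List (Fin 3)) (c : X.cube) (h : v.length = X.dim c) :
    lo (v.filterMap in0) (lo (v.map out0) c) = X.wface (v.map t0) c :=
  wface_pair v ![.inl none, .inl (some false), .inr false] c h _ _ _
    (by rw [List.map_map]; congr 1; funext i; fin_cases i <;> rfl)
    (map_filterMap_eq _ _ _ _ (by intro i; fin_cases i <;> rfl))
    (by congr 1; funext i; fin_cases i <;> rfl)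

theorem hi_lo (v : List (Fin 3)) (c : X.cube) (h : v.length = X.dim c) :
    hi (v.filterMap in0) (lo (v.map out0) c) = X.wface (v.map t1) c :=
  wface_pair v ![.inl (some true), .inl none, .inr false] c h _ _ _
    (by rw [List.map_map]; congr 1; funext i; fin_cases i <;> rfl)
    (map_filterMap_eq _ _ _ _ (by intro i; fin_cases i <;> rfl))
    (by congr 1; funext i; fin_cases i <;> rfl)

theorem lo_hi (v : List (Fin 3)) (c : X.cube) (h : v.length = X.dim c) :
    lo (v.filterMap in1) (hi (v.map out1) c) = X.wface (v.map t1) c :=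
  wface_pair v ![.inr true, .inl none, .inl (some false)] c h _ _ _
    (by rw [List.map_map]; congr 1; funext i; fin_cases i <;> rfl)
    (map_filterMap_eq _ _ _ _ (by intro i; fin_cases i <;> rfl))
    (by congr 1; funext i; fin_cases i <;> rfl)

theorem hi_hi (v : List (Fin 3)) (c : X.cube) (h : v.length = X.dim c) :
    hi (v.filterMap in1) (hi (v.map out1) c) = X.wface (v.map t2) c :=
  wface_pair v ![.inr true, .inl (some true), .inl none] c h _ _ _
    (by rw [List.map_map]; congr 1; funext i; fin_cases i <;> rfl)
    (map_filterMap_eq _ _ _ _ (by intro i; fin_cases i <;> rfl))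
    (by congr 1; funext i; fin_cases i <;> rfl)

theorem hi_out0 (v : List (Fin 3)) (c : X.cube) :
    hi (v.map out0) c = X.wface (v.map t2) c := by
  rw [hi, List.map_map]; congr 2; funext i; fin_cases i <;> rfl

theorem lo_out1 (v : List (Fin 3)) (c : X.cube) :
    lo (v.map out1) c = X.wface (v.map t0) c := by
  rw [lo, List.map_map]; congr 2; funext i; fin_cases i <;> rfl

theorem proper0 (v : List (Fin 3)) :
    ((true ∈ v.map out0 ∧ false ∈ v.map out0) ∧ true ∈ v.filterMap in0 ∧ false ∈ v.filterMap in0) ↔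
      (0 ∈ v ∧ 1 ∈ v ∧ 2 ∈ v) := by
  simp [Fin.exists_fin_succ, out0, in0]; tauto

theorem proper1 (v : List (Fin 3)) :
    ((true ∈ v.map out1 ∧ false ∈ v.map out1) ∧ true ∈ v.filterMap in1 ∧ false ∈ v.filterMap in1) ↔
      (0 ∈ v ∧ 1 ∈ v ∧ 2 ∈ v) := by
  simp [Fin.exists_fin_succ, out1, in1]; tauto

theorem wexp_parity (v : List (Fin 3)) :
    (wexp (v.map out0) + wexp (v.filterMap in0)) % 2 =
      (wexp (v.map out1) + wexp (v.filterMap in1) + (v.map out1).count true) % 2 := by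
  have key : ∀ v : List (Fin 3), (v.map out0).count false = v.count 2 ∧
      (v.filterMap in0).count false = v.count 1 ∧ (v.map out1).count false = v.count 1 + v.count 2 ∧
      (v.filterMap in1).count false = v.count 2 := by
    intro v
    induction v with
    | nil => simp
    | cons a v ih =>
      fin_cases a <;> simp [out0, in0, out1, in1, List.filterMap_cons] at ih ⊢ <;>
        omega
  induction v with
  | nil => rfl
  | cons a v ih =>
    have := key v
    fin_cases a <;>
      simp [out0, in0, out1, in1, List.filterMap_cons, wexp] at ih this ⊢ <;> omega

/-- The formal splitting of a cube, for cubes interpreted as elements of a ring. -/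
def fsplit {E : Type*} [Ring E] (κ : X.cube → E) (c : X.cube) : E :=
  wsum (X.dim c) fun w =>
    if true ∈ w ∧ false ∈ w then (-1) ^ wexp w * (κ (lo w c) * κ (hi w c)) else 0

theorem fsplit_fsplit {E : Type*} [Ring E] (κ : X.cube → E) (c : X.cube) :
    wsum (X.dim c) (fun w => if true ∈ w ∧ false ∈ w then
      (-1) ^ wexp w * (fsplit κ (lo w c) * κ (hi w c) +
        (-1) ^ (X.dim (lo w c) - 1) * (κ (lo w c) * fsplit κ (hi w c))) else 0) = 0 := by
  have h1 : ∀ w : List Bool, w.length = X.dim c → (if true ∈ w ∧ false ∈ w then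
      (-1) ^ wexp w * (fsplit κ (lo w c) * κ (hi w c) +
        (-1) ^ (X.dim (lo w c) - 1) * (κ (lo w c) * fsplit κ (hi w c))) else 0) =
      wsum (w.count true) (fun w' => if (true ∈ w ∧ false ∈ w) ∧ true ∈ w' ∧ false ∈ w' then
        (-1) ^ (wexp w + wexp w') *
          (κ (lo w' (lo w c)) * κ (hi w' (lo w c)) * κ (hi w c)) else 0) +
      wsum (w.count false) (fun w' => if (true ∈ w ∧ false ∈ w) ∧ true ∈ w' ∧ false ∈ w' then
        (-1) ^ (wexp w + (w.count true - 1) + wexp w') *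
          (κ (lo w c) * κ (lo w' (hi w c)) * κ (hi w' (hi w c))) else 0) := by
    intro w hw
    by_cases hp : true ∈ w ∧ false ∈ w
    · rw [if_pos hp, fsplit, fsplit, dim_lo hw, dim_hi hw, mul_add]
      congr 1
      · have := map_wsum ((AddMonoidHom.mulLeft ((-1 : E) ^ wexp w)).comp
          (AddMonoidHom.mulRight (κ (hi w c))))
        simp only [AddMonoidHom.coe_comp, Function.comp, AddMonoidHom.mulLeft, AddMonoidHom.mulRight,
          AddMonoidHom.coe_mk, ZeroHom.coe_mk] at this
        rw [this]
        refine wsum_congr fun w' _ => ?_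
        by_cases hp' : true ∈ w' ∧ false ∈ w'
        · rw [if_pos hp', if_pos ⟨hp, hp'⟩, pow_add]
          simp only [mul_assoc]
        · rw [if_neg hp', if_neg (fun h => hp' h.2)]; simp
      · have := map_wsum ((AddMonoidHom.mulLeft ((-1 : E) ^ wexp w *
          ((-1) ^ (w.count true - 1) * κ (lo w c)))))
        simp only [AddMonoidHom.mulLeft, AddMonoidHom.coe_mk, ZeroHom.coe_mk, mul_assoc] at this
        rw [this]
        refine wsum_congr fun w' _ => ?_
        by_cases hp' : true ∈ w' ∧ false ∈ w'
        · rw [if_pos hp', if_pos ⟨hp, hp'⟩, pow_add, pow_add]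
          have := ((Commute.neg_one_left (κ (lo w c))).pow_left (wexp w')).eq
          simp only [mul_assoc]
          congr 2
          rw [← mul_assoc, ← this, mul_assoc]
        · rw [if_neg hp', if_neg (fun h => hp' h.2)]; simp
    · have h2 : ∀ w' : List Bool,
          ¬ ((true ∈ w ∧ false ∈ w) ∧ true ∈ w' ∧ false ∈ w') := fun w' h => hp h.1
      have h3 : ∀ n, wsum n (fun _ : List Bool => (0 : E)) = 0 := by
        intro n
        induction n with
        | zero => rfl
        | succ n ih => simp only [wsum, ih, add_zero]
      simp only [if_neg hp, if_neg (h2 _), h3, add_zero]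
  rw [wsum_congr h1, wsum_add, wsum_wsum_true, wsum_wsum_false, ← wsum₃_add]
  refine (wsum₃_congr fun v hv => ?_).trans (wsum₃_zero (X.dim c))
  by_cases hp : 0 ∈ v ∧ 1 ∈ v ∧ 2 ∈ v
  · rw [if_pos ((proper0 v).2 hp), if_pos ((proper1 v).2 hp), lo_lo v c hv, hi_lo v c hv,
      lo_hi v c hv, hi_hi v c hv, hi_out0, lo_out1, ← add_mul]
    have e := wexp_parity v
    have hpos : 0 < (v.map out1).count true := List.count_pos_iff.2 ((proper1 v).2 hp).1.1
    have : (-1 : E) ^ (wexp (v.map out0) + wexp (v.filterMap in0)) =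
        (-1) ^ ((wexp (v.map out1) + ((v.map out1).count true - 1) + wexp (v.filterMap in1)) + 1) :=
      neg_one_pow_congr (by omega)
    rw [this, pow_succ]
    simp
  · rw [if_neg (mt (proper0 v).1 hp), if_neg (mt (proper1 v).1 hp), add_zero]

theorem neg_one_pow_mul {R E : Type*} [CommRing R] [Ring E] [Algebra R E] (n : ℕ) (x : E) :
    (-1 : E) ^ n * x = (-1 : R) ^ n • x := by
  rcases Nat.even_or_odd n with h | h <;> simp [h.neg_one_pow]

theorem fsplit_eq {R E : Type*} [CommRing R] [Ring E] [Algebra R E] (κ : X.cube → E) (c : X.cube) :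
    fsplit κ c = wsum (X.dim c) fun w =>
      if true ∈ w ∧ false ∈ w then (-1 : R) ^ wexp w • (κ (lo w c) * κ (hi w c)) else 0 := by
  simp only [fsplit, neg_one_pow_mul (R := R)]

theorem der_fsplit {R E : Type*} [CommRing R] [Ring E] [Algebra R E] (κ : X.cube → E) (D : E)
    (hD : ∀ c, D * κ c = fsplit κ c + (-1 : R) ^ (X.dim c - 1) • (κ c * D)) (c : X.cube) :
    D * fsplit κ c = (-1 : R) ^ X.dim c • (fsplit κ c * D) := by
  have h1 := map_wsum (AddMonoidHom.mulLeft D) (X.dim c)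
    (fun w => if true ∈ w ∧ false ∈ w then (-1) ^ wexp w * (κ (lo w c) * κ (hi w c)) else 0)
  have h2 := map_wsum ((AddMonoidHom.mulLeft ((-1 : E) ^ X.dim c)).comp
    (AddMonoidHom.mulRight D)) (X.dim c)
    (fun w => if true ∈ w ∧ false ∈ w then (-1) ^ wexp w * (κ (lo w c) * κ (hi w c)) else 0)
  simp only [AddMonoidHom.coe_comp, Function.comp, AddMonoidHom.mulLeft, AddMonoidHom.mulRight,
    AddMonoidHom.coe_mk, ZeroHom.coe_mk] at h1 h2
  rw [← neg_one_pow_mul]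
  refine h1.trans (Eq.trans ?_ h2.symm)
  rw [← zero_add (wsum _ fun w => (-1) ^ X.dim c * _)]
  refine Eq.trans ?_ (congrArg (· + _) (fsplit_fsplit κ c))
  rw [← wsum_add]
  refine wsum_congr fun w hw => ?_
  by_cases hp : true ∈ w ∧ false ∈ w
  · simp only [if_pos hp]
    have d1 := dim_lo hw
    have d2 := dim_hi hw
    have d3 := count_add w
    have d4 : 0 < w.count true := List.count_pos_iff.2 hp.1
    have d5 : 0 < w.count false := List.count_pos_iff.2 hp.2
    have e2 : D * (κ (lo w c) * κ (hi w c)) = fsplit κ (lo w c) * κ (hi w c) +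
        (-1 : R) ^ (X.dim (lo w c) - 1) • (κ (lo w c) * (D * κ (hi w c))) := by
      rw [← mul_assoc, hD, add_mul, smul_mul_assoc, mul_assoc (κ (lo w c))]
    have e3 : ((-1 : R) ^ (X.dim c)) =
        (-1) ^ (X.dim (lo w c) - 1) * (-1) ^ (X.dim (hi w c) - 1) := by
      rw [← pow_add]; exact neg_one_pow_congr (by omega)
    simp only [neg_one_pow_mul (R := R), mul_smul_comm, smul_mul_assoc, e2, hD (hi w c), e3, mul_add,
      smul_add, smul_smul, mul_assoc]
    rw [← add_assoc]
    congr 2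
    ring
  · simp [if_neg hp]

theorem der_der {R E : Type*} [CommRing R] [Ring E] [Algebra R E] (κ : X.cube → E) (D : E)
    (hD : ∀ c, D * κ c = fsplit κ c + (-1 : R) ^ (X.dim c - 1) • (κ c * D)) (c : X.cube) (hc : 1 ≤ X.dim c) : D * (D * κ c) = κ c * (D * D) := by
  obtain ⟨n, hn⟩ : ∃ n, X.dim c = n + 1 := ⟨X.dim c - 1, by omega⟩
  rw [hD, mul_add, der_fsplit κ D hD, hn, Nat.add_sub_cancel, mul_smul_comm, ← mul_assoc, hD, hn,
    Nat.add_sub_cancel, add_mul, smul_add, smul_mul_assoc, smul_smul, ← pow_add,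
    (Even.add_self n).neg_one_pow, one_smul, pow_succ, ← add_assoc, ← add_smul, mul_assoc]
  simp

end Square

end PrecubicalSet

namespace PrecubicalSet

section Raw

variable (R : Type v) [CommRing R] {X : PrecubicalSet.{u}}

/-- Prepending a cube, on formal linear combinations of lists of cubes. -/
noncomputable def pre (c : X.cube) : Module.End R (List X.cube →₀ R) :=
  Finsupp.lmapDomain R R (List.cons c)

theorem pre_single (c : X.cube) (l : List X.cube) (r : R) :
    pre R c (Finsupp.single l r) = Finsupp.single (c :: l) r := by
  simp [pre]

/-- The boundary of a list of cubes, recursively. -/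
noncomputable def rawList : List X.cube → (List X.cube →₀ R)
  | [] => 0
  | c :: l => fsplit (pre R) c (Finsupp.single l 1) + (-1 : R) ^ (X.dim c - 1) • pre R c (rawList l)

noncomputable def raw : Module.End R (List X.cube →₀ R) := Finsupp.linearCombination R (rawList R)

theorem raw_single (l : List X.cube) : raw R (Finsupp.single l 1) = rawList R l := by
  simp [raw]

theorem raw_pre (c : X.cube) :
    raw R * pre R c = fsplit (pre R) c + (-1 : R) ^ (X.dim c - 1) • (pre R c * raw R) := by
  refine Finsupp.lhom_ext' fun l => LinearMap.ext_ring ?_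
  simp [Module.End.mul_apply, pre_single, raw_single, rawList]

theorem raw_raw (l : List X.cube) (hl : ∀ c ∈ l, 1 ≤ X.dim c) :
    raw R (raw R (Finsupp.single l 1)) = 0 := by
  induction l with
  | nil => simp [raw_single, rawList]
  | cons c l ih =>
    have := congrArg (fun f => f (Finsupp.single l 1)) (der_der (pre R) (raw R) (raw_pre R) c (hl c (by simp)))
    simp only [Module.End.mul_apply, pre_single] at this
    rw [this, ih fun c hc => hl c (by simp [hc]), map_zero]

/-- The recursive description of the boundary agrees with the explicit formula. -/
theorem rawList_eq (l : List X.cube) :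
    rawList R l = ∑ k : Fin l.length, ∑ A ∈ properSubsets (X.dim l[k]),
      Finsupp.single (splitList l k A) ((-1 : R) ^ X.signExp l k A) := by
  induction l with
  | nil => simp [rawList]
  | cons c l ih =>
    rw [rawList]
    simp only [List.length_cons]
    rw [Fin.sum_univ_succ]
    congr 1
    · have h0 := map_wsum (M := Module.End R (List X.cube →₀ R))
        (LinearMap.applyₗ (Finsupp.single l (1 : R))).toAddMonoidHom (X.dim c)
        (fun w => if true ∈ w ∧ false ∈ w then
          (-1 : R) ^ wexp w • (pre R (lo w c) * pre R (hi w c)) else 0)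
      simp only [LinearMap.toAddMonoidHom_coe, LinearMap.applyₗ_apply_apply] at h0
      rw [fsplit_eq (R := R), h0, ← sum_powerset_range]
      have : properSubsets (X.dim c) = (Finset.range (X.dim c)).powerset.filter
          (fun A => true ∈ setWord A (X.dim c) ∧ false ∈ setWord A (X.dim c)) := by
        ext A
        by_cases hA : A ⊆ Finset.range (X.dim c)
        · rw [mem_properSubsets hA, Finset.mem_filter, Finset.mem_powerset]; tauto
        · simp [properSubsets, hA]
      change _ = ∑ A ∈ properSubsets (X.dim c), _
      rw [this, Finset.sum_filter]
      refine Finset.sum_congr rfl fun A hA => ?_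
      rw [Finset.mem_powerset] at hA
      by_cases hp : true ∈ setWord A (X.dim c) ∧ false ∈ setWord A (X.dim c)
      · rw [if_pos hp, if_pos hp]
        simp only [Module.End.mul_apply, LinearMap.smul_apply, pre_single,
          Finsupp.smul_single, smul_eq_mul, mul_one]
        congr 1
        · simp [splitList, faces_lo, faces_hi]
        · refine neg_one_pow_congr ?_
          rw [wexp_setWord hA]
          simp [signExp, degree]
      · rw [if_neg hp, if_neg hp]; rfl
    · rw [ih, map_sum, Finset.smul_sum]
      refine Finset.sum_congr rfl fun k _ => ?_
      rw [map_sum, Finset.smul_sum]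
      refine Finset.sum_congr rfl fun A hA => ?_
      rw [pre_single, Finsupp.smul_single, smul_eq_mul, ← pow_add]
      congr 2
      simp [signExp, degree, add_assoc]

/-- Lists of cubes together with endpoints. -/
abbrev Key (X : PrecubicalSet.{u}) : Type u := X.Vertex × List X.cube × X.Vertex

noncomputable def key (v w : X.Vertex) : (List X.cube →₀ R) →ₗ[R] (Key X →₀ R) :=
  Finsupp.lmapDomain R R fun l => (v, l, w)

noncomputable def toKey (n : ℕ) : X.Chains R n →ₗ[R] (Key X →₀ R) :=
  Finsupp.lmapDomain R R fun c => (c.src, c.cubes, c.tgt)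

noncomputable def rawKey : Module.End R (Key X →₀ R) :=
  Finsupp.linearCombination R fun t => key R t.1 t.2.2 (rawList R t.2.1)

theorem toKey_injective (n : ℕ) : Function.Injective (toKey R (X := X) n) := by
  refine Finsupp.mapDomain_injective fun c c' h => ?_
  simp only [Prod.mk.injEq] at h
  exact CubeChain.ext h.1 h.2.2 h.2.1

theorem toKey_single {n : ℕ} (c : X.CubeChain n) (r : R) :
    toKey R n (Finsupp.single c r) = key R c.src c.tgt (Finsupp.single c.cubes r) := by
  simp [toKey, key]

theorem rawKey_key (v w : X.Vertex) (x : List X.cube →₀ R) :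
    rawKey R (key R v w x) = key R v w (raw R x) := by
  have : rawKey R ∘ₗ key R v w = key R v w ∘ₗ raw R (X := X) := by
    refine Finsupp.lhom_ext' fun l => LinearMap.ext_ring ?_
    simp [rawKey, key, raw]
  exact congrArg (· x) this

theorem toKey_boundary_single {n : ℕ} (c : X.CubeChain (n + 1)) :
    toKey R n (X.boundary R n (Finsupp.single c 1)) =
      key R c.src c.tgt (rawList R c.cubes) := by
  rw [boundary, Finsupp.linearCombination_single, one_smul, rawList_eq, map_sum, map_sum]
  refine Finset.sum_congr rfl fun k _ => ?_
  rw [map_sum, map_sum, ← Finset.sum_attach (properSubsets (X.dim c.cubes[k]))]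
  refine Finset.sum_congr rfl fun A _ => ?_
  rw [toKey_single]
  rfl

theorem toKey_boundary (n : ℕ) (x : X.Chains R (n + 1)) :
    toKey R n (X.boundary R n x) = rawKey R (toKey R (n + 1) x) := by
  have : toKey R n ∘ₗ X.boundary R n = rawKey R ∘ₗ toKey R (n + 1) := by
    refine Finsupp.lhom_ext' fun c => LinearMap.ext_ring ?_
    simp only [LinearMap.comp_apply, Finsupp.lsingle_apply]
    rw [toKey_boundary_single, toKey_single, rawKey_key, raw_single]
  exact congrArg (· x) this

theorem IsChain.one_le_dim {v w : X.Vertex} {l : List X.cube} (h : X.IsChain v l w) :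
    ∀ c ∈ l, 1 ≤ X.dim c := by
  induction l generalizing v with
  | nil => simp
  | cons a l ih =>
    intro c hc
    rcases List.mem_cons.1 hc with rfl | hc
    · exact h.1
    · exact ih h.2.2 c hc

theorem boundary_boundary (n : ℕ) (x : X.Chains R (n + 2)) :
    X.boundary R n (X.boundary R (n + 1) x) = 0 := by
  have : X.boundary R n ∘ₗ X.boundary R (n + 1) = 0 := by
    refine Finsupp.lhom_ext' fun c => LinearMap.ext_ring (toKey_injective R n ?_)
    simp only [LinearMap.comp_apply, Finsupp.lsingle_apply]
    rw [toKey_boundary, toKey_boundary_single, rawKey_key, ← raw_single,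
      raw_raw R _ c.isChain.one_le_dim]
    simp
  exact congrArg (· x) this

end Raw

end PrecubicalSet

namespace PrecubicalSet

section Concat

variable (R : Type v) [CommRing R] {X : PrecubicalSet.{u}}

theorem IsChain.append {v x w : X.Vertex} {l l' : List X.cube} (h : X.IsChain v l x)
    (h' : X.IsChain x l' w) : X.IsChain v (l ++ l') w :=
  isChain_append.2 ⟨x, h, h'⟩

/-- Concatenation of composable cube chains. -/
def CubeChain.concat {m n k : ℕ} (hk : m + n = k) (p : X.CubeChain m) (c : X.CubeChain n)
    (h : p.tgt = c.src) : X.CubeChain k where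
  src := p.src
  tgt := c.tgt
  cubes := p.cubes ++ c.cubes
  isChain := p.isChain.append (h ▸ c.isChain)
  degree_eq := by rw [degree_append, p.degree_eq, c.degree_eq, hk]

/-- The constant path at a vertex. -/
def CubeChain.const (v : X.Vertex) : X.CubeChain 0 where
  src := v
  tgt := v
  cubes := []
  isChain := rfl
  degree_eq := rfl

open Classical in
/-- The product of two cube chains: their concatenation, or `0` if they are not composable. -/
noncomputable def concatOrZero {m n k : ℕ} (hk : m + n = k) (p : X.CubeChain m)
    (c : X.CubeChain n) : X.Chains R k :=
  if h : p.tgt = c.src then Finsupp.single (p.concat hk c h) 1 else 0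

theorem concatOrZero_pos {m n k : ℕ} (hk : m + n = k) (p : X.CubeChain m) (c : X.CubeChain n)
    (h : p.tgt = c.src) : concatOrZero R hk p c = Finsupp.single (p.concat hk c h) 1 :=
  dif_pos h

theorem concatOrZero_neg {m n k : ℕ} (hk : m + n = k) (p : X.CubeChain m) (c : X.CubeChain n)
    (h : ¬ p.tgt = c.src) : concatOrZero R hk p c = 0 :=
  dif_neg h

/-- The bilinear extension of the concatenation of cube chains. -/
noncomputable def concatLin {m n k : ℕ} (hk : m + n = k) :
    X.Chains R m →ₗ[R] X.Chains R n →ₗ[R] X.Chains R k :=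
  Finsupp.linearCombination R fun p => Finsupp.linearCombination R fun c => concatOrZero R hk p c

theorem concatLin_single {m n k : ℕ} (hk : m + n = k) (p : X.CubeChain m) (c : X.CubeChain n) :
    concatLin R hk (Finsupp.single p 1) (Finsupp.single c 1) = concatOrZero R hk p c := by
  simp [concatLin]

theorem concatLin_assoc {a b c ab bc abc : ℕ} (h1 : a + b = ab) (h2 : ab + c = abc)
    (h3 : b + c = bc) (h4 : a + bc = abc) (x : X.Chains R a) (y : X.Chains R b)
    (z : X.Chains R c) :
    concatLin R h2 (concatLin R h1 x y) z = concatLin R h4 x (concatLin R h3 y z) := by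
  induction x using Finsupp.induction_linear with
  | zero => simp
  | add f g hf hg => simp [hf, hg]
  | single p r =>
    induction y using Finsupp.induction_linear with
    | zero => simp
    | add f g hf hg => simp [hf, hg]
    | single q s =>
      induction z using Finsupp.induction_linear with
      | zero => simp
      | add f g hf hg => simp only [map_add, hf, hg]
      | single t u =>
        rw [← mul_one r, ← mul_one s, ← mul_one u, ← smul_eq_mul, ← smul_eq_mul, ← smul_eq_mul,
          ← Finsupp.smul_single, ← Finsupp.smul_single, ← Finsupp.smul_single]
        simp only [map_smul, LinearMap.smul_apply, concatLin_single]
        congr 3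
        by_cases hpq : p.tgt = q.src <;> by_cases hqt : q.tgt = t.src
        · rw [concatOrZero_pos R h1 p q hpq, concatOrZero_pos R h3 q t hqt, concatLin_single,
            concatLin_single, concatOrZero_pos R h2 (p.concat h1 q hpq) t hqt,
            concatOrZero_pos R h4 p (q.concat h3 t hqt) hpq]
          congr 1
          simp [CubeChain.concat]
        · rw [concatOrZero_pos R h1 p q hpq, concatOrZero_neg R h3 q t hqt, concatLin_single,
            concatOrZero_neg R h2 (p.concat h1 q hpq) t hqt, map_zero]
        · rw [concatOrZero_neg R h1 p q hpq, concatOrZero_pos R h3 q t hqt, concatLin_single,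
            concatOrZero_neg R h4 p (q.concat h3 t hqt) hpq, map_zero, LinearMap.zero_apply]
        · rw [concatOrZero_neg R h1 p q hpq, concatOrZero_neg R h3 q t hqt, map_zero, map_zero,
            LinearMap.zero_apply]

noncomputable instance [Finite X.cube] : Fintype X.Vertex :=
  haveI : Finite X.Vertex := Subtype.finite
  Fintype.ofFinite _

/-- The sum of the constant paths at all vertices. -/
noncomputable def constSum [Finite X.cube] : X.Chains R 0 :=
  ∑ v : X.Vertex, Finsupp.single (CubeChain.const v) 1

theorem constSum_concat [Finite X.cube] {n : ℕ} (h : 0 + n = n) (x : X.Chains R n) :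
    concatLin R h (constSum R) x = x := by
  induction x using Finsupp.induction_linear with
  | zero => simp
  | add f g hf hg => simp only [map_add, hf, hg]
  | single c r =>
    rw [← mul_one r, ← smul_eq_mul, ← Finsupp.smul_single, map_smul, constSum, map_sum,
      LinearMap.sum_apply]
    congr 1
    simp only [concatLin_single]
    rw [Finset.sum_eq_single c.src]
    · rw [concatOrZero_pos R h (CubeChain.const c.src) c rfl]
      congr 1
    · intro v _ hv
      rw [concatOrZero_neg R h (CubeChain.const v) c hv]
    · intro h; exact absurd (Finset.mem_univ _) h

theorem concat_constSum [Finite X.cube] {n : ℕ} (h : n + 0 = n) (x : X.Chains R n) :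
    concatLin R h x (constSum R) = x := by
  induction x using Finsupp.induction_linear with
  | zero => simp
  | add f g hf hg => simp only [map_add, LinearMap.add_apply, hf, hg]
  | single c r =>
    rw [← mul_one r, ← smul_eq_mul, ← Finsupp.smul_single, map_smul, LinearMap.smul_apply,
      constSum, map_sum]
    congr 1
    simp only [concatLin_single]
    rw [Finset.sum_eq_single c.tgt]
    · rw [concatOrZero_pos R h c (CubeChain.const c.tgt) rfl]
      congr 1
      exact CubeChain.ext rfl rfl (List.append_nil _)
    · intro v _ hv
      rw [concatOrZero_neg R h c (CubeChain.const v) (Ne.symm hv)]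
    · intro h; exact absurd (Finset.mem_univ _) h

/-! Compatibility of the boundary with concatenation by edge paths. -/

theorem dim_eq_one {v w : X.Vertex} {l : List X.cube} (h : X.IsChain v l w)
    (h0 : X.degree l = 0) : ∀ c ∈ l, X.dim c = 1 := by
  intro c hc
  have h1 := h.one_le_dim c hc
  have h2 : X.dim c - 1 = 0 :=
    List.sum_eq_zero_iff.1 h0 _ (List.mem_map.2 ⟨c, hc, rfl⟩)
  omega

theorem fsplit_edge {E : Type*} [Ring E] (κ : X.cube → E) {c : X.cube} (hc : X.dim c = 1) :
    fsplit κ c = 0 := by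
  rw [fsplit, hc]
  simp [wsum]

theorem rawList_append_left (p l : List X.cube) (hp : ∀ c ∈ p, X.dim c = 1) :
    rawList R (p ++ l) = Finsupp.lmapDomain R R (fun l' => p ++ l') (rawList R l) := by
  induction p with
  | nil =>
    rw [List.nil_append]
    exact (Finsupp.mapDomain_id).symm
  | cons c p ih =>
    rw [List.cons_append, rawList, fsplit_edge _ (hp c (by simp)), hp c (by simp),
      ih fun c hc => hp c (by simp [hc])]
    simp only [LinearMap.zero_apply, zero_add, Nat.sub_self, pow_zero, one_smul, pre]
    rw [← LinearMap.comp_apply, ← Finsupp.lmapDomain_comp]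
    rfl

theorem commute_fsplit {E : Type*} [Ring E] (κ : X.cube → E) (D : E)
    (hD : ∀ c, D * κ c = κ c * D) (c : X.cube) : D * fsplit κ c = fsplit κ c * D := by
  have h1 := map_wsum (AddMonoidHom.mulLeft D) (X.dim c)
    (fun w => if true ∈ w ∧ false ∈ w then (-1) ^ wexp w * (κ (lo w c) * κ (hi w c)) else 0)
  have h2 := map_wsum (AddMonoidHom.mulRight D) (X.dim c)
    (fun w => if true ∈ w ∧ false ∈ w then (-1) ^ wexp w * (κ (lo w c) * κ (hi w c)) else 0)
  refine h1.trans (Eq.trans ?_ h2.symm)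
  refine wsum_congr fun w _ => ?_
  simp only [AddMonoidHom.mulLeft, AddMonoidHom.mulRight, AddMonoidHom.coe_mk, ZeroHom.coe_mk]
  split_ifs
  · have := ((Commute.neg_one_left D).pow_left (wexp w)).eq
    rw [← mul_assoc, ← this, mul_assoc, mul_assoc, ← mul_assoc D, hD, mul_assoc, hD]
    simp only [mul_assoc]
  · simp

theorem rawList_append_right (l p : List X.cube) (hp : ∀ c ∈ p, X.dim c = 1) :
    rawList R (l ++ p) = Finsupp.lmapDomain R R (fun l' => l' ++ p) (rawList R l) := by
  induction l with
  | nil =>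
    rw [List.nil_append]
    have := rawList_append_left R p [] hp
    rw [List.append_nil] at this
    rw [this]
    simp [rawList]
  | cons c l ih =>
    set P : Module.End R (List X.cube →₀ R) := Finsupp.lmapDomain R R (fun l' => l' ++ p)
    have hP : ∀ c, P * pre R c = pre R c * P := by
      intro c
      refine Finsupp.lhom_ext' fun l => LinearMap.ext_ring ?_
      simp [P, pre, Module.End.mul_apply]
    have h1 : P (fsplit (pre R) c (Finsupp.single l 1)) =
        fsplit (pre R) c (Finsupp.single (l ++ p) 1) := by
      have := congrArg (fun f => f (Finsupp.single l 1)) (commute_fsplit (pre R) P hP c)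
      simp only [Module.End.mul_apply] at this
      rw [this]; simp [P]
    have h2 : P (pre R c (rawList R l)) = pre R c (P (rawList R l)) :=
      congrArg (fun f => f (rawList R l)) (hP c)
    rw [List.cons_append, rawList, rawList, map_add, map_smul, h1, h2, ih]

open Classical in
theorem boundary_concat_left {n : ℕ} (a : X.Chains R 0) (x : X.Chains R (n + 1))
    (h : 0 + (n + 1) = n + 1) (h' : 0 + n = n) :
    X.boundary R n (concatLin R h a x) = concatLin R h' a (X.boundary R n x) := by
  induction a using Finsupp.induction_linear with
  | zero => simp
  | add f g hf hg => simp only [map_add, LinearMap.add_apply, hf, hg]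
  | single p r =>
    rw [← mul_one r, ← smul_eq_mul, ← Finsupp.smul_single]
    simp only [map_smul, LinearMap.smul_apply]
    congr 1
    let L : Module.End R (Key X →₀ R) := Finsupp.linearCombination R fun t =>
      if p.tgt = t.1 then Finsupp.single (p.src, p.cubes ++ t.2.1, t.2.2) 1 else 0
    have hL : ∀ (m : ℕ) (hm : 0 + m = m) (y : X.Chains R m),
        toKey R m (concatLin R hm (Finsupp.single p 1) y) = L (toKey R m y) := by
      intro m hm y
      have : toKey R m ∘ₗ concatLin R hm (Finsupp.single p 1) = L ∘ₗ toKey R m := by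
        refine Finsupp.lhom_ext' fun c => LinearMap.ext_ring ?_
        simp only [LinearMap.comp_apply, Finsupp.lsingle_apply, concatLin_single]
        by_cases hc : p.tgt = c.src
        · rw [concatOrZero, dif_pos hc]
          simp [toKey, L, hc, CubeChain.concat]
        · rw [concatOrZero, dif_neg hc]
          simp [toKey, L, hc]
      exact congrArg (· y) this
    apply toKey_injective R n
    rw [hL]
    suffices X.boundary R n ∘ₗ concatLin R h (Finsupp.single p 1) =
        concatLin R h' (Finsupp.single p 1) ∘ₗ X.boundary R n by
      rw [← hL]; exact congrArg (fun f => toKey R n (f x)) this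
    refine Finsupp.lhom_ext' fun c => LinearMap.ext_ring (toKey_injective R n ?_)
    simp only [LinearMap.comp_apply, Finsupp.lsingle_apply, concatLin_single]
    rw [hL, toKey_boundary_single]
    have hLk : ∀ y, L (key R c.src c.tgt y) = if p.tgt = c.src then
        key R p.src c.tgt (Finsupp.lmapDomain R R (fun l' => p.cubes ++ l') y) else 0 := by
      intro y
      induction y using Finsupp.induction_linear with
      | zero => simp
      | add f g hf hg => simp only [map_add, hf, hg]; split_ifs <;> simp
      | single l r => by_cases hc : p.tgt = c.src <;> simp [key, L, hc]
    rw [hLk]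
    by_cases hc : p.tgt = c.src
    · rw [concatOrZero, dif_pos hc, if_pos hc, toKey_boundary_single,
        ← rawList_append_left R _ _ (dim_eq_one p.isChain p.degree_eq)]
      rfl
    · rw [concatOrZero, dif_neg hc, if_neg hc]; simp

open Classical in
theorem boundary_concat_right {n : ℕ} (a : X.Chains R 0) (x : X.Chains R (n + 1))
    (h : n + 1 + 0 = n + 1) (h' : n + 0 = n) :
    X.boundary R n (concatLin R h x a) = concatLin R h' (X.boundary R n x) a := by
  induction a using Finsupp.induction_linear with
  | zero => simp
  | add f g hf hg => simp only [map_add, hf, hg]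
  | single p r =>
    rw [← mul_one r, ← smul_eq_mul, ← Finsupp.smul_single]
    simp only [map_smul]
    congr 1
    let L : Module.End R (Key X →₀ R) := Finsupp.linearCombination R fun t =>
      if t.2.2 = p.src then Finsupp.single (t.1, t.2.1 ++ p.cubes, p.tgt) 1 else 0
    have hL : ∀ (m : ℕ) (hm : m + 0 = m) (y : X.Chains R m),
        toKey R m (concatLin R hm y (Finsupp.single p 1)) = L (toKey R m y) := by
      intro m hm y
      have : toKey R m ∘ₗ (concatLin R hm).flip (Finsupp.single p 1) = L ∘ₗ toKey R m := by
        refine Finsupp.lhom_ext' fun c => LinearMap.ext_ring ?_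
        simp only [LinearMap.comp_apply, Finsupp.lsingle_apply, LinearMap.flip_apply,
          concatLin_single]
        by_cases hc : c.tgt = p.src
        · rw [concatOrZero, dif_pos hc]
          simp [toKey, L, hc, CubeChain.concat]
        · rw [concatOrZero, dif_neg hc]
          simp [toKey, L, hc]
      exact congrArg (· y) this
    suffices X.boundary R n ∘ₗ (concatLin R h).flip (Finsupp.single p 1) =
        (concatLin R h').flip (Finsupp.single p 1) ∘ₗ X.boundary R n from
      congrArg (fun f => f x) this
    refine Finsupp.lhom_ext' fun c => LinearMap.ext_ring (toKey_injective R n ?_)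
    simp only [LinearMap.comp_apply, Finsupp.lsingle_apply, LinearMap.flip_apply,
      concatLin_single]
    rw [hL, toKey_boundary_single]
    have hLk : ∀ y, L (key R c.src c.tgt y) = if c.tgt = p.src then
        key R c.src p.tgt (Finsupp.lmapDomain R R (fun l' => l' ++ p.cubes) y) else 0 := by
      intro y
      induction y using Finsupp.induction_linear with
      | zero => simp
      | add f g hf hg => simp only [map_add, hf, hg]; split_ifs <;> simp
      | single l r => by_cases hc : c.tgt = p.src <;> simp [key, L, hc]
    rw [hLk]
    by_cases hc : c.tgt = p.src
    · rw [concatOrZero, dif_pos hc, if_pos hc, toKey_boundary_single,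
        ← rawList_append_right R _ _ (dim_eq_one p.isChain p.degree_eq)]
      rfl
    · rw [concatOrZero, dif_neg hc, if_neg hc]; simp

end Concat

end PrecubicalSet

/-! ### Bimodules over algebras and their chain complexes -/

/-- An `A`-`B`-bimodule over `R`-algebras `A` and `B`: an `R`-module with commuting `R`-linear
actions of `A` on the left and of `B` on the right. The right action of `b` is
`right (MulOpposite.op b)`. -/
structure Bimodule (R : Type*) [CommRing R] (A : Type*) [Ring A] [Algebra R A] (B : Type*) [Ring B]
    [Algebra R B] where
  carrier : Type w
  [addCommGroup : AddCommGroup carrier]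
  [module : Module R carrier]
  left : A →ₐ[R] Module.End R carrier
  right : Bᵐᵒᵖ →ₐ[R] Module.End R carrier
  comm : ∀ a b m, left a (right b m) = right b (left a m)

attribute [instance] Bimodule.addCommGroup Bimodule.module

namespace Bimodule

variable {R : Type*} [CommRing R] {A A' B B' : Type*} [Ring A] [Algebra R A] [Ring A']
  [Algebra R A'] [Ring B] [Algebra R B] [Ring B'] [Algebra R B']

/-- Isomorphisms of `A`-`B`-bimodules. -/
structure Iso (M : Bimodule.{u} R A B) (N : Bimodule.{v} R A B) where
  toEquiv : M.carrier ≃ₗ[R] N.carrier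
  map_left : ∀ a m, toEquiv (M.left a m) = N.left a (toEquiv m)
  map_right : ∀ b m, toEquiv (M.right b m) = N.right b (toEquiv m)

/-- Restriction of scalars on the left and on the right. -/
def restrict (f : A' →ₐ[R] A) (g : B' →ₐ[R] B) (M : Bimodule.{w} R A B) :
    Bimodule.{w} R A' B' where
  carrier := M.carrier
  left := M.left.comp f
  right := M.right.comp (AlgHom.op g)
  comm _ _ m := M.comm _ _ m

/-- The componentwise action `(a ⊗ a') (m ⊗ n) = a m ⊗ a' n` on a tensor product. -/
noncomputable def tensorAct {M N : Type*} [AddCommGroup M] [Module R M] [AddCommGroup N]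
    [Module R N] (f : A →ₐ[R] Module.End R M) (g : A' →ₐ[R] Module.End R N) :
    A ⊗[R] A' →ₐ[R] Module.End R (M ⊗[R] N) :=
  (Module.endTensorEndAlgHom (R := R) (S := R) (A := R)).comp (Algebra.TensorProduct.map f g)

theorem tensorAct_tmul {M N : Type*} [AddCommGroup M] [Module R M] [AddCommGroup N]
    [Module R N] (f : A →ₐ[R] Module.End R M) (g : A' →ₐ[R] Module.End R N) (a : A) (a' : A')
    (m : M) (n : N) : tensorAct f g (a ⊗ₜ a') (m ⊗ₜ n) = f a m ⊗ₜ g a' n := by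
  change (Module.endTensorEndAlgHom (R := R) (S := R) (A := R)
    (Algebra.TensorProduct.map f g (a ⊗ₜ a'))) (m ⊗ₜ n) = _
  rw [Algebra.TensorProduct.map_tmul, Module.endTensorEndAlgHom_apply]
  rfl

/-- The external tensor product of bimodules, with the componentwise actions. -/
noncomputable def tensor (M : Bimodule.{u} R A B) (N : Bimodule.{v} R A' B') :
    Bimodule.{max u v} R (A ⊗[R] A') (B ⊗[R] B') where
  carrier := M.carrier ⊗[R] N.carrier
  left := tensorAct M.left N.left
  right := (tensorAct M.right N.right).comp
    (Algebra.TensorProduct.opAlgEquiv R R B B').symm.toAlgHom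
  comm a b m := by
    induction b using MulOpposite.rec' with | _ b
    induction a using TensorProduct.induction_on with
    | zero => simp
    | add a a' h h' => simp only [map_add, LinearMap.add_apply, h, h']
    | tmul a a' =>
      induction b using TensorProduct.induction_on with
      | zero => simp
      | add b b' h h' => simp only [MulOpposite.op_add, map_add, LinearMap.add_apply, h, h']
      | tmul b b' =>
        induction m using TensorProduct.induction_on with
        | zero => simp
        | add m m' h h' => simp only [map_add, h, h']
        | tmul m m' =>
          change tensorAct M.left N.left (a ⊗ₜ a') (tensorAct M.right N.right
            (MulOpposite.op b ⊗ₜ MulOpposite.op b') (m ⊗ₜ m')) =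
            tensorAct M.right N.right (MulOpposite.op b ⊗ₜ MulOpposite.op b')
              (tensorAct M.left N.left (a ⊗ₜ a') (m ⊗ₜ m'))
          simp only [tensorAct_tmul, M.comm, N.comm]

theorem tensor_left_tmul (M : Bimodule.{u} R A B) (N : Bimodule.{v} R A' B') (a : A) (a' : A')
    (m : M.carrier) (n : N.carrier) :
    (M.tensor N).left (a ⊗ₜ a') (m ⊗ₜ[R] n : M.carrier ⊗[R] N.carrier) =
      (M.left a m ⊗ₜ[R] N.left a' n : M.carrier ⊗[R] N.carrier) :=
  tensorAct_tmul _ _ _ _ _ _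

theorem tensor_right_tmul (M : Bimodule.{u} R A B) (N : Bimodule.{v} R A' B') (b : B) (b' : B')
    (m : M.carrier) (n : N.carrier) :
    (M.tensor N).right (MulOpposite.op (b ⊗ₜ b')) (m ⊗ₜ[R] n : M.carrier ⊗[R] N.carrier) =
      (M.right (MulOpposite.op b) m ⊗ₜ[R] N.right (MulOpposite.op b') n :
        M.carrier ⊗[R] N.carrier) :=
  tensorAct_tmul M.right N.right (MulOpposite.op b) (MulOpposite.op b') m n

section DirectSum

variable {ι : Type} [DecidableEq ι] (M : ι → Bimodule.{w} R A B)

/-- The algebra homomorphism by which an algebra acts componentwise on a direct sum. -/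
noncomputable def directSumAct {N : ι → Type w} [∀ i, AddCommGroup (N i)] [∀ i, Module R (N i)]
    {E : Type*} [Ring E] [Algebra R E] (f : ∀ i, E →ₐ[R] Module.End R (N i)) :
    E →ₐ[R] Module.End R (⨁ i, N i) :=
  AlgHom.ofLinearMap
    { toFun := fun a => DirectSum.lmap fun i => f i a
      map_add' := fun a b => by
        refine DirectSum.linearMap_ext R fun i => LinearMap.ext fun x => ?_
        simp [map_add]
      map_smul' := fun r a => by
        refine DirectSum.linearMap_ext R fun i => LinearMap.ext fun x => ?_
        simp }
    (by
      refine DirectSum.linearMap_ext R fun i => LinearMap.ext fun x => ?_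
      simp)
    (fun a b => by
      refine DirectSum.linearMap_ext R fun i => LinearMap.ext fun x => ?_
      simp [Module.End.mul_apply])

theorem directSumAct_lof {N : ι → Type w} [∀ i, AddCommGroup (N i)] [∀ i, Module R (N i)]
    {E : Type*} [Ring E] [Algebra R E] (f : ∀ i, E →ₐ[R] Module.End R (N i)) (a : E) (i : ι)
    (x : N i) :
    directSumAct f a (DirectSum.lof R ι N i x) = DirectSum.lof R ι N i (f i a x) :=
  DirectSum.lmap_lof _ _ _

/-- The direct sum of a family of bimodules. -/
noncomputable def directSum : Bimodule.{w} R A B where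
  carrier := ⨁ i, (M i).carrier
  left := directSumAct fun i => (M i).left
  right := directSumAct fun i => (M i).right
  comm a b m := by
    have : directSumAct (fun i => (M i).left) a ∘ₗ directSumAct (fun i => (M i).right) b =
        directSumAct (fun i => (M i).right) b ∘ₗ directSumAct (fun i => (M i).left) a := by
      refine DirectSum.linearMap_ext R fun i => LinearMap.ext fun x => ?_
      simp [directSumAct_lof, (M i).comm]
    exact congrArg (· m) this

end DirectSum

/-- The map `Z / (B ∩ Z) → Z' / (B' ∩ Z')` induced by a linear map. -/
def subquotMap {M N : Type*} [AddCommGroup M] [Module R M] [AddCommGroup N] [Module R N]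
    {Z B : Submodule R M} {Z' B' : Submodule R N} (f : M →ₗ[R] N) (hZ : ∀ x ∈ Z, f x ∈ Z')
    (hB : ∀ x ∈ B, f x ∈ B') : (Z ⧸ B.submoduleOf Z) →ₗ[R] (Z' ⧸ B'.submoduleOf Z') :=
  Submodule.mapQ _ _ (f.restrict hZ) fun x hx => hB x hx

theorem subquotMap_mk {M N : Type*} [AddCommGroup M] [Module R M] [AddCommGroup N] [Module R N]
    {Z B : Submodule R M} {Z' B' : Submodule R N} (f : M →ₗ[R] N) (hZ : ∀ x ∈ Z, f x ∈ Z')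
    (hB : ∀ x ∈ B, f x ∈ B') (x : Z) :
    subquotMap f hZ hB (Submodule.Quotient.mk x) = Submodule.Quotient.mk (f.restrict hZ x) := rfl

theorem subquot_ext {M N : Type*} [AddCommGroup M] [Module R M] [AddCommGroup N] [Module R N]
    {Z B : Submodule R M} {f g : (Z ⧸ B.submoduleOf Z) →ₗ[R] N}
    (h : ∀ x : Z, f (Submodule.Quotient.mk x) = g (Submodule.Quotient.mk x)) : f = g :=
  LinearMap.ext fun x => by obtain ⟨x, rfl⟩ := Submodule.Quotient.mk_surjective _ x; exact h x

/-- The action of an algebra on a subquotient of a module by invariant submodules. -/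
noncomputable def subquotAct {M : Type*} [AddCommGroup M] [Module R M] {E : Type*} [Ring E]
    [Algebra R E] (f : E →ₐ[R] Module.End R M) {Z B : Submodule R M}
    (hZ : ∀ a, ∀ x ∈ Z, f a x ∈ Z) (hB : ∀ a, ∀ x ∈ B, f a x ∈ B) :
    E →ₐ[R] Module.End R (Z ⧸ B.submoduleOf Z) :=
  AlgHom.ofLinearMap
    { toFun := fun a => subquotMap (f a) (hZ a) (hB a)
      map_add' := fun a b => subquot_ext fun x => by
        simp only [LinearMap.add_apply, subquotMap_mk, ← Submodule.Quotient.mk_add]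
        congr 1; ext; simp
      map_smul' := fun r a => subquot_ext fun x => by
        simp only [LinearMap.smul_apply, subquotMap_mk, RingHom.id_apply,
          ← Submodule.Quotient.mk_smul]
        congr 1; ext; simp }
    (subquot_ext fun x => by
      simp only [LinearMap.coe_mk, AddHom.coe_mk, subquotMap_mk, Module.End.one_apply]
      congr 1; ext; simp)
    (fun a b => subquot_ext fun x => by
      simp only [LinearMap.coe_mk, AddHom.coe_mk, subquotMap_mk, Module.End.mul_apply]
      congr 1; ext; simp)

end Bimodule

/-- Chain complexes `⋯ → M₂ → M₁ → M₀` of `A`-`B`-bimodules. -/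
structure BimoduleComplex (R : Type*) [CommRing R] (A : Type*) [Ring A] [Algebra R A] (B : Type*)
    [Ring B] [Algebra R B] where
  obj : ℕ → Bimodule.{w} R A B
  d : ∀ n, (obj (n + 1)).carrier →ₗ[R] (obj n).carrier
  d_left : ∀ n a x, d n ((obj (n + 1)).left a x) = (obj n).left a (d n x)
  d_right : ∀ n b x, d n ((obj (n + 1)).right b x) = (obj n).right b (d n x)
  d_d : ∀ n x, d n (d (n + 1) x) = 0

namespace BimoduleComplex

variable {R : Type*} [CommRing R] {A A' B B' : Type*} [Ring A] [Algebra R A] [Ring A']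
  [Algebra R A'] [Ring B] [Algebra R B] [Ring B'] [Algebra R B']

/-- The cycles in degree `n` (everything in degree `0`). -/
def cycles (K : BimoduleComplex.{w} R A B) : ∀ n, Submodule R (K.obj n).carrier
  | 0 => ⊤
  | n + 1 => LinearMap.ker (K.d n)

/-- The boundaries in degree `n`. -/
def boundaries (K : BimoduleComplex.{w} R A B) (n : ℕ) : Submodule R (K.obj n).carrier :=
  LinearMap.range (K.d n)

/-- The `n`-th homology bimodule `cycles / boundaries`. -/
noncomputable def homology (K : BimoduleComplex.{w} R A B) (n : ℕ) : Bimodule.{w} R A B where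
  carrier := K.cycles n ⧸ (K.boundaries n).submoduleOf (K.cycles n)
  left := Bimodule.subquotAct (K.obj n).left
    (fun a x hx => by
      cases n with
      | zero => trivial
      | succ n =>
        have : K.d n x = 0 := hx
        change K.d n _ = 0
        rw [K.d_left, this, map_zero])
    (fun a x ⟨y, hy⟩ => ⟨(K.obj (n + 1)).left a y, by rw [K.d_left, hy]⟩)
  right := Bimodule.subquotAct (K.obj n).right
    (fun a x hx => by
      cases n with
      | zero => trivial
      | succ n =>
        have : K.d n x = 0 := hx
        change K.d n _ = 0
        rw [K.d_right, this, map_zero])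
    (fun a x ⟨y, hy⟩ => ⟨(K.obj (n + 1)).right a y, by rw [K.d_right, hy]⟩)
  comm a b m := by
    obtain ⟨x, rfl⟩ := Submodule.Quotient.mk_surjective _ m
    refine congrArg Submodule.Quotient.mk (Subtype.ext ?_)
    exact (K.obj n).comm a b x.1

/-- The (`R`-linear) chain maps between complexes of bimodules, possibly over different algebras. -/
structure ChainMap (K : BimoduleComplex.{u} R A B) (L : BimoduleComplex.{v} R A' B') where
  f : ∀ n, (K.obj n).carrier →ₗ[R] (L.obj n).carrier
  comm : ∀ n x, f n (K.d n x) = L.d n (f (n + 1) x)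

/-- The map induced in homology by a chain map. -/
def ChainMap.homologyMap {K : BimoduleComplex.{u} R A B} {L : BimoduleComplex.{v} R A' B'}
    (φ : ChainMap K L) (n : ℕ) : (K.homology n).carrier →ₗ[R] (L.homology n).carrier :=
  Bimodule.subquotMap (φ.f n)
    (fun x hx => by
      cases n with
      | zero => trivial
      | succ n =>
        have : K.d n x = 0 := hx
        change L.d n _ = 0
        rw [← φ.comm, this, map_zero])
    (fun x ⟨y, hy⟩ => ⟨φ.f (n + 1) y, by rw [← φ.comm, hy]⟩)

section Tensor

/-- The pairs `(p, q)` with `p + q = n`. -/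
abbrev Bideg (n : ℕ) : Type := {pq : ℕ × ℕ // pq.1 + pq.2 = n}

variable (K : BimoduleComplex.{u} R A B) (L : BimoduleComplex.{v} R A' B')

/-- `(K ⊗ L)_n = ⨁_{p + q = n} K_p ⊗ L_q`. -/
noncomputable def tensorObj (n : ℕ) : Bimodule.{max u v} R (A ⊗[R] A') (B ⊗[R] B') :=
  Bimodule.directSum fun pq : Bideg n => (K.obj pq.1.1).tensor (L.obj pq.1.2)

/-- The inclusion of `K_p ⊗ L_q` into `(K ⊗ L)_n`. -/
noncomputable def tensorIn (n p q : ℕ) (h : p + q = n) :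
    (K.obj p).carrier ⊗[R] (L.obj q).carrier →ₗ[R] (tensorObj K L n).carrier :=
  DirectSum.lof R (Bideg n) (fun pq => (K.obj pq.1.1).carrier ⊗[R] (L.obj pq.1.2).carrier)
    ⟨(p, q), h⟩

/-- The component `d ⊗ 1` of the differential of `K ⊗ L`. -/
noncomputable def tensorD₁ (n : ℕ) : ∀ p q : ℕ, p + q = n + 1 →
    ((K.obj p).carrier ⊗[R] (L.obj q).carrier →ₗ[R] (tensorObj K L n).carrier)
  | 0, _, _ => 0
  | p + 1, q, h => tensorIn K L n p q (by omega) ∘ₗ (K.d p).rTensor (L.obj q).carrier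

/-- The component `1 ⊗ d` of the differential of `K ⊗ L`. -/
noncomputable def tensorD₂ (n : ℕ) : ∀ p q : ℕ, p + q = n + 1 →
    ((K.obj p).carrier ⊗[R] (L.obj q).carrier →ₗ[R] (tensorObj K L n).carrier)
  | _, 0, _ => 0
  | p, q + 1, h => tensorIn K L n p q (by omega) ∘ₗ (L.d q).lTensor (K.obj p).carrier

/-- The differential `d (x ⊗ y) = d x ⊗ y + (-1)^p x ⊗ d y` for `x ∈ K_p`, `y ∈ L_q`. -/
noncomputable def tensorD (n : ℕ) :
    (tensorObj K L (n + 1)).carrier →ₗ[R] (tensorObj K L n).carrier :=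
  DirectSum.toModule R (Bideg (n + 1)) _ fun pq =>
    tensorD₁ K L n pq.1.1 pq.1.2 pq.2 + (-1 : R) ^ pq.1.1 • tensorD₂ K L n pq.1.1 pq.1.2 pq.2

variable {K L}

theorem tensorD_in (n p q : ℕ) (h : p + q = n + 1) (x : (K.obj p).carrier ⊗[R] (L.obj q).carrier) :
    tensorD K L n (tensorIn K L (n + 1) p q h x) =
      tensorD₁ K L n p q h x + (-1 : R) ^ p • tensorD₂ K L n p q h x :=
  DirectSum.toModule_lof R _ _

theorem tensor_ext {n : ℕ} {N : Type*} [AddCommGroup N] [Module R N]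
    {f g : (tensorObj K L n).carrier →ₗ[R] N}
    (h : ∀ p q hpq x y, f (tensorIn K L n p q hpq (x ⊗ₜ y)) =
      g (tensorIn K L n p q hpq (x ⊗ₜ y))) : f = g :=
  DirectSum.linearMap_ext R fun pq => TensorProduct.ext' fun x y => h pq.1.1 pq.1.2 pq.2 x y

theorem tensorObj_left_in (n p q : ℕ) (h : p + q = n) (a : A) (a' : A')
    (x : (K.obj p).carrier) (y : (L.obj q).carrier) :
    (tensorObj K L n).left (a ⊗ₜ a') (tensorIn K L n p q h (x ⊗ₜ y)) =
      tensorIn K L n p q h ((K.obj p).left a x ⊗ₜ (L.obj q).left a' y) :=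
  (Bimodule.directSumAct_lof _ _ _ _).trans
    (congrArg _ (Bimodule.tensor_left_tmul (K.obj p) (L.obj q) a a' x y))

theorem tensorObj_right_in (n p q : ℕ) (h : p + q = n) (b : B) (b' : B')
    (x : (K.obj p).carrier) (y : (L.obj q).carrier) :
    (tensorObj K L n).right (MulOpposite.op (b ⊗ₜ b')) (tensorIn K L n p q h (x ⊗ₜ y)) =
      tensorIn K L n p q h
        ((K.obj p).right (MulOpposite.op b) x ⊗ₜ (L.obj q).right (MulOpposite.op b') y) :=
  (Bimodule.directSumAct_lof _ _ _ _).trans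
    (congrArg _ (Bimodule.tensor_right_tmul (K.obj p) (L.obj q) b b' x y))

variable (K L)

/-- The tensor product of chain complexes of bimodules. -/
noncomputable def tensor : BimoduleComplex.{max u v} R (A ⊗[R] A') (B ⊗[R] B') where
  obj := tensorObj K L
  d := tensorD K L
  d_left n a x := by
    suffices tensorD K L n ∘ₗ (tensorObj K L (n + 1)).left a =
        (tensorObj K L n).left a ∘ₗ tensorD K L n from congrArg (· x) this
    induction a using TensorProduct.induction_on with
    | zero => simp
    | add a a' h h' => simp only [map_add, LinearMap.comp_add, LinearMap.add_comp, h, h']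
    | tmul a a' =>
      refine tensor_ext fun p q hpq x y => ?_
      simp only [LinearMap.comp_apply, tensorObj_left_in, tensorD_in, map_add, map_smul]
      congr 1
      · cases p with
        | zero => simp [tensorD₁]
        | succ p => simp [tensorD₁, tensorObj_left_in, K.d_left]
      · cases q with
        | zero => simp [tensorD₂]
        | succ q => simp [tensorD₂, tensorObj_left_in, L.d_left]
  d_right n b x := by
    suffices tensorD K L n ∘ₗ (tensorObj K L (n + 1)).right b =
        (tensorObj K L n).right b ∘ₗ tensorD K L n from congrArg (· x) this
    induction b using MulOpposite.rec' with | _ b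
    induction b using TensorProduct.induction_on with
    | zero => simp
    | add a a' h h' =>
      simp only [MulOpposite.op_add, map_add, LinearMap.comp_add, LinearMap.add_comp, h, h']
    | tmul a a' =>
      refine tensor_ext fun p q hpq x y => ?_
      simp only [LinearMap.comp_apply, tensorObj_right_in, tensorD_in, map_add, map_smul]
      congr 1
      · cases p with
        | zero => simp [tensorD₁]
        | succ p => simp [tensorD₁, tensorObj_right_in, K.d_right]
      · cases q with
        | zero => simp [tensorD₂]
        | succ q => simp [tensorD₂, tensorObj_right_in, L.d_right]
  d_d n x := by
    suffices tensorD K L n ∘ₗ tensorD K L (n + 1) = 0 from congrArg (· x) this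
    refine tensor_ext fun p q hpq x y => ?_
    simp only [LinearMap.comp_apply, tensorD_in, map_add, map_smul, LinearMap.zero_apply]
    rcases p with _ | _ | p <;> rcases q with _ | _ | q <;>
      simp [tensorD₁, tensorD₂, tensorD_in, K.d_d, L.d_d, pow_succ]

variable {K L}

section ChainMap

variable {S S' T T' : Type*} [Ring S] [Algebra R S] [Ring S'] [Algebra R S']
  [Ring T] [Algebra R T] [Ring T'] [Algebra R T'] {K' : BimoduleComplex.{u} R S T}
  {L' : BimoduleComplex.{v} R S' T'}

/-- The linear map `⨁ φ_p ⊗ ψ_q`. -/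
noncomputable def tensorMap (φ : ChainMap K K') (ψ : ChainMap L L') (n : ℕ) :
    (tensorObj K L n).carrier →ₗ[R] (tensorObj K' L' n).carrier :=
  DirectSum.lmap (N := fun pq : Bideg n => (K'.obj pq.1.1).carrier ⊗[R] (L'.obj pq.1.2).carrier)
    fun pq : Bideg n => TensorProduct.map (φ.f pq.1.1) (ψ.f pq.1.2)

theorem tensorMap_in (φ : ChainMap K K') (ψ : ChainMap L L') (n p q : ℕ) (h : p + q = n)
    (x : (K.obj p).carrier) (y : (L.obj q).carrier) :
    tensorMap φ ψ n (tensorIn K L n p q h (x ⊗ₜ y)) =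
      tensorIn K' L' n p q h (φ.f p x ⊗ₜ ψ.f q y) :=
  DirectSum.lmap_lof _ _ _

/-- The tensor product of two chain maps. -/
noncomputable def ChainMap.tensor (φ : ChainMap K K') (ψ : ChainMap L L') :
    ChainMap (K.tensor L) (K'.tensor L') where
  f n := tensorMap φ ψ n
  comm n x := by
    suffices tensorMap φ ψ n ∘ₗ tensorD K L n = tensorD K' L' n ∘ₗ tensorMap φ ψ (n + 1) from
      congrArg (· x) this
    refine tensor_ext fun p q hpq x y => ?_
    simp only [LinearMap.comp_apply, tensorD_in, map_add, map_smul, tensorMap_in]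
    congr 1
    · cases p with
      | zero => simp [tensorD₁]
      | succ p => simp [tensorD₁, tensorMap_in, φ.comm]
    · cases q with
      | zero => simp [tensorD₂]
      | succ q => simp [tensorD₂, tensorMap_in, ψ.comm]

end ChainMap

end Tensor

end BimoduleComplex

namespace PrecubicalSet

section PathAlgebra

variable (R : Type v) [CommRing R] (X : PrecubicalSet.{u})

/-- The path algebra `R(X)`: the free `R`-module on the directed edge paths of `X` (the cube chains
of dimension `0`, including the constant paths), multiplied by concatenation; the product of two
paths that are not composable is `0`. -/
def PathAlgebra : Type (max u v) := X.Chains R 0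

noncomputable instance : AddCommGroup (PathAlgebra R X) := inferInstanceAs (AddCommGroup (X.Chains R 0))

noncomputable instance : Module R (PathAlgebra R X) := inferInstanceAs (Module R (X.Chains R 0))

noncomputable instance [Finite X.cube] : Ring (PathAlgebra R X) :=
  { (inferInstance : AddCommGroup (PathAlgebra R X)) with
    mul := fun a b => concatLin R (add_zero 0) a b
    one := constSum R
    mul_assoc := concatLin_assoc R _ _ _ _
    one_mul := constSum_concat R _
    mul_one := concat_constSum R _
    left_distrib := fun a b c => map_add (concatLin R (add_zero 0) a) b c
    right_distrib := fun a b c => LinearMap.map_add₂ (concatLin R (add_zero 0)) a b c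
    zero_mul := fun a => LinearMap.map_zero₂ (concatLin R (add_zero 0)) a
    mul_zero := fun a => map_zero (concatLin R (add_zero 0) a) }

theorem PathAlgebra.mul_def [Finite X.cube] (a b : PathAlgebra R X) :
    a * b = concatLin R (add_zero 0) a b := rfl

theorem PathAlgebra.one_def [Finite X.cube] : (1 : PathAlgebra R X) = constSum R := rfl

noncomputable instance [Finite X.cube] : Algebra R (PathAlgebra R X) :=
  Algebra.ofModule (fun r a b => LinearMap.map_smul₂ (concatLin R (add_zero 0)) r a b)
    (fun r a b => map_smul (concatLin R (add_zero 0) a) r b)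

variable {X}

/-- The element of the path algebra given by an edge path. -/
noncomputable def PathAlgebra.of (p : X.CubeChain 0) : PathAlgebra R X :=
  (Finsupp.single p 1 : X.Chains R 0)

variable (X)

/-- The left action of the path algebra on `C_n(X)` by concatenation. -/
noncomputable def leftAct [Finite X.cube] (n : ℕ) :
    PathAlgebra R X →ₐ[R] Module.End R (X.Chains R n) :=
  AlgHom.ofLinearMap
    { toFun := fun a => concatLin R (zero_add n) a
      map_add' := fun a b => map_add (concatLin R (zero_add n)) a b
      map_smul' := fun r a => map_smul (concatLin R (zero_add n)) r a }
    (LinearMap.ext fun x => constSum_concat R _ x)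
    (fun a b => LinearMap.ext fun x => concatLin_assoc R _ _ _ _ a b x)

/-- The right action of the path algebra on `C_n(X)` by concatenation. -/
noncomputable def rightAct [Finite X.cube] (n : ℕ) :
    (PathAlgebra R X)ᵐᵒᵖ →ₐ[R] Module.End R (X.Chains R n) :=
  AlgHom.ofLinearMap
    { toFun := fun a => (concatLin R (add_zero n)).flip a.unop
      map_add' := fun a b => map_add (concatLin R (add_zero n)).flip a.unop b.unop
      map_smul' := fun r a => map_smul (concatLin R (add_zero n)).flip r a.unop }
    (LinearMap.ext fun x => concat_constSum R _ x)
    (fun a b => LinearMap.ext fun x =>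
      (concatLin_assoc R (add_zero n) (add_zero n) (add_zero 0) (add_zero n) x b.unop a.unop).symm)

/-- The `R(X)`-bimodule `C_n(X)`: the free `R`-module on the `n`-dimensional cube chains, on which
paths act on both sides by concatenation. -/
noncomputable def chainBimodule [Finite X.cube] (n : ℕ) :
    Bimodule.{max u v} R (PathAlgebra R X) (PathAlgebra R X) where
  carrier := X.Chains R n
  left := X.leftAct R n
  right := X.rightAct R n
  comm a b x := (concatLin_assoc R (zero_add n) (add_zero n) (add_zero n) (zero_add n)
    a x b.unop).symm

/-- The cube chain complex `C(X)`, a chain complex of `R(X)`-bimodules. -/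
noncomputable def cubeComplex [Finite X.cube] :
    BimoduleComplex.{max u v} R (PathAlgebra R X) (PathAlgebra R X) where
  obj := X.chainBimodule R
  d := X.boundary R
  d_left _ a x := boundary_concat_left R a x (zero_add _) (zero_add _)
  d_right _ b x := boundary_concat_right R b.unop x (add_zero _) (add_zero _)
  d_d n x := boundary_boundary R n x

end PathAlgebra

section Functoriality

variable (R : Type v) [CommRing R] {X Y : PrecubicalSet.{u}}

theorem Hom.map_tface (f : Hom X Y) (ε : Bool) (i : ℕ) (c : X.cube) :
    f.toFun (X.tface ε i c) = Y.tface ε i (f.toFun c) := by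
  by_cases h : i < X.dim c
  · have h' : i < Y.dim (f.toFun c) := by rwa [f.dim_map]
    exact (congrArg f.toFun (dif_pos h)).trans ((f.map_face ε c i h).trans (dif_pos h').symm)
  · have h' : ¬ i < Y.dim (f.toFun c) := by rwa [f.dim_map]
    rw [show X.tface ε i c = c from dif_neg h,
      show Y.tface ε i (f.toFun c) = f.toFun c from dif_neg h']

theorem Hom.map_wface (f : Hom X Y) (w : List (Option Bool)) (c : X.cube) :
    f.toFun (X.wface w c) = Y.wface w (f.toFun c) := by
  induction w generalizing c with
  | nil => rfl
  | cons o w ih => cases o <;> simp [wface, ih, f.map_tface]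

/-- The map on vertices. -/
def Hom.mapVertex (f : Hom X Y) (v : X.Vertex) : Y.Vertex :=
  ⟨f.toFun v.1, by rw [f.dim_map, v.2]⟩

theorem Hom.map_endpoint (f : Hom X Y) (ε : Bool) (c : X.cube) :
    f.mapVertex (X.endpoint ε c) = Y.endpoint ε (f.toFun c) := by
  apply Subtype.ext
  change f.toFun (X.endpoint ε c).1 = _
  rw [endpoint_eq, endpoint_eq, f.map_wface, f.dim_map]

theorem Hom.map_isChain (f : Hom X Y) {v w : X.Vertex} {l : List X.cube} (h : X.IsChain v l w) :
    Y.IsChain (f.mapVertex v) (l.map f.toFun) (f.mapVertex w) := by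
  induction l generalizing v with
  | nil => exact congrArg f.mapVertex h
  | cons c l ih =>
    refine ⟨by rw [f.dim_map]; exact h.1, ?_, ?_⟩
    · rw [← f.map_endpoint, h.2.1]
    · rw [← f.map_endpoint]; exact ih h.2.2

/-- The image of a cube chain under a morphism. -/
def CubeChain.map (f : Hom X Y) {n : ℕ} (c : X.CubeChain n) : Y.CubeChain n where
  src := f.mapVertex c.src
  tgt := f.mapVertex c.tgt
  cubes := c.cubes.map f.toFun
  isChain := f.map_isChain c.isChain
  degree_eq := by
    refine Eq.trans ?_ c.degree_eq
    rw [degree, degree, List.map_map]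
    congr 2
    funext c
    simp [f.dim_map]

theorem fsplit_single (c : X.cube) (l : List X.cube) :
    fsplit (pre R) c (Finsupp.single l 1) = wsum (X.dim c) fun w =>
      if true ∈ w ∧ false ∈ w then
        Finsupp.single (lo w c :: hi w c :: l) ((-1 : R) ^ wexp w) else 0 := by
  have h0 := map_wsum (M := Module.End R (List X.cube →₀ R))
    (LinearMap.applyₗ (Finsupp.single l (1 : R))).toAddMonoidHom (X.dim c)
    (fun w => if true ∈ w ∧ false ∈ w then
      (-1 : R) ^ wexp w • (pre R (lo w c) * pre R (hi w c)) else 0)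
  simp only [LinearMap.toAddMonoidHom_coe, LinearMap.applyₗ_apply_apply] at h0
  rw [fsplit_eq (R := R), h0]
  refine wsum_congr fun w _ => ?_
  split_ifs
  · simp [Module.End.mul_apply, pre_single]
  · rfl

theorem rawList_map (f : Hom X Y) (l : List X.cube) :
    rawList R (l.map f.toFun) = Finsupp.lmapDomain R R (List.map f.toFun) (rawList R l) := by
  induction l with
  | nil => simp [rawList]
  | cons c l ih =>
    rw [List.map_cons, rawList, rawList, map_add, map_smul, ih, f.dim_map]
    congr 1
    · have := map_wsum (Finsupp.lmapDomain R R (List.map f.toFun)).toAddMonoidHom (X.dim c)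
        (fun w => if true ∈ w ∧ false ∈ w then
          Finsupp.single (lo w c :: hi w c :: l) ((-1 : R) ^ wexp w) else 0)
      simp only [LinearMap.toAddMonoidHom_coe] at this
      rw [fsplit_single, fsplit_single, this, f.dim_map]
      refine wsum_congr fun w _ => ?_
      split_ifs
      · simp [lo, hi, f.map_wface]
      · simp
    · congr 1
      simp only [pre]
      rw [← LinearMap.comp_apply, ← LinearMap.comp_apply, ← Finsupp.lmapDomain_comp,
        ← Finsupp.lmapDomain_comp]
      rfl

theorem boundary_map (f : Hom X Y) (n : ℕ) (x : X.Chains R (n + 1)) :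
    Finsupp.lmapDomain R R (CubeChain.map f) (X.boundary R n x) =
      Y.boundary R n (Finsupp.lmapDomain R R (CubeChain.map f) x) := by
  suffices Finsupp.lmapDomain R R (CubeChain.map f) ∘ₗ X.boundary R n =
      Y.boundary R n ∘ₗ Finsupp.lmapDomain R R (CubeChain.map f) from congrArg (· x) this
  let F : (Key X →₀ R) →ₗ[R] (Key Y →₀ R) := Finsupp.lmapDomain R R fun t =>
    (f.mapVertex t.1, t.2.1.map f.toFun, f.mapVertex t.2.2)
  have h1 : ∀ (m : ℕ) (y : X.Chains R m),
      toKey R m (Finsupp.lmapDomain R R (CubeChain.map f) y) = F (toKey R m y) := by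
    intro m y
    rw [toKey, toKey, ← LinearMap.comp_apply, ← LinearMap.comp_apply, ← Finsupp.lmapDomain_comp,
      ← Finsupp.lmapDomain_comp]
    rfl
  have h2 : ∀ v w (y : List X.cube →₀ R), F (key R v w y) =
      key R (f.mapVertex v) (f.mapVertex w) (Finsupp.lmapDomain R R (List.map f.toFun) y) := by
    intro v w y
    rw [key, key, ← LinearMap.comp_apply, ← LinearMap.comp_apply, ← Finsupp.lmapDomain_comp,
      ← Finsupp.lmapDomain_comp]
    rfl
  refine Finsupp.lhom_ext' fun c => LinearMap.ext_ring (toKey_injective R n ?_)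
  simp only [LinearMap.comp_apply, Finsupp.lsingle_apply]
  rw [h1, toKey_boundary_single, h2, ← rawList_map]
  simp only [Finsupp.lmapDomain_apply, Finsupp.mapDomain_single]
  rw [toKey_boundary_single]
  rfl

/-- The chain map `C(f)` induced by a morphism of precubical sets. -/
noncomputable def cubeComplexMap [Finite X.cube] [Finite Y.cube] (f : Hom X Y) :
    (X.cubeComplex R).ChainMap (Y.cubeComplex R) where
  f n := Finsupp.lmapDomain R R (CubeChain.map f : X.CubeChain n → Y.CubeChain n)
  comm n x := boundary_map R f n x

end Functoriality

section Tensor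

/-- The tensor product: `(X ⊗ Y)_n = ∐_{p + q = n} X_p × Y_q`, with the faces `d_i^ε (x, y)` equal
to `(d_i^ε x, y)` if `i < p` and to `(x, d_{i-p}^ε y)` otherwise (directions counted from `0`). -/
def tensor (X Y : PrecubicalSet.{u}) : PrecubicalSet.{u} where
  cube := X.cube × Y.cube
  dim c := X.dim c.1 + Y.dim c.2
  face ε c i h :=
    if h1 : i < X.dim c.1 then (X.face ε c.1 i h1, c.2)
    else (c.1, Y.face ε c.2 (i - X.dim c.1) (by omega))
  dim_face ε c i h := by
    split_ifs with h1
    · have := X.dim_face ε c.1 i h1; simp only; omega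
    · have := Y.dim_face ε c.2 (i - X.dim c.1) (by omega); simp only; omega
  face_face ε η c i j hij hj := by
    by_cases hj1 : j < X.dim c.1
    · have hi1 : i < X.dim c.1 := hij.trans hj1
      have h1 := X.dim_face η c.1 j hj1
      have h2 := X.dim_face ε c.1 i hi1
      have a1 : i < X.dim (X.face η c.1 j hj1) := by omega
      have a2 : j - 1 < X.dim (X.face ε c.1 i hi1) := by omega
      simp only [dif_pos hj1, dif_pos hi1, dif_pos a1, dif_pos a2]
      rw [X.face_face ε η c.1 i j hij hj1]
    · by_cases hi1 : i < X.dim c.1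
      · have h2 := X.dim_face ε c.1 i hi1
        have a2 : ¬ j - 1 < X.dim (X.face ε c.1 i hi1) := by omega
        simp only [dif_neg hj1, dif_pos hi1, dif_neg a2]
        congr 2
        omega
      · have a2 : ¬ j - 1 < X.dim c.1 := by omega
        simp only [dif_neg hj1, dif_neg hi1, dif_neg a2]
        have := Y.face_face ε η c.2 (i - X.dim c.1) (j - X.dim c.1) (by omega) (by omega)
        rw [this]
        congr 2
        omega

/-- The morphism `f ⊗ g`. -/
def Hom.tensor {X X' Y Y' : PrecubicalSet.{u}} (f : Hom X X') (g : Hom Y Y') :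
    Hom (X.tensor Y) (X'.tensor Y') where
  toFun c := (f.toFun c.1, g.toFun c.2)
  dim_map c := by simp [PrecubicalSet.tensor, f.dim_map, g.dim_map]
  map_face ε c i h := by
    by_cases h1 : i < X.dim c.1
    · have h2 : i < X'.dim (f.toFun c.1) := by rwa [f.dim_map]
      simp [PrecubicalSet.tensor, dif_pos h1, dif_pos h2, f.map_face]
    · have h2 : ¬ i < X'.dim (f.toFun c.1) := by rwa [f.dim_map]
      simp [PrecubicalSet.tensor, dif_neg h1, g.map_face, f.dim_map]

variable {X Y : PrecubicalSet.{u}}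

theorem tensor_tface_left (ε : Bool) {i : ℕ} {x : X.cube} (y : Y.cube) (h : i < X.dim x) :
    (X.tensor Y).tface ε i (x, y) = (X.tface ε i x, y) := by
  have h' : i < (X.tensor Y).dim (x, y) := Nat.lt_add_right _ h
  rw [show X.tface ε i x = X.face ε x i h from dif_pos h]
  exact (dif_pos h').trans (dif_pos h)

theorem tensor_tface_right (ε : Bool) (i : ℕ) (x : X.cube) (y : Y.cube) :
    (X.tensor Y).tface ε (i + X.dim x) (x, y) = (x, Y.tface ε i y) := by
  by_cases h : i < Y.dim y
  · have h' : i + X.dim x < (X.tensor Y).dim (x, y) := by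
      change _ < X.dim x + Y.dim y; omega
    have h'' : ¬ i + X.dim x < X.dim x := by omega
    rw [show Y.tface ε i y = Y.face ε y i h from dif_pos h]
    refine (dif_pos h').trans ((dif_neg h'').trans ?_)
    congr 2
    simp
  · have h' : ¬ i + X.dim x < (X.tensor Y).dim (x, y) := by
      change ¬ _ < X.dim x + Y.dim y; omega
    rw [show Y.tface ε i y = y from dif_neg h]
    exact dif_neg h'

theorem tensor_wface_left (w : List (Option Bool)) (x : X.cube) (y : Y.cube)
    (h : w.length ≤ X.dim x) :
    (X.tensor Y).wface w (x, y) = (X.wface w x, y) := by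
  induction w generalizing x with
  | nil => rfl
  | cons o w ih =>
    simp at h
    cases o with
    | none => exact ih x (by omega)
    | some ε =>
      have := dim_tface (X := X) (ε := ε) (i := w.length) (c := x) (by omega)
      change (X.tensor Y).wface w ((X.tensor Y).tface ε w.length (x, y)) = _
      rw [tensor_tface_left ε y (by omega), ih _ (by omega)]
      rfl

theorem tensor_wface (w₁ w₂ : List (Option Bool)) (x : X.cube) (y : Y.cube)
    (h₂ : w₂.length = X.dim x) :
    (X.tensor Y).wface (w₁ ++ w₂) (x, y) = (X.wface w₂ x, Y.wface w₁ y) := by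
  induction w₁ generalizing y with
  | nil => exact tensor_wface_left w₂ x y h₂.le
  | cons o w ih =>
    cases o with
    | none => exact ih y
    | some ε =>
      change (X.tensor Y).wface (w ++ w₂)
        ((X.tensor Y).tface ε (w ++ w₂).length (x, y)) = _
      rw [List.length_append, h₂, tensor_tface_right, ih]
      rfl

/-- The components of a vertex of `X ⊗ Y`. -/
def Vertex.fst (v : (X.tensor Y).Vertex) : X.Vertex :=
  ⟨v.1.1, (Nat.add_eq_zero_iff.1 v.2).1⟩

def Vertex.snd (v : (X.tensor Y).Vertex) : Y.Vertex :=
  ⟨v.1.2, (Nat.add_eq_zero_iff.1 v.2).2⟩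

theorem tensor_endpoint (ε : Bool) (c : (X.tensor Y).cube) :
    ((X.tensor Y).endpoint ε c).1 = ((X.endpoint ε c.1).1, (Y.endpoint ε c.2).1) := by
  have e : (X.tensor Y).dim c = Y.dim c.2 + X.dim c.1 := Nat.add_comm _ _
  rw [endpoint_eq, endpoint_eq, endpoint_eq, e, List.replicate_add]
  exact tensor_wface _ _ c.1 c.2 (by simp)

theorem tensor_endpoint_fst (ε : Bool) (c : (X.tensor Y).cube) :
    ((X.tensor Y).endpoint ε c).fst = X.endpoint ε c.1 :=
  Subtype.ext (congrArg Prod.fst (tensor_endpoint ε c))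

theorem tensor_endpoint_snd (ε : Bool) (c : (X.tensor Y).cube) :
    ((X.tensor Y).endpoint ε c).snd = Y.endpoint ε c.2 :=
  Subtype.ext (congrArg Prod.snd (tensor_endpoint ε c))

/-- The cubes `x` of positive dimension among the first components of a list of cubes `(x, y)`. -/
def listFst (l : List (X.tensor Y).cube) : List X.cube :=
  l.filterMap fun c : X.cube × Y.cube => if X.dim c.1 = 0 then none else some c.1

/-- The cubes `y` of positive dimension among the second components of a list of cubes `(x, y)`. -/
def listSnd (l : List (X.tensor Y).cube) : List Y.cube :=
  l.filterMap fun c : X.cube × Y.cube => if Y.dim c.2 = 0 then none else some c.2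

theorem endpoint_of_dim_eq_zero {X : PrecubicalSet.{u}} (ε : Bool) {c : X.cube}
    (h : X.dim c = 0) : X.endpoint ε c = ⟨c, h⟩ := by
  apply Subtype.ext
  rw [endpoint_eq, h]
  rfl

theorem isChain_fst {v w : (X.tensor Y).Vertex} {l : List (X.tensor Y).cube}
    (h : (X.tensor Y).IsChain v l w) : X.IsChain v.fst (listFst l) w.fst := by
  induction l generalizing v with
  | nil => exact congrArg Vertex.fst h
  | cons c l ih =>
    obtain ⟨-, h2, h3⟩ := h
    have ih := ih h3
    rw [tensor_endpoint_fst] at ih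
    have h2 := congrArg Vertex.fst h2
    rw [tensor_endpoint_fst] at h2
    by_cases hc : X.dim c.1 = 0
    · have : listFst (c :: l) = listFst l := List.filterMap_cons_none (if_pos hc)
      rw [this, ← h2, endpoint_of_dim_eq_zero _ hc]
      rwa [endpoint_of_dim_eq_zero _ hc] at ih
    · have : listFst (c :: l) = c.1 :: listFst l := List.filterMap_cons_some (if_neg hc)
      rw [this]
      exact ⟨by omega, h2, ih⟩

theorem isChain_snd {v w : (X.tensor Y).Vertex} {l : List (X.tensor Y).cube}
    (h : (X.tensor Y).IsChain v l w) : Y.IsChain v.snd (listSnd l) w.snd := by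
  induction l generalizing v with
  | nil => exact congrArg Vertex.snd h
  | cons c l ih =>
    obtain ⟨-, h2, h3⟩ := h
    have ih := ih h3
    rw [tensor_endpoint_snd] at ih
    have h2 := congrArg Vertex.snd h2
    rw [tensor_endpoint_snd] at h2
    by_cases hc : Y.dim c.2 = 0
    · have : listSnd (c :: l) = listSnd l := List.filterMap_cons_none (if_pos hc)
      rw [this, ← h2, endpoint_of_dim_eq_zero _ hc]
      rwa [endpoint_of_dim_eq_zero _ hc] at ih
    · have : listSnd (c :: l) = c.2 :: listSnd l := List.filterMap_cons_some (if_neg hc)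
      rw [this]
      exact ⟨by omega, h2, ih⟩

theorem degree_eq_zero {X : PrecubicalSet.{u}} {l : List X.cube} (h : ∀ c ∈ l, X.dim c ≤ 1) :
    X.degree l = 0 :=
  List.sum_eq_zero fun n hn => by
    obtain ⟨c, hc, rfl⟩ := List.mem_map.1 hn
    have := h c hc
    omega

theorem dim_mem_listFst {l : List (X.tensor Y).cube} (h : ∀ c ∈ l, (X.tensor Y).dim c = 1) :
    ∀ x ∈ listFst l, X.dim x = 1 := by
  intro x hx
  obtain ⟨c, hc, hx⟩ := List.mem_filterMap.1 hx
  have h1 : X.dim c.1 + Y.dim c.2 = 1 := h c hc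
  split_ifs at hx with h0
  cases hx
  omega

theorem dim_mem_listSnd {l : List (X.tensor Y).cube} (h : ∀ c ∈ l, (X.tensor Y).dim c = 1) :
    ∀ x ∈ listSnd l, Y.dim x = 1 := by
  intro x hx
  obtain ⟨c, hc, hx⟩ := List.mem_filterMap.1 hx
  have h1 : X.dim c.1 + Y.dim c.2 = 1 := h c hc
  split_ifs at hx with h0
  cases hx
  omega

/-- The projection to `X` of an edge path in `X ⊗ Y`. -/
def CubeChain.fst (p : (X.tensor Y).CubeChain 0) : X.CubeChain 0 where
  src := p.src.fst
  tgt := p.tgt.fst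
  cubes := listFst p.cubes
  isChain := isChain_fst p.isChain
  degree_eq := degree_eq_zero fun x hx =>
    (dim_mem_listFst (dim_eq_one p.isChain p.degree_eq) x hx).le

/-- The projection to `Y` of an edge path in `X ⊗ Y`. -/
def CubeChain.snd (p : (X.tensor Y).CubeChain 0) : Y.CubeChain 0 where
  src := p.src.snd
  tgt := p.tgt.snd
  cubes := listSnd p.cubes
  isChain := isChain_snd p.isChain
  degree_eq := degree_eq_zero fun x hx =>
    (dim_mem_listSnd (dim_eq_one p.isChain p.degree_eq) x hx).le

/-- A precubical set is cycle-free if it has no closed directed edge path of positive length. -/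
def IsCycleFree (X : PrecubicalSet.{u}) : Prop :=
  ∀ (v : X.Vertex) (l : List X.cube), (∀ c ∈ l, X.dim c = 1) → X.IsChain v l v → l = []

theorem IsCycleFree.tensor (hX : X.IsCycleFree) (hY : Y.IsCycleFree) :
    (X.tensor Y).IsCycleFree := by
  intro v l hl h
  have h1 := hX _ _ (dim_mem_listFst hl) (isChain_fst h)
  have h2 := hY _ _ (dim_mem_listSnd hl) (isChain_snd h)
  have h1 := List.filterMap_eq_nil_iff.1 h1
  have h2 := List.filterMap_eq_nil_iff.1 h2
  rw [List.eq_nil_iff_forall_not_mem]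
  intro c hc
  have h3 : X.dim c.1 + Y.dim c.2 = 1 := hl c hc
  have h4 := h1 c hc
  have h5 := h2 c hc
  simp only [ite_eq_left_iff, reduceCtorEq, imp_false, not_not] at h4 h5
  omega

instance [Finite X.cube] [Finite Y.cube] : Finite (X.tensor Y).cube :=
  inferInstanceAs (Finite (X.cube × Y.cube))

variable (R : Type v) [CommRing R]

variable (X Y) in
/-- The linear map underlying the algebra map `h`. -/
noncomputable def pathLin : PathAlgebra R (X.tensor Y) →ₗ[R] PathAlgebra R X ⊗[R] PathAlgebra R Y :=
  (Finsupp.linearCombination R fun p : (X.tensor Y).CubeChain 0 =>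
    PathAlgebra.of R p.fst ⊗ₜ[R] PathAlgebra.of R p.snd :
      (X.tensor Y).Chains R 0 →ₗ[R] PathAlgebra R X ⊗[R] PathAlgebra R Y)

theorem pathLin_of (p : (X.tensor Y).CubeChain 0) :
    pathLin X Y R (PathAlgebra.of R p) = PathAlgebra.of R p.fst ⊗ₜ[R] PathAlgebra.of R p.snd :=
  (Finsupp.linearCombination_single R _ _).trans (one_smul _ _)

theorem PathAlgebra.of_mul_of [Finite X.cube] (p q : X.CubeChain 0) (h : p.tgt = q.src) :
    PathAlgebra.of R p * PathAlgebra.of R q = PathAlgebra.of R (p.concat (add_zero 0) q h) :=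
  (concatLin_single R _ p q).trans (concatOrZero_pos R _ p q h)

theorem PathAlgebra.of_mul_of_ne [Finite X.cube] (p q : X.CubeChain 0) (h : ¬ p.tgt = q.src) :
    PathAlgebra.of R p * PathAlgebra.of R q = 0 :=
  (concatLin_single R _ p q).trans (concatOrZero_neg R _ p q h)

theorem PathAlgebra.lhom_ext {M : Type*} [AddCommGroup M] [Module R M]
    {f g : PathAlgebra R X →ₗ[R] M} (h : ∀ p, f (.of R p) = g (.of R p)) : f = g :=
  Finsupp.lhom_ext' (R := R) (M := R) fun p => LinearMap.ext_ring (h p)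

theorem pathLin_mul [Finite X.cube] [Finite Y.cube] (a b : PathAlgebra R (X.tensor Y)) :
    pathLin X Y R (a * b) = pathLin X Y R a * pathLin X Y R b := by
  suffices (LinearMap.mul R (PathAlgebra R (X.tensor Y))).compr₂ (pathLin X Y R) =
      (LinearMap.mul R (PathAlgebra R X ⊗[R] PathAlgebra R Y)).compl₁₂
        (pathLin X Y R) (pathLin X Y R) from
    congrArg (fun f => f a b) this
  refine PathAlgebra.lhom_ext R fun p => PathAlgebra.lhom_ext R fun q => ?_
  simp only [LinearMap.compr₂_apply, LinearMap.mul_apply', LinearMap.compl₁₂_apply, pathLin_of,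
    Algebra.TensorProduct.tmul_mul_tmul]
  by_cases h : p.tgt = q.src
  · rw [PathAlgebra.of_mul_of R p q h, pathLin_of,
      PathAlgebra.of_mul_of R p.fst q.fst (congrArg Vertex.fst h),
      PathAlgebra.of_mul_of R p.snd q.snd (congrArg Vertex.snd h)]
    congr 2
    · exact CubeChain.ext rfl rfl List.filterMap_append
    · exact CubeChain.ext rfl rfl List.filterMap_append
  · rw [PathAlgebra.of_mul_of_ne R p q h, map_zero]
    by_cases h1 : p.fst.tgt = q.fst.src
    · have h2 : ¬ p.snd.tgt = q.snd.src := fun h2 => h (Subtype.ext (Prod.ext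
        (congrArg Subtype.val h1) (congrArg Subtype.val h2)))
      rw [PathAlgebra.of_mul_of_ne R p.snd q.snd h2, TensorProduct.tmul_zero]
    · rw [PathAlgebra.of_mul_of_ne R p.fst q.fst h1, TensorProduct.zero_tmul]

theorem pathLin_one [Finite X.cube] [Finite Y.cube] :
    pathLin X Y R 1 = 1 := by
  have h1 : ∀ (Z : PrecubicalSet.{u}) [Finite Z.cube],
      (1 : PathAlgebra R Z) = ∑ v : Z.Vertex, PathAlgebra.of R (CubeChain.const v) := fun _ _ => rfl
  rw [h1, map_sum, Algebra.TensorProduct.one_def, h1, h1, TensorProduct.sum_tmul]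
  simp only [TensorProduct.tmul_sum, pathLin_of]
  refine Eq.trans ?_ (Finset.sum_product' (Finset.univ : Finset X.Vertex)
    (Finset.univ : Finset Y.Vertex) fun x y => PathAlgebra.of R (CubeChain.const x) ⊗ₜ[R]
      PathAlgebra.of R (CubeChain.const y))
  refine Finset.sum_bij' (fun v _ => (v.fst, v.snd))
    (fun v _ => ⟨(v.1.1, v.2.1), by
      change X.dim v.1.1 + Y.dim v.2.1 = 0; rw [v.1.2, v.2.2]⟩)
    (fun _ _ => Finset.mem_univ _) (fun _ _ => Finset.mem_univ _) (fun _ _ => rfl)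
    (fun _ _ => rfl) (fun _ _ => rfl)

variable (X Y) in
/-- The algebra map `h : R(X ⊗ Y) → R(X) ⊗ R(Y)`. It sends a path to the tensor product of its
two projections; in particular it sends a generator `(u, v)`, where one of `u` and `v` is an edge and
the other a vertex (or both are vertices), to `u ⊗ v`. -/
noncomputable def pathAlgebraMap [Finite X.cube] [Finite Y.cube] :
    PathAlgebra R (X.tensor Y) →ₐ[R] PathAlgebra R X ⊗[R] PathAlgebra R Y :=
  AlgHom.ofLinearMap (pathLin X Y R) (pathLin_one R) (pathLin_mul R)

/-- The edge path consisting of a single edge. -/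
def CubeChain.edge (c : X.cube) (hc : X.dim c = 1) : X.CubeChain 0 where
  src := X.endpoint false c
  tgt := X.endpoint true c
  cubes := [c]
  isChain := ⟨hc.ge, rfl, rfl⟩
  degree_eq := by simp [degree, hc]

open Classical in
/-- The generator of the path algebra given by a vertex or an edge. -/
noncomputable def PathAlgebra.gen (c : X.cube) (hc : X.dim c ≤ 1) : PathAlgebra R X :=
  if h : X.dim c = 0 then .of R (.const ⟨c, h⟩) else .of R (.edge c (by omega))

theorem PathAlgebra.gen_of_eq (c : X.cube) (hc : X.dim c ≤ 1) (h : X.dim c = 0) :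
    PathAlgebra.gen R c hc = .of R (.const ⟨c, h⟩) := dif_pos h

theorem PathAlgebra.gen_of_ne (c : X.cube) (hc : X.dim c ≤ 1) (h : ¬ X.dim c = 0) :
    PathAlgebra.gen R c hc = .of R (.edge c (by omega)) := dif_neg h

/-- On the generators `c = (u, v)` of the path algebra of `X ⊗ Y`, the map `h` is given by
`h (u, v) = u ⊗ v`. -/
theorem pathAlgebraMap_gen [Finite X.cube] [Finite Y.cube] (c : (X.tensor Y).cube)
    (h : X.dim c.1 + Y.dim c.2 ≤ 1) :
    pathAlgebraMap X Y R (PathAlgebra.gen R c h) =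
      PathAlgebra.gen R c.1 (by omega) ⊗ₜ[R] PathAlgebra.gen R c.2 (by omega) := by
  have key : ∀ p, pathAlgebraMap X Y R (PathAlgebra.of R p) =
    PathAlgebra.of R p.fst ⊗ₜ[R] PathAlgebra.of R p.snd := pathLin_of R
  by_cases h0 : X.dim c.1 = 0 <;> by_cases h1 : Y.dim c.2 = 0
  · have h2 : (X.tensor Y).dim c = 0 := Nat.add_eq_zero_iff.2 ⟨h0, h1⟩
    rw [PathAlgebra.gen_of_eq R c h h2, PathAlgebra.gen_of_eq R c.1 _ h0,
      PathAlgebra.gen_of_eq R c.2 _ h1, key]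
    rfl
  · have h2 : ¬ (X.tensor Y).dim c = 0 := fun h => h1 (Nat.add_eq_zero_iff.1 h).2
    rw [PathAlgebra.gen_of_ne R c h h2, PathAlgebra.gen_of_eq R c.1 _ h0,
      PathAlgebra.gen_of_ne R c.2 _ h1, key]
    congr 2
    · refine CubeChain.ext ?_ ?_
        (show listFst [c] = [] from List.filterMap_cons_none (if_pos h0))
      · exact (tensor_endpoint_fst false _).trans (endpoint_of_dim_eq_zero _ h0)
      · exact (tensor_endpoint_fst true _).trans (endpoint_of_dim_eq_zero _ h0)
    · refine CubeChain.ext ?_ ?_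
        (show listSnd [c] = [c.2] from List.filterMap_cons_some (if_neg h1))
      · exact tensor_endpoint_snd false _
      · exact tensor_endpoint_snd true _
  · have h2 : ¬ (X.tensor Y).dim c = 0 := fun h => h0 (Nat.add_eq_zero_iff.1 h).1
    rw [PathAlgebra.gen_of_ne R c h h2, PathAlgebra.gen_of_ne R c.1 _ h0,
      PathAlgebra.gen_of_eq R c.2 _ h1, key]
    congr 2
    · refine CubeChain.ext ?_ ?_
        (show listFst [c] = [c.1] from List.filterMap_cons_some (if_neg h0))
      · exact tensor_endpoint_fst false _
      · exact tensor_endpoint_fst true _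
    · refine CubeChain.ext ?_ ?_
        (show listSnd [c] = [] from List.filterMap_cons_none (if_pos h1))
      · exact (tensor_endpoint_snd false _).trans (endpoint_of_dim_eq_zero _ h1)
      · exact (tensor_endpoint_snd true _).trans (endpoint_of_dim_eq_zero _ h1)
  · omega

end Tensor

end PrecubicalSet

/-- The objects of the category `Cub`: finite cycle-free precubical sets. -/
structure Cub extends PrecubicalSet.{u} where
  finite : Finite cube
  cycleFree : toPrecubicalSet.IsCycleFree

attribute [instance] Cub.finite

namespace Cub

/-- The morphisms of `Cub`: morphisms of precubical sets that are injective on vertices. -/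
structure Hom (X Y : Cub.{u}) extends PrecubicalSet.Hom X.toPrecubicalSet Y.toPrecubicalSet where
  injective_mapVertex : Function.Injective toHom.mapVertex

/-- The tensor product of two objects of `Cub`. -/
def tensor (X Y : Cub.{u}) : Cub.{u} where
  toPrecubicalSet := X.toPrecubicalSet.tensor Y.toPrecubicalSet
  finite := inferInstance
  cycleFree := X.cycleFree.tensor Y.cycleFree

/-- The tensor product of two morphisms of `Cub`. -/
def Hom.tensor {X X' Y Y' : Cub.{u}} (f : Hom X X') (g : Hom Y Y') :
    Hom (X.tensor Y) (X'.tensor Y') where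
  toHom := f.toHom.tensor g.toHom
  injective_mapVertex v w h := by
    have h1 := @f.injective_mapVertex v.fst w.fst
      (Subtype.ext (congrArg (fun t => t.1.1) h))
    have h2 := @g.injective_mapVertex v.snd w.snd
      (Subtype.ext (congrArg (fun t => t.1.2) h))
    exact Subtype.ext (Prod.ext (congrArg Subtype.val h1) (congrArg Subtype.val h2))

variable (R : Type v) [CommRing R]

/-- The path algebra `R(X)`. -/
abbrev pathAlgebra (X : Cub.{u}) : Type (max u v) := X.toPrecubicalSet.PathAlgebra R

/-- The cube chain complex `C(X)` of `R(X)`-bimodules. -/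
noncomputable abbrev C (X : Cub.{u}) :
    BimoduleComplex.{max u v} R (X.pathAlgebra R) (X.pathAlgebra R) :=
  X.toPrecubicalSet.cubeComplex R

/-- The chain map `C(f) : C(X) → C(Y)`. -/
noncomputable abbrev Hom.C {X Y : Cub.{u}} (f : Hom X Y) : (X.C R).ChainMap (Y.C R) :=
  PrecubicalSet.cubeComplexMap R f.toHom

/-- The algebra map `h : R(X ⊗ Y) → R(X) ⊗ R(Y)`. -/
noncomputable abbrev h (X Y : Cub.{u}) :
    (X.tensor Y).pathAlgebra R →ₐ[R] X.pathAlgebra R ⊗[R] Y.pathAlgebra R :=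
  X.toPrecubicalSet.pathAlgebraMap Y.toPrecubicalSet R

end Cub

/-! The isomorphism is induced by Milgram's map. The complex `C(X)` is the cobar construction of the
coalgebra (over the vertices) of cubes with the diagonal `c ↦ ∑ ± d^0_{Aᶜ} c ⊗ d^1_A c`, and the
coalgebra of `X ⊗ Y` is the tensor product of those of `X` and `Y`. Milgram's map
`C(X ⊗ Y) → C(X) ⊗ C(Y)` is the map that turns concatenation into multiplication and sends a
horizontal cube `(x, w)` to `x ⊗ 1_w`, a vertical cube `(v, y)` to `1_v ⊗ y`, and a mixed cube `(x, y)`,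
with `x` and `y` of positive dimension, to `0`. It commutes with the differentials because a mixed cube
has precisely two splittings without mixed cubes, and their images cancel
(`IsMixed.fsplit_letterAct`, `milgramRaw_rawList`). In degree `0` it is the algebra map `h`, so that it
is compatible with the bimodule structures (`milgramLin_left`, `milgramLin_right`); naturality is
immediate (`milgramLin_natural`).

That Milgram's map is a quasi-isomorphism is shown by discrete Morse theory. The essential chains, which
are composed of horizontal cubes followed by vertical ones, span a subcomplex (`boundary_essential`),
which is mapped isomorphically onto `C(X) ⊗ C(Y)`: a pair of chains `a`, `b` comes from the
concatenation of `a × {start of b}` and `{end of a} × b` (`sortedChain`). A chain is called collapsible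
if it consists of horizontal cubes, then vertical cubes, then a mixed cube `(x, y)`, then anything; it is
matched with the face in which `(x, y)` is replaced by `(d^0 x, y)`, `(x, d^1 y)` (`redundantFace`).
Every chain is essential, collapsible, or such a face (`isEssential_or_isCollapsible_or`). The matching is
acyclic: all other terms of the boundary of a collapsible chain are collapsible or of smaller weight
(`rawList_collapsible`). Hence every chain is, modulo boundaries, a combination of essential and
collapsible ones, and the boundary is injective on combinations of collapsible chains modulo essential
ones. By `ChainMap.homologyMap_bijective` this suffices. -/

namespace PrecubicalSet

/-! ### Sums over words -/

section WordSums

variable {M : Type*}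

theorem wsum_const_zero [AddCommMonoid M] (n : ℕ) : wsum n (fun _ => (0 : M)) = 0 := by
  induction n with
  | zero => rfl
  | succ n ih => simp only [wsum, ih, add_zero]

theorem wsum_eq_single [AddCommMonoid M] {n : ℕ} {f : List Bool → M} (w₀ : List Bool)
    (h₀ : w₀.length = n) (h : ∀ w, w.length = n → w ≠ w₀ → f w = 0) : wsum n f = f w₀ := by
  induction n generalizing f w₀ with
  | zero => rw [List.length_eq_zero_iff.1 h₀]; rfl
  | succ n ih =>
    have hz : ∀ b, (∀ w, w.length = n → f (b :: w) = 0) → wsum n (fun w => f (b :: w)) = 0 :=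
      fun b hb => (wsum_congr hb).trans (wsum_const_zero n)
    obtain _ | ⟨b, w₀⟩ := w₀
    · simp at h₀
    · simp only [List.length_cons, Nat.add_right_cancel_iff] at h₀
      have hs := ih (f := fun w => f (b :: w)) w₀ h₀ fun w hw hne =>
        h _ (by simp [hw]) (by simpa using hne)
      cases b
      · rw [wsum, hs, hz true fun w hw => h _ (by simp [hw]) (by simp), zero_add]
      · rw [wsum, hs, hz false fun w hw => h _ (by simp [hw]) (by simp), add_zero]

theorem wsum_mem {R : Type*} [Ring R] [AddCommGroup M] [Module R M] (S : Submodule R M) {n : ℕ}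
    {f : List Bool → M} (h : ∀ w, w.length = n → f w ∈ S) : wsum n f ∈ S := by
  induction n generalizing f with
  | zero => exact h [] rfl
  | succ n ih =>
    exact S.add_mem (ih fun w hw => h _ (by simp [hw])) (ih fun w hw => h _ (by simp [hw]))

theorem wsum_sub_mem {R : Type*} [Ring R] [AddCommGroup M] [Module R M] (S : Submodule R M) {n : ℕ}
    {f : List Bool → M} (w₀ : List Bool) (h₀ : w₀.length = n)
    (h : ∀ w, w.length = n → w ≠ w₀ → f w ∈ S) : wsum n f - f w₀ ∈ S := by
  have e : wsum n f = f w₀ + wsum n fun w => if w = w₀ then 0 else f w := by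
    have h1 := wsum_eq_single (f := fun w => if w = w₀ then f w else 0) w₀ h₀
      fun w _ hw => if_neg hw
    simp only [if_true] at h1
    rw [← h1, ← wsum_add]
    refine wsum_congr fun w _ => ?_
    split_ifs <;> simp
  rw [e, add_sub_cancel_left]
  refine wsum_mem S fun w hw => ?_
  split_ifs with h1
  · exact S.zero_mem
  · exact h w hw h1

end WordSums

/-! ### Iterated faces in a tensor product -/

section TensorFaces

variable {X Y : PrecubicalSet.{u}}

theorem lo_append {w₁ w₂ : List Bool} (c : (X.tensor Y).cube) (h₂ : w₂.length = X.dim c.1) :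
    lo (X := X.tensor Y) (w₁ ++ w₂) c = (lo w₂ c.1, lo w₁ c.2) := by
  rw [lo, List.map_append]
  exact tensor_wface _ _ c.1 c.2 (by simpa using h₂)

theorem hi_append {w₁ w₂ : List Bool} (c : (X.tensor Y).cube) (h₂ : w₂.length = X.dim c.1) :
    hi (X := X.tensor Y) (w₁ ++ w₂) c = (hi w₂ c.1, hi w₁ c.2) := by
  rw [hi, List.map_append]
  exact tensor_wface _ _ c.1 c.2 (by simpa using h₂)

/-- A word for a cube `(x, y)` of `X ⊗ Y` consists of a word for `y` followed by one for `x`. -/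
theorem exists_append_of_length_eq_dim {w : List Bool} {c : (X.tensor Y).cube}
    (h : w.length = (X.tensor Y).dim c) :
    ∃ w₁ w₂ : List Bool, w = w₁ ++ w₂ ∧ w₁.length = Y.dim c.2 ∧ w₂.length = X.dim c.1 := by
  have h : w.length = X.dim c.1 + Y.dim c.2 := h
  exact ⟨w.take (Y.dim c.2), w.drop (Y.dim c.2), (List.take_append_drop _ _).symm,
    by simp [h], by simp [h]⟩

theorem wface_replicate_none (n : ℕ) (c : X.cube) : X.wface (List.replicate n none) c = c := by
  induction n with
  | zero => rfl
  | succ n ih => exact ih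

theorem lo_replicate_true (n : ℕ) (c : X.cube) : lo (List.replicate n true) c = c := by
  rw [lo, List.map_replicate]; exact wface_replicate_none n c

theorem hi_replicate_false (n : ℕ) (c : X.cube) : hi (List.replicate n false) c = c := by
  rw [hi, List.map_replicate]; exact wface_replicate_none n c

theorem lo_replicate_false (c : X.cube) :
    lo (List.replicate (X.dim c) false) c = (X.endpoint false c).1 := by
  rw [lo, List.map_replicate, endpoint_eq]; rfl

theorem hi_replicate_true (c : X.cube) :
    hi (List.replicate (X.dim c) true) c = (X.endpoint true c).1 := by
  rw [hi, List.map_replicate, endpoint_eq]; rfl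

theorem eq_replicate_false {w : List Bool} {n : ℕ} (hn : w.length = n) (h : w.count true = 0) :
    w = List.replicate n false :=
  List.eq_replicate_iff.2 ⟨hn, fun b hb => by
    cases b
    · rfl
    · exact absurd hb (List.count_eq_zero.1 h)⟩

theorem eq_replicate_true {w : List Bool} {n : ℕ} (hn : w.length = n) (h : w.count false = 0) :
    w = List.replicate n true :=
  List.eq_replicate_iff.2 ⟨hn, fun b hb => by
    cases b
    · exact absurd hb (List.count_eq_zero.1 h)
    · rfl⟩

theorem dim_vertex (v : X.Vertex) : X.dim v.1 = 0 := v.2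

end TensorFaces

/-! ### Essential and collapsible lists -/

section Letters

variable {X Y : PrecubicalSet.{u}}

/-- A cube `(x, v)` of `X ⊗ Y` with `x` of positive dimension and `v` a vertex. -/
def IsHorizontal (c : (X.tensor Y).cube) : Prop := 1 ≤ X.dim c.1 ∧ Y.dim c.2 = 0

/-- A cube `(v, y)` of `X ⊗ Y` with `v` a vertex and `y` of positive dimension. -/
def IsVertical (c : (X.tensor Y).cube) : Prop := X.dim c.1 = 0 ∧ 1 ≤ Y.dim c.2

/-- A cube `(x, y)` of `X ⊗ Y` with both `x` and `y` of positive dimension. -/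
def IsMixed (c : (X.tensor Y).cube) : Prop := 1 ≤ X.dim c.1 ∧ 1 ≤ Y.dim c.2

instance (c : (X.tensor Y).cube) : Decidable (IsHorizontal c) := inferInstanceAs (Decidable (_ ∧ _))

instance (c : (X.tensor Y).cube) : Decidable (IsVertical c) := inferInstanceAs (Decidable (_ ∧ _))

theorem IsVertical.not_isHorizontal {c : (X.tensor Y).cube} (h : IsVertical c) :
    ¬ IsHorizontal c := fun h' => by have := h.1; have := h'.1; omega

theorem IsMixed.not_isHorizontal {c : (X.tensor Y).cube} (h : IsMixed c) :
    ¬ IsHorizontal c := fun h' => by have := h.2; have := h'.2; omega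

theorem IsMixed.not_isVertical {c : (X.tensor Y).cube} (h : IsMixed c) :
    ¬ IsVertical c := fun h' => by have := h.1; have := h'.1; omega

theorem letter_trichotomy {c : (X.tensor Y).cube} (h : 1 ≤ (X.tensor Y).dim c) :
    IsHorizontal c ∨ IsVertical c ∨ IsMixed c := by
  have h : 1 ≤ X.dim c.1 + Y.dim c.2 := h
  unfold IsHorizontal IsVertical IsMixed
  omega

/-- Lists that start with some vertical cubes followed by a mixed one. -/
def IsVertCollapsible : List (X.tensor Y).cube → Prop
  | [] => False
  | c :: l => IsMixed c ∨ IsVertical c ∧ IsVertCollapsible l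

/-- Collapsible lists: some horizontal cubes, then some vertical cubes, then a mixed cube, then
anything. -/
def IsCollapsible : List (X.tensor Y).cube → Prop
  | [] => False
  | c :: l => IsVertCollapsible (c :: l) ∨ IsHorizontal c ∧ IsCollapsible l

/-- Essential lists: some horizontal cubes followed by some vertical cubes. -/
def IsEssential : List (X.tensor Y).cube → Prop
  | [] => True
  | c :: l => (∀ d ∈ c :: l, IsVertical d) ∨ IsHorizontal c ∧ IsEssential l

/-- Lists that start with exactly `n` vertical cubes followed by a horizontal one. -/
def IsVertThenHoriz : ℕ → List (X.tensor Y).cube → Prop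
  | _, [] => False
  | 0, c :: _ => IsHorizontal c
  | n + 1, c :: l => IsVertical c ∧ IsVertThenHoriz n l

/-- The number of vertical cubes at the beginning of a list. -/
def vertLength : List (X.tensor Y).cube → ℕ
  | [] => 0
  | c :: l => if IsVertical c then vertLength l + 1 else 0

/-- The weight of a list, in the lexicographic order on pairs: the length of what remains after
dropping the horizontal cubes at the beginning, and then the number of vertical cubes at the
beginning of the remaining list. -/
def weight : List (X.tensor Y).cube → ℕ ×ₗ ℕ
  | [] => toLex (0, 0)
  | c :: l => if IsHorizontal c then weight l else toLex (l.length + 1, vertLength (c :: l))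

/-- The vertical cube `(d^0 x, y)` of a cube `(x, y)`. -/
def vertFace (c : (X.tensor Y).cube) : (X.tensor Y).cube := ((X.endpoint false c.1).1, c.2)

/-- The horizontal cube `(x, d^1 y)` of a cube `(x, y)`. -/
def horizFace (c : (X.tensor Y).cube) : (X.tensor Y).cube := (c.1, (Y.endpoint true c.2).1)

theorem IsMixed.isVertical_vertFace {c : (X.tensor Y).cube} (h : IsMixed c) :
    IsVertical (vertFace c) := ⟨dim_vertex _, h.2⟩

theorem IsMixed.isHorizontal_horizFace {c : (X.tensor Y).cube} (h : IsMixed c) :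
    IsHorizontal (horizFace c) := ⟨h.1, dim_vertex _⟩

theorem eq_of_vertFace_of_horizFace {c c' : (X.tensor Y).cube} (h : vertFace c = vertFace c')
    (h' : horizFace c = horizFace c') : c = c' := by
  have h1 := congrArg (fun a : (X.tensor Y).cube => a.1) h'
  have h2 := congrArg (fun a : (X.tensor Y).cube => a.2) h
  exact Prod.ext h1 h2

/-- The operation `redundantFace` after the initial horizontal cubes. -/
def vertRedundantFace : List (X.tensor Y).cube → List (X.tensor Y).cube
  | [] => []
  | c :: l => if IsVertical c then c :: vertRedundantFace l else
      vertFace c :: horizFace c :: l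

/-- The face with which a collapsible list is matched: its first mixed cube `(x, y)` is replaced by
the two cubes `(d^0 x, y)` and `(x, d^1 y)`. -/
def redundantFace : List (X.tensor Y).cube → List (X.tensor Y).cube
  | [] => []
  | c :: l => if IsHorizontal c then c :: redundantFace l else vertRedundantFace (c :: l)

theorem IsVertCollapsible.isCollapsible {l : List (X.tensor Y).cube} (h : IsVertCollapsible l) :
    IsCollapsible l := by
  cases l with
  | nil => exact h
  | cons c l => exact Or.inl h

theorem IsVertCollapsible.head_not_isHorizontal {c : (X.tensor Y).cube}
    {l : List (X.tensor Y).cube} (h : IsVertCollapsible (c :: l)) : ¬ IsHorizontal c := by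
  rcases h with h | h
  · exact h.not_isHorizontal
  · exact h.1.not_isHorizontal

theorem weight_le (l : List (X.tensor Y).cube) : (ofLex (weight l)).1 ≤ l.length := by
  induction l with
  | nil => exact le_rfl
  | cons c l ih =>
    rw [weight]
    split_ifs
    · exact ih.trans (by simp)
    · exact le_rfl

theorem weight_cons_horizontal {c : (X.tensor Y).cube} (h : IsHorizontal c)
    (l : List (X.tensor Y).cube) : weight (c :: l) = weight l := if_pos h

theorem IsVertThenHoriz.vertLength_eq {n : ℕ} {l : List (X.tensor Y).cube}
    (h : IsVertThenHoriz n l) : vertLength l = n := by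
  induction n generalizing l with
  | zero =>
    cases l with
    | nil => exact h.elim
    | cons c l => exact if_neg fun h' => h'.not_isHorizontal h
  | succ n ih =>
    cases l with
    | nil => exact h.elim
    | cons c l => rw [vertLength, if_pos h.1, ih h.2]

theorem IsVertThenHoriz.weight_lt {n : ℕ} {l : List (X.tensor Y).cube}
    (h : IsVertThenHoriz n l) : weight l < toLex (l.length, n + 1) := by
  cases l with
  | nil => cases n <;> exact h.elim
  | cons c l =>
    rw [Prod.Lex.lt_iff]
    cases n with
    | zero =>
      left
      rw [weight_cons_horizontal h]
      have := weight_le l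
      simp only [ofLex_toLex, List.length_cons]
      omega
    | succ n =>
      right
      rw [weight, if_neg h.1.not_isHorizontal, h.vertLength_eq]
      exact ⟨rfl, Nat.lt_succ_self _⟩

theorem IsVertCollapsible.isVertThenHoriz {l : List (X.tensor Y).cube} (h : IsVertCollapsible l) :
    IsVertThenHoriz (vertLength l + 1) (vertRedundantFace l) := by
  induction l with
  | nil => exact h.elim
  | cons c l ih =>
    by_cases hc : IsVertical c
    · rw [vertLength, vertRedundantFace, if_pos hc, if_pos hc]
      exact ⟨hc, ih (h.resolve_left fun h' => h'.not_isVertical hc).2⟩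
    · have hm : IsMixed c := h.resolve_right fun h' => hc h'.1
      rw [vertLength, vertRedundantFace, if_neg hc, if_neg hc]
      exact ⟨hm.isVertical_vertFace, hm.isHorizontal_horizFace⟩

theorem IsVertCollapsible.length_vertRedundantFace {l : List (X.tensor Y).cube}
    (h : IsVertCollapsible l) : (vertRedundantFace l).length = l.length + 1 := by
  induction l with
  | nil => exact h.elim
  | cons c l ih =>
    rw [vertRedundantFace]
    split_ifs with hc
    · simp [ih (h.resolve_left fun h' => h'.not_isVertical hc).2]
    · simp

theorem IsVertCollapsible.redundantFace_eq {l : List (X.tensor Y).cube}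
    (h : IsVertCollapsible l) : redundantFace l = vertRedundantFace l := by
  cases l with
  | nil => rfl
  | cons c l => exact if_neg h.head_not_isHorizontal

theorem IsVertCollapsible.weight_redundantFace {l : List (X.tensor Y).cube}
    (h : IsVertCollapsible l) :
    weight (redundantFace l) = toLex (l.length + 1, vertLength l + 1) := by
  have h1 := h.isVertThenHoriz
  have h2 := h.length_vertRedundantFace
  rw [h.redundantFace_eq]
  generalize vertRedundantFace l = l' at h1 h2
  cases l' with
  | nil => exact h1.elim
  | cons c l' => rw [weight, if_neg h1.1.not_isHorizontal, h1.vertLength_eq, ← h2]; rfl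

theorem IsVertThenHoriz.not_isVertCollapsible {n : ℕ} {l : List (X.tensor Y).cube}
    (h : IsVertThenHoriz n l) : ¬ IsVertCollapsible l := by
  induction n generalizing l with
  | zero =>
    cases l with
    | nil => exact h.elim
    | cons c l => exact fun h' => h'.head_not_isHorizontal h
  | succ n ih =>
    cases l with
    | nil => exact h.elim
    | cons c l => exact fun h' => ih h.2 (h'.resolve_left fun h'' => h''.not_isVertical h.1).2

theorem IsVertThenHoriz.not_forall_isVertical {n : ℕ} {l : List (X.tensor Y).cube}
    (h : IsVertThenHoriz n l) : ¬ ∀ d ∈ l, IsVertical d := by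
  induction n generalizing l with
  | zero =>
    cases l with
    | nil => exact h.elim
    | cons c l => exact fun h' => (h' c (by simp)).not_isHorizontal h
  | succ n ih =>
    cases l with
    | nil => exact h.elim
    | cons c l => exact fun h' => ih h.2 fun d hd => h' d (by simp [hd])

theorem IsVertCollapsible.redundantFace_not {l : List (X.tensor Y).cube}
    (h : IsVertCollapsible l) :
    ¬ IsCollapsible (redundantFace l) ∧ ¬ IsEssential (redundantFace l) := by
  have h1 := h.isVertThenHoriz
  rw [h.redundantFace_eq]
  generalize vertRedundantFace l = l' at h1
  cases l' with
  | nil => exact h1.elim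
  | cons c l' =>
    have h2 : ¬ IsHorizontal c := h1.1.not_isHorizontal
    exact ⟨fun h3 => h1.not_isVertCollapsible (h3.resolve_right fun h4 => h2 h4.1),
      fun h3 => h1.not_forall_isVertical (h3.resolve_right fun h4 => h2 h4.1)⟩

theorem IsHorizontal.isCollapsible_cons {c : (X.tensor Y).cube} (hc : IsHorizontal c)
    {l : List (X.tensor Y).cube} : IsCollapsible (c :: l) ↔ IsCollapsible l :=
  ⟨fun h => (h.resolve_left fun h' => h'.head_not_isHorizontal hc).2, fun h => Or.inr ⟨hc, h⟩⟩

theorem IsHorizontal.isEssential_cons {c : (X.tensor Y).cube} (hc : IsHorizontal c)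
    {l : List (X.tensor Y).cube} : IsEssential (c :: l) ↔ IsEssential l :=
  ⟨fun h => (h.resolve_left fun h' => (h' c (by simp)).not_isHorizontal hc).2,
    fun h => Or.inr ⟨hc, h⟩⟩

theorem IsHorizontal.redundantFace_cons {c : (X.tensor Y).cube} (hc : IsHorizontal c)
    (l : List (X.tensor Y).cube) : redundantFace (c :: l) = c :: redundantFace l := if_pos hc

theorem IsCollapsible.redundantFace_not {l : List (X.tensor Y).cube} (h : IsCollapsible l) :
    ¬ IsCollapsible (redundantFace l) ∧ ¬ IsEssential (redundantFace l) := by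
  induction l with
  | nil => exact h.elim
  | cons c l ih =>
    rcases h with h | ⟨hc, h⟩
    · exact h.redundantFace_not
    · rw [hc.redundantFace_cons, hc.isCollapsible_cons, hc.isEssential_cons]
      exact ih h

theorem IsVertCollapsible.vertRedundantFace_inj {l l' : List (X.tensor Y).cube}
    (h : IsVertCollapsible l) (h' : IsVertCollapsible l')
    (e : vertRedundantFace l = vertRedundantFace l') : l = l' := by
  induction l generalizing l' with
  | nil => exact h.elim
  | cons c l ih =>
    cases l' with
    | nil => exact h'.elim
    | cons c' l' =>
      by_cases hc : IsVertical c <;> by_cases hc' : IsVertical c'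
      · rw [vertRedundantFace, vertRedundantFace, if_pos hc, if_pos hc', List.cons.injEq] at e
        rw [e.1, ih (h.resolve_left fun h' => h'.not_isVertical hc).2
          (h'.resolve_left fun h' => h'.not_isVertical hc').2 e.2]
      · have h1 := (h.resolve_left fun h' => h'.not_isVertical hc).2.isVertThenHoriz
        rw [vertRedundantFace, vertRedundantFace, if_pos hc, if_neg hc', List.cons.injEq] at e
        rw [e.2] at h1
        exact absurd (h'.resolve_right fun h' => hc' h'.1).isHorizontal_horizFace
          h1.1.not_isHorizontal
      · have h1 := (h'.resolve_left fun h' => h'.not_isVertical hc').2.isVertThenHoriz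
        rw [vertRedundantFace, vertRedundantFace, if_neg hc, if_pos hc', List.cons.injEq] at e
        rw [← e.2] at h1
        exact absurd (h.resolve_right fun h' => hc h'.1).isHorizontal_horizFace
          h1.1.not_isHorizontal
      · rw [vertRedundantFace, vertRedundantFace, if_neg hc, if_neg hc', List.cons.injEq,
          List.cons.injEq] at e
        rw [e.2.2, eq_of_vertFace_of_horizFace e.1 e.2.1]

theorem IsCollapsible.redundantFace_inj {l l' : List (X.tensor Y).cube}
    (h : IsCollapsible l) (h' : IsCollapsible l')
    (e : redundantFace l = redundantFace l') : l = l' := by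
  induction l generalizing l' with
  | nil => exact h.elim
  | cons c l ih =>
    cases l' with
    | nil => exact h'.elim
    | cons c' l' =>
      have key : ∀ {a : (X.tensor Y).cube} {k l : List (X.tensor Y).cube}, IsHorizontal a →
          IsVertCollapsible k → a :: l ≠ redundantFace k := by
        intro a k l ha hk e
        have h1 := hk.isVertThenHoriz
        rw [← hk.redundantFace_eq, ← e] at h1
        exact h1.1.not_isHorizontal ha
      rcases h with h | ⟨hc, h⟩ <;> rcases h' with h' | ⟨hc', h'⟩
      · rw [h.redundantFace_eq, h'.redundantFace_eq] at e
        exact h.vertRedundantFace_inj h' e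
      · rw [hc'.redundantFace_cons] at e
        exact absurd e.symm (key hc' h)
      · rw [hc.redundantFace_cons] at e
        exact absurd e (key hc h')
      · rw [hc.redundantFace_cons, hc'.redundantFace_cons, List.cons.injEq] at e
        rw [e.1, ih h h' e.2]

end Letters

/-! ### Splittings of horizontal, vertical and mixed cubes -/

section SplittingLetters

variable {X Y : PrecubicalSet.{u}}

theorem IsHorizontal.split {c : (X.tensor Y).cube} (hc : IsHorizontal c) {w : List Bool}
    (hw : w.length = (X.tensor Y).dim c) (ht : true ∈ w) (hf : false ∈ w) :
    IsHorizontal (lo (X := X.tensor Y) w c) ∧ IsHorizontal (hi (X := X.tensor Y) w c) := by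
  obtain ⟨w₁, w₂, rfl, h₁, h₂⟩ := exists_append_of_length_eq_dim hw
  rw [hc.2, List.length_eq_zero_iff] at h₁
  subst h₁
  rw [List.nil_append] at ht hf
  have ht := List.count_pos_iff.2 ht
  have hf := List.count_pos_iff.2 hf
  rw [lo_append c h₂, hi_append c h₂]
  refine ⟨⟨?_, ?_⟩, ?_, ?_⟩
  · exact (dim_lo h₂).symm ▸ ht
  · exact dim_lo (w := []) hc.2.symm
  · exact (dim_hi h₂).symm ▸ hf
  · exact dim_hi (w := []) hc.2.symm

theorem IsVertical.split {c : (X.tensor Y).cube} (hc : IsVertical c) {w : List Bool}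
    (hw : w.length = (X.tensor Y).dim c) (ht : true ∈ w) (hf : false ∈ w) :
    IsVertical (lo (X := X.tensor Y) w c) ∧ IsVertical (hi (X := X.tensor Y) w c) := by
  obtain ⟨w₁, w₂, rfl, h₁, h₂⟩ := exists_append_of_length_eq_dim hw
  have h₃ := h₂
  rw [hc.1, List.length_eq_zero_iff] at h₃
  subst h₃
  rw [List.append_nil] at ht hf
  have ht := List.count_pos_iff.2 ht
  have hf := List.count_pos_iff.2 hf
  rw [lo_append c h₂, hi_append c h₂]
  refine ⟨⟨?_, ?_⟩, ?_, ?_⟩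
  · exact dim_lo (w := []) hc.1.symm
  · exact (dim_lo h₁).symm ▸ ht
  · exact dim_hi (w := []) hc.1.symm
  · exact (dim_hi h₁).symm ▸ hf

/-- The word of the splitting of `c = (x, y)` into `vertFace c` and `horizFace c`. -/
def vertHorizWord (c : (X.tensor Y).cube) : List Bool :=
  List.replicate (Y.dim c.2) true ++ List.replicate (X.dim c.1) false

theorem length_vertHorizWord (c : (X.tensor Y).cube) :
    (vertHorizWord c).length = (X.tensor Y).dim c := by
  simp only [vertHorizWord, List.length_append, List.length_replicate]
  exact Nat.add_comm _ _

theorem lo_vertHorizWord (c : (X.tensor Y).cube) :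
    lo (X := X.tensor Y) (vertHorizWord c) c = vertFace c := by
  rw [vertHorizWord, lo_append c (by simp), lo_replicate_true, lo_replicate_false]; rfl

theorem hi_vertHorizWord (c : (X.tensor Y).cube) :
    hi (X := X.tensor Y) (vertHorizWord c) c = horizFace c := by
  rw [vertHorizWord, hi_append c (by simp), hi_replicate_true, hi_replicate_false]; rfl

/-- Unless a splitting of a mixed cube is the one given by `vertHorizWord`, its first cube is mixed or
horizontal, or its second cube is mixed. -/
theorem IsMixed.split {c : (X.tensor Y).cube} (hc : IsMixed c) {w : List Bool}
    (hw : w.length = (X.tensor Y).dim c) (ht : true ∈ w) (hne : w ≠ vertHorizWord c) :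
    IsMixed (lo (X := X.tensor Y) w c) ∨ IsHorizontal (lo (X := X.tensor Y) w c) ∨
      IsVertical (lo (X := X.tensor Y) w c) ∧ IsMixed (hi (X := X.tensor Y) w c) := by
  obtain ⟨w₁, w₂, rfl, h₁, h₂⟩ := exists_append_of_length_eq_dim hw
  have ht := List.count_pos_iff.2 ht
  rw [List.count_append] at ht
  have a₁ := count_add w₁
  have a₂ := count_add w₂
  have hc₁ := hc.1
  have hc₂ := hc.2
  have hl : X.dim (lo w₂ c.1) = _ := dim_lo h₂
  have hl' : Y.dim (lo w₁ c.2) = _ := dim_lo h₁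
  have hh : X.dim (hi w₂ c.1) = _ := dim_hi h₂
  have hh' : Y.dim (hi w₁ c.2) = _ := dim_hi h₁
  rw [lo_append c h₂, hi_append c h₂]
  by_cases h : w₂.count true = 0
  · right; right
    have hne' : w₁.count false ≠ 0 := fun h' => hne (by
      rw [vertHorizWord, ← eq_replicate_true h₁ h', ← eq_replicate_false h₂ h])
    unfold IsMixed IsVertical
    simp only [hl, hl', hh, hh']
    omega
  · unfold IsMixed IsHorizontal
    simp only [hl, hl']
    omega

end SplittingLetters

/-! ### Boundaries of essential and collapsible lists -/

section Matching

variable (R : Type v) [CommRing R] {X Y : PrecubicalSet.{u}}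

theorem pre_mem_supported {Z : PrecubicalSet.{u}} (c : Z.cube) {S T : Set (List Z.cube)}
    (h : ∀ l ∈ S, c :: l ∈ T) {z : List Z.cube →₀ R} (hz : z ∈ Finsupp.supported R R S) :
    pre R c z ∈ Finsupp.supported R R T := by
  classical
  rw [Finsupp.mem_supported] at hz ⊢
  intro l hl
  obtain ⟨l', hl', rfl⟩ := Finset.mem_image.1 (Finsupp.mapDomain_support hl)
  exact h l' (hz hl')

theorem fsplit_single_mem_supported {Z : PrecubicalSet.{u}} (c : Z.cube) (l : List Z.cube)
    {T : Set (List Z.cube)} (h : ∀ w : List Bool, w.length = Z.dim c → true ∈ w → false ∈ w →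
      lo w c :: hi w c :: l ∈ T) :
    fsplit (pre R) c (Finsupp.single l 1) ∈ Finsupp.supported R R T := by
  rw [fsplit_single]
  refine wsum_mem _ fun w hw => ?_
  split_ifs with hp
  · exact Finsupp.single_mem_supported R _ (h w hw hp.1 hp.2)
  · exact Submodule.zero_mem _

theorem rawList_vertical_mem (l : List (X.tensor Y).cube) (hl : ∀ d ∈ l, IsVertical d) :
    rawList R l ∈ Finsupp.supported R R
      {l' : List (X.tensor Y).cube | l' ≠ [] ∧ ∀ d ∈ l', IsVertical d} := by
  induction l with
  | nil => exact Submodule.zero_mem _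
  | cons c l ih =>
    have hc : IsVertical c := hl c (by simp)
    have hl' : ∀ d ∈ l, IsVertical d := fun d hd => hl d (by simp [hd])
    rw [rawList]
    refine Submodule.add_mem _ (fsplit_single_mem_supported R c l fun w hw ht hf => ?_)
      (Submodule.smul_mem _ _ (pre_mem_supported R c (fun l' h' => ?_) (ih hl')))
    · have := hc.split hw ht hf
      refine ⟨by simp, ?_⟩
      simpa using ⟨this.1, this.2, hl'⟩
    · refine ⟨by simp, ?_⟩
      simpa using ⟨hc, h'.2⟩

/-- The essential lists span a subcomplex. -/
theorem rawList_essential_mem (l : List (X.tensor Y).cube) (hl : IsEssential l) :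
    rawList R l ∈ Finsupp.supported R R {l' : List (X.tensor Y).cube | IsEssential l'} := by
  induction l with
  | nil => exact Submodule.zero_mem _
  | cons c l ih =>
    rcases hl with hl | ⟨hc, hl⟩
    · refine Finsupp.supported_mono ?_ (rawList_vertical_mem R _ hl)
      rintro (_ | ⟨c, l⟩) ⟨h, h'⟩
      · exact absurd rfl h
      · exact Or.inl h'
    · rw [rawList]
      refine Submodule.add_mem _ (fsplit_single_mem_supported R c l fun w hw ht hf => ?_)
        (Submodule.smul_mem _ _ (pre_mem_supported R c (fun l' h' => ?_) (ih hl)))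
      · have := hc.split hw ht hf
        exact Or.inr ⟨this.1, Or.inr ⟨this.2, hl⟩⟩
      · exact Or.inr ⟨hc, h'⟩

theorem one_or_neg_one_mul_pow {s : R} (hs : s = 1 ∨ s = -1) (n : ℕ) :
    (-1) ^ n * s = 1 ∨ (-1) ^ n * s = -1 := by
  rcases hs with rfl | rfl <;> rcases neg_one_pow_eq_or R n with h | h <;> simp [h]

theorem rawList_vertCollapsible (l : List (X.tensor Y).cube) (hl : IsVertCollapsible l) :
    ∃ s : R, (s = 1 ∨ s = -1) ∧ rawList R l - Finsupp.single (vertRedundantFace l) s ∈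
      Finsupp.supported R R {l' : List (X.tensor Y).cube | IsVertCollapsible l' ∨
        IsVertThenHoriz (vertLength l) l' ∧ l'.length = l.length + 1} := by
  induction l with
  | nil => exact hl.elim
  | cons c l ih =>
    rcases hl with hc | ⟨hc, hl⟩
    · have hv : ¬ IsVertical c := hc.not_isVertical
      refine ⟨(-1) ^ wexp (vertHorizWord c), neg_one_pow_eq_or R _, ?_⟩
      rw [vertRedundantFace, if_neg hv, vertLength, if_neg hv, rawList, add_sub_right_comm]
      refine Submodule.add_mem _ ?_ (Submodule.smul_mem _ _ (pre_mem_supported R c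
        (S := Set.univ) (fun l' _ => Or.inl (Or.inl hc)) (by simp)))
      have h1 := hc.1
      have h2 := hc.2
      have hp : true ∈ vertHorizWord c ∧ false ∈ vertHorizWord c := by
        simp only [vertHorizWord, List.mem_append, List.mem_replicate]
        exact ⟨Or.inl ⟨by omega, trivial⟩, Or.inr ⟨by omega, trivial⟩⟩
      have key := wsum_sub_mem (Finsupp.supported R R {l' : List (X.tensor Y).cube |
          IsVertCollapsible l' ∨ IsVertThenHoriz 0 l' ∧ l'.length = (c :: l).length + 1})
        (f := fun w => if true ∈ w ∧ false ∈ w then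
          Finsupp.single (lo (X := X.tensor Y) w c :: hi (X := X.tensor Y) w c :: l)
            ((-1 : R) ^ wexp w) else 0)
        (vertHorizWord c) (length_vertHorizWord c) fun w hw hne => by
          split_ifs with hp
          · refine Finsupp.single_mem_supported R _ ?_
            rcases hc.split hw hp.1 hne with h | h | h
            · exact Or.inl (Or.inl h)
            · exact Or.inr ⟨h, by simp⟩
            · exact Or.inl (Or.inr ⟨h.1, Or.inl h.2⟩)
          · exact Submodule.zero_mem _
      rw [if_pos hp, lo_vertHorizWord, hi_vertHorizWord] at key
      rw [fsplit_single]
      exact key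
    · obtain ⟨s, hs, h⟩ := ih hl
      refine ⟨(-1) ^ ((X.tensor Y).dim c - 1) * s, one_or_neg_one_mul_pow R hs _, ?_⟩
      rw [vertRedundantFace, if_pos hc, vertLength, if_pos hc, rawList, ← smul_eq_mul,
        ← Finsupp.smul_single, ← pre_single, add_sub_assoc, ← smul_sub, ← map_sub]
      refine Submodule.add_mem _ (fsplit_single_mem_supported R c l fun w hw ht hf => ?_)
        (Submodule.smul_mem _ _ (pre_mem_supported R c (fun l' h' => ?_) h))
      · have := hc.split hw ht hf
        exact Or.inl (Or.inr ⟨this.1, Or.inr ⟨this.2, hl⟩⟩)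
      · rcases h' with h' | ⟨h', h''⟩
        · exact Or.inl (Or.inr ⟨hc, h'⟩)
        · exact Or.inr ⟨⟨hc, h'⟩, by simp [h'']⟩

/-- The boundary of a collapsible list `l` is `± redundantFace l`, up to collapsible lists and lists
of smaller weight. -/
theorem rawList_collapsible (l : List (X.tensor Y).cube) (hl : IsCollapsible l) :
    ∃ s : R, (s = 1 ∨ s = -1) ∧ rawList R l - Finsupp.single (redundantFace l) s ∈
      Finsupp.supported R R {l' : List (X.tensor Y).cube | IsCollapsible l' ∨
        weight l' < weight (redundantFace l)} := by
  induction l with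
  | nil => exact hl.elim
  | cons c l ih =>
    rcases hl with hl | ⟨hc, hl⟩
    · obtain ⟨s, hs, h⟩ := rawList_vertCollapsible R (c :: l) hl
      refine ⟨s, hs, ?_⟩
      rw [hl.weight_redundantFace, hl.redundantFace_eq]
      refine Finsupp.supported_mono ?_ h
      rintro l' (h' | ⟨h', h''⟩)
      · exact Or.inl h'.isCollapsible
      · exact Or.inr (h'' ▸ h'.weight_lt)
    · obtain ⟨s, hs, h⟩ := ih hl
      refine ⟨(-1) ^ ((X.tensor Y).dim c - 1) * s, one_or_neg_one_mul_pow R hs _, ?_⟩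
      rw [hc.redundantFace_cons, weight_cons_horizontal hc, rawList, ← smul_eq_mul,
        ← Finsupp.smul_single, ← pre_single, add_sub_assoc, ← smul_sub, ← map_sub]
      refine Submodule.add_mem _ (fsplit_single_mem_supported R c l fun w hw ht hf => ?_)
        (Submodule.smul_mem _ _ (pre_mem_supported R c (fun l' h' => ?_) h))
      · have := hc.split hw ht hf
        exact Or.inl (Or.inr ⟨this.1, Or.inr ⟨this.2, hl⟩⟩)
      · rcases h' with h' | h'
        · exact Or.inl (Or.inr ⟨hc, h'⟩)
        · exact Or.inr (by rwa [weight_cons_horizontal hc])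

/-! Every composable list is essential, collapsible, or the redundant face of a collapsible one. -/

theorem isVertical_or_isVertCollapsible_or {v w : (X.tensor Y).Vertex}
    {l : List (X.tensor Y).cube} (h : (X.tensor Y).IsChain v l w) :
    (∀ d ∈ l, IsVertical d) ∨ IsVertCollapsible l ∨
      (∃ l', (X.tensor Y).IsChain v l' w ∧ IsVertCollapsible l' ∧ vertRedundantFace l' = l) ∨
      ∃ c l', l = c :: l' ∧ IsHorizontal c := by
  induction l generalizing v with
  | nil => simp
  | cons c l ih =>
    obtain ⟨h1, h2, h3⟩ := h
    rcases letter_trichotomy h1 with hc | hc | hc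
    · exact Or.inr (Or.inr (Or.inr ⟨c, l, rfl, hc⟩))
    · rcases ih h3 with hl | hl | ⟨l', hl, hl', rfl⟩ | ⟨d, l', rfl, hd⟩
      · left
        simpa using ⟨hc, hl⟩
      · exact Or.inr (Or.inl (Or.inr ⟨hc, hl⟩))
      · exact Or.inr (Or.inr (Or.inl ⟨c :: l', ⟨h1, h2, hl⟩, Or.inr ⟨hc, hl'⟩, if_pos hc⟩))
      · -- The vertical cube `c` and the horizontal cube `d` that follows it are composable, hence of
        -- the form `(d^0 x, y)` and `(x, d^1 y)`, where `(x, y)` is the mixed cube `b`.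
        obtain ⟨h4, h5, h6⟩ := h3
        obtain ⟨b, hb1, hb2⟩ : ∃ b : (X.tensor Y).cube, b.1 = d.1 ∧ b.2 = c.2 :=
          ⟨((d.1, c.2) : X.cube × Y.cube), rfl, rfl⟩
        have hbm : IsMixed b := ⟨hb1 ▸ hd.1, hb2 ▸ hc.2⟩
        have e1 := congrArg Vertex.fst h5
        have e2 := congrArg Vertex.snd h5
        rw [tensor_endpoint_fst, tensor_endpoint_fst, endpoint_of_dim_eq_zero true hc.1] at e1
        rw [tensor_endpoint_snd, tensor_endpoint_snd, endpoint_of_dim_eq_zero false hd.2] at e2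
        have hcb : vertFace b = c := Prod.ext
          ((congrArg (fun a => (X.endpoint false a).1) hb1).trans (congrArg Subtype.val e1)) hb2
        have hdb : horizFace b = d := Prod.ext hb1
          ((congrArg (fun a => (Y.endpoint true a).1) hb2).trans (congrArg Subtype.val e2).symm)
        refine Or.inr (Or.inr (Or.inl ⟨b :: l', ⟨?_, ?_, ?_⟩, Or.inl hbm, ?_⟩))
        · exact Nat.le_add_right_of_le hbm.1
        · rw [← lo_vertHorizWord] at hcb
          rw [← h2, ← hcb, endpoint_lo_false (length_vertHorizWord b)]
        · rw [← hi_vertHorizWord] at hdb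
          rw [← hdb, endpoint_hi_true (length_vertHorizWord b)] at h6
          exact h6
        · rw [vertRedundantFace, if_neg hbm.not_isVertical, hcb, hdb]
    · exact Or.inr (Or.inl (Or.inl hc))

theorem isEssential_or_isCollapsible_or {v w : (X.tensor Y).Vertex}
    {l : List (X.tensor Y).cube} (h : (X.tensor Y).IsChain v l w) :
    IsEssential l ∨ IsCollapsible l ∨
      ∃ l', (X.tensor Y).IsChain v l' w ∧ IsCollapsible l' ∧ redundantFace l' = l := by
  induction l generalizing v with
  | nil => exact Or.inl trivial
  | cons c l ih =>
    rcases isVertical_or_isVertCollapsible_or h with hl | hl | ⟨l', h1, h2, h3⟩ | ⟨d, l', hd, hc⟩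
    · exact Or.inl (Or.inl hl)
    · exact Or.inr (Or.inl (Or.inl hl))
    · exact Or.inr (Or.inr ⟨l', h1, h2.isCollapsible, h2.redundantFace_eq.trans h3⟩)
    · obtain ⟨rfl, rfl⟩ := List.cons.inj hd
      obtain ⟨h1, h2, h3⟩ := h
      rcases ih h3 with hl | hl | ⟨l', h4, h5, h6⟩
      · exact Or.inl (Or.inr ⟨hc, hl⟩)
      · exact Or.inr (Or.inl (Or.inr ⟨hc, hl⟩))
      · refine Or.inr (Or.inr ⟨c :: l', ⟨h1, h2, h4⟩, Or.inr ⟨hc, h5⟩, ?_⟩)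
        rw [hc.redundantFace_cons, h6]

theorem IsMixed.isChain_faces {c : (X.tensor Y).cube} (hc : IsMixed c)
    {v w : (X.tensor Y).Vertex} {l : List (X.tensor Y).cube}
    (h : (X.tensor Y).IsChain v (c :: l) w) :
    (X.tensor Y).IsChain v (vertFace c :: horizFace c :: l) w := by
  have e := length_vertHorizWord c
  have h1 := hc.isVertical_vertFace
  have h2 := hc.isHorizontal_horizFace
  refine ⟨Nat.le_add_left_of_le h1.2, ?_, Nat.le_add_right_of_le h2.1, ?_, ?_⟩
  · rw [← lo_vertHorizWord, endpoint_lo_false e]; exact h.2.1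
  · rw [← lo_vertHorizWord, ← hi_vertHorizWord, endpoint_lo_hi e]
  · rw [← hi_vertHorizWord, endpoint_hi_true e]; exact h.2.2

theorem IsMixed.degree_faces {c : (X.tensor Y).cube} (hc : IsMixed c)
    (l : List (X.tensor Y).cube) :
    (X.tensor Y).degree (vertFace c :: horizFace c :: l) + 1 = (X.tensor Y).degree (c :: l) := by
  have h1 : (X.tensor Y).dim (vertFace c) = 0 + Y.dim c.2 :=
    congrArg (· + _) (dim_vertex _)
  have h2 : (X.tensor Y).dim (horizFace c) = X.dim c.1 + 0 :=
    congrArg (_ + ·) (dim_vertex _)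
  have h3 : (X.tensor Y).dim c = X.dim c.1 + Y.dim c.2 := rfl
  have h4 := hc.1
  have h5 := hc.2
  rw [degree_cons, degree_cons, degree_cons, h1, h2, h3]
  omega

theorem IsCollapsible.redundantFace_spec {v w : (X.tensor Y).Vertex}
    {l : List (X.tensor Y).cube} (hl : IsCollapsible l) (h : (X.tensor Y).IsChain v l w) :
    (X.tensor Y).IsChain v (redundantFace l) w ∧
      (X.tensor Y).degree (redundantFace l) + 1 = (X.tensor Y).degree l := by
  have key : ∀ (l : List (X.tensor Y).cube) (v : (X.tensor Y).Vertex), IsVertCollapsible l →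
      (X.tensor Y).IsChain v l w → (X.tensor Y).IsChain v (vertRedundantFace l) w ∧
        (X.tensor Y).degree (vertRedundantFace l) + 1 = (X.tensor Y).degree l := by
    intro l
    induction l with
    | nil => exact fun _ h => h.elim
    | cons c l ih =>
      intro v hl h
      rw [vertRedundantFace]
      split_ifs with hc
      · have := ih _ (hl.resolve_left fun h' => h'.not_isVertical hc).2 h.2.2
        refine ⟨⟨h.1, h.2.1, this.1⟩, ?_⟩
        rw [degree_cons, degree_cons, ← this.2]
        rfl
      · have hm : IsMixed c := hl.resolve_right fun h' => hc h'.1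
        exact ⟨hm.isChain_faces h, hm.degree_faces l⟩
  induction l generalizing v with
  | nil => exact hl.elim
  | cons c l ih =>
    rcases hl with hl | ⟨hc, hl⟩
    · rw [hl.redundantFace_eq]
      exact key _ _ hl h
    · have := ih hl h.2.2
      rw [hc.redundantFace_cons]
      refine ⟨⟨h.1, h.2.1, this.1⟩, ?_⟩
      rw [degree_cons, degree_cons, ← this.2]
      rfl

end Matching

/-! ### Formal splittings -/

section FormalSplitting

variable (R : Type v) [CommRing R] {X : PrecubicalSet.{u}} {M N : Type*} [AddCommGroup M]
  [Module R M] [AddCommGroup N] [Module R N]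

theorem fsplit_apply (κ : X.cube → Module.End R M) (c : X.cube) (m : M) :
    fsplit κ c m = wsum (X.dim c) fun w =>
      if true ∈ w ∧ false ∈ w then (-1 : R) ^ wexp w • κ (lo w c) (κ (hi w c) m) else 0 := by
  have h0 := map_wsum (M := Module.End R M) (LinearMap.applyₗ m).toAddMonoidHom (X.dim c)
    (fun w => if true ∈ w ∧ false ∈ w then
      (-1 : R) ^ wexp w • (κ (lo w c) * κ (hi w c)) else 0)
  simp only [LinearMap.toAddMonoidHom_coe, LinearMap.applyₗ_apply_apply] at h0
  rw [fsplit_eq (R := R), h0]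
  refine wsum_congr fun w _ => ?_
  split_ifs <;> rfl

variable {R}

theorem map_fsplit (φ : M →ₗ[R] N) (κ : X.cube → Module.End R M) (κ' : X.cube → Module.End R N)
    (h : ∀ c m, φ (κ c m) = κ' c (φ m)) (c : X.cube) (m : M) :
    φ (fsplit κ c m) = fsplit κ' c (φ m) := by
  rw [fsplit_apply, fsplit_apply]
  refine (map_wsum φ.toAddMonoidHom _ _).trans (wsum_congr fun w _ => ?_)
  simp only [LinearMap.toAddMonoidHom_coe]
  split_ifs
  · rw [map_smul, h, h]
  · exact map_zero φ

theorem eq_of_mem_supported {α : Type*} {S : Set α} {f g : (α →₀ R) →ₗ[R] M}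
    (h : ∀ a ∈ S, f (Finsupp.single a 1) = g (Finsupp.single a 1)) {z : α →₀ R}
    (hz : z ∈ Finsupp.supported R R S) : f z = g z := by
  rw [Finsupp.supported_eq_span_single] at hz
  refine LinearMap.eqOn_span ?_ hz
  rintro _ ⟨a, ha, rfl⟩
  exact h a ha

variable (R)

theorem degree_lo_hi {c : X.cube} {w : List Bool} (hw : w.length = X.dim c) (ht : true ∈ w)
    (hf : false ∈ w) (l : List X.cube) :
    X.degree (lo w c :: hi w c :: l) + 1 = X.degree (c :: l) := by
  have d1 := dim_lo hw
  have d2 := dim_hi hw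
  have d3 := count_add w
  have d4 : 0 < w.count true := List.count_pos_iff.2 ht
  have d5 : 0 < w.count false := List.count_pos_iff.2 hf
  rw [degree_cons, degree_cons, degree_cons, d1, d2]
  omega

theorem rawList_mem_degree (l : List X.cube) :
    rawList R l ∈ Finsupp.supported R R {l' : List X.cube | X.degree l' + 1 = X.degree l} := by
  induction l with
  | nil => exact Submodule.zero_mem _
  | cons c l ih =>
    rw [rawList]
    refine Submodule.add_mem _ (fsplit_single_mem_supported R c l fun w hw ht hf => ?_)
      (Submodule.smul_mem _ _ (pre_mem_supported R c (fun l' h' => ?_) ih))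
    · exact degree_lo_hi hw ht hf l
    · have h' : X.degree l' + 1 = X.degree l := h'
      change X.degree (c :: l') + 1 = X.degree (c :: l)
      rw [degree_cons, degree_cons, ← h', add_assoc]

theorem rawList_of_degree_eq_zero {l : List X.cube} (h : X.degree l = 0) : rawList R l = 0 := by
  have := rawList_mem_degree R l
  rw [h] at this
  have e : {l' : List X.cube | X.degree l' + 1 = 0} = ∅ := by ext; simp
  rw [e, Finsupp.supported_empty] at this
  exact (Submodule.mem_bot R).1 this

end FormalSplitting

/-! ### Milgram's map on lists -/

section Milgram

variable (R : Type v) [CommRing R] {X Y : PrecubicalSet.{u}}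

variable (X Y) in
/-- Formal linear combinations of pairs of lists of cubes: an enlargement of `C(X) ⊗ C(Y)` in which
endpoints and composability are disregarded. -/
abbrev PairModule : Type (max u v) := (List X.cube × List Y.cube) →₀ R

/-- The inclusion `z ↦ z ⊗ l'`. -/
noncomputable def pairLeft (l' : List Y.cube) : (List X.cube →₀ R) →ₗ[R] PairModule R X Y :=
  Finsupp.lmapDomain R R fun l => (l, l')

/-- The inclusion `z ↦ l ⊗ z`. -/
noncomputable def pairRight (l : List X.cube) : (List Y.cube →₀ R) →ₗ[R] PairModule R X Y :=
  Finsupp.lmapDomain R R fun l' => (l, l')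

/-- The operator `l ⊗ l' ↦ x l ⊗ l'`. -/
noncomputable def preFst (x : X.cube) : Module.End R (PairModule R X Y) :=
  Finsupp.lmapDomain R R fun p => (x :: p.1, p.2)

/-- The operator `l ⊗ l' ↦ ± l ⊗ y l'`, with the Koszul sign for moving `y` past `l`. -/
noncomputable def preSnd (y : Y.cube) : Module.End R (PairModule R X Y) :=
  Finsupp.linearCombination R fun p =>
    Finsupp.single (p.1, y :: p.2) ((-1 : R) ^ ((Y.dim y - 1) * X.degree p.1))

/-- The differential `l ⊗ l' ↦ ∂ l ⊗ l' + (-1)^{deg l} l ⊗ ∂ l'`. -/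
noncomputable def pairD : Module.End R (PairModule R X Y) :=
  Finsupp.linearCombination R fun p =>
    pairLeft R p.2 (rawList R p.1) + (-1 : R) ^ X.degree p.1 • pairRight R p.1 (rawList R p.2)

theorem pairLeft_single (l : List X.cube) (l' : List Y.cube) (r : R) :
    pairLeft R l' (Finsupp.single l r) = Finsupp.single (l, l') r := by simp [pairLeft]

theorem pairRight_single (l : List X.cube) (l' : List Y.cube) (r : R) :
    pairRight R l (Finsupp.single l' r) = Finsupp.single (l, l') r := by simp [pairRight]

theorem preFst_single (x : X.cube) (l : List X.cube) (l' : List Y.cube) (r : R) :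
    preFst R x (Finsupp.single (l, l') r) = Finsupp.single (x :: l, l') r := by simp [preFst]

theorem preSnd_single (y : Y.cube) (l : List X.cube) (l' : List Y.cube) (r : R) :
    preSnd R y (Finsupp.single (l, l') r) =
      (-1 : R) ^ ((Y.dim y - 1) * X.degree l) • Finsupp.single (l, y :: l') r := by
  simp [preSnd, mul_comm]

theorem pairD_single (l : List X.cube) (l' : List Y.cube) :
    pairD R (Finsupp.single (l, l') 1) =
      pairLeft R l' (rawList R l) + (-1 : R) ^ X.degree l • pairRight R l (rawList R l') := by
  simp [pairD]

theorem preFst_pairLeft (x : X.cube) (l' : List Y.cube) (z : List X.cube →₀ R) :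
    preFst R x (pairLeft R l' z) = pairLeft R l' (pre R x z) := by
  rw [preFst, pairLeft, pre, ← LinearMap.comp_apply, ← LinearMap.comp_apply,
    ← Finsupp.lmapDomain_comp, ← Finsupp.lmapDomain_comp]
  rfl

theorem preFst_pairRight (x : X.cube) (l : List X.cube) (z : List Y.cube →₀ R) :
    preFst R x (pairRight R l z) = pairRight R (x :: l) z := by
  rw [preFst, pairRight, pairRight, ← LinearMap.comp_apply, ← Finsupp.lmapDomain_comp]
  rfl

theorem preSnd_pairRight (y : Y.cube) (l : List X.cube) (z : List Y.cube →₀ R) :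
    preSnd R y (pairRight R l z) =
      (-1 : R) ^ ((Y.dim y - 1) * X.degree l) • pairRight R l (pre R y z) := by
  suffices preSnd R y ∘ₗ pairRight R l =
      (-1 : R) ^ ((Y.dim y - 1) * X.degree l) • (pairRight R l ∘ₗ pre R y) from
    congrArg (· z) this
  refine Finsupp.lhom_ext' fun l' => LinearMap.ext_ring ?_
  simp only [LinearMap.comp_apply, LinearMap.smul_apply, Finsupp.lsingle_apply, pairRight_single,
    pre_single, preSnd_single]

theorem preSnd_pairLeft (y : Y.cube) (l' : List Y.cube) {n : ℕ} {z : List X.cube →₀ R}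
    (hz : z ∈ Finsupp.supported R R {l : List X.cube | X.degree l + 1 = n}) :
    preSnd R y (pairLeft R l' z) =
      (-1 : R) ^ ((Y.dim y - 1) * (n + 1)) • pairLeft R (y :: l') z := by
  refine eq_of_mem_supported (f := preSnd R y ∘ₗ pairLeft R l')
    (g := (-1 : R) ^ ((Y.dim y - 1) * (n + 1)) • pairLeft R (y :: l')) (fun l hl => ?_) hz
  have hl : X.degree l + 1 = n := hl
  simp only [LinearMap.comp_apply, LinearMap.smul_apply, pairLeft_single, preSnd_single]
  congr 1
  rw [← hl]
  refine neg_one_pow_congr ?_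
  rw [show X.degree l + 1 + 1 = X.degree l + 2 * 1 by rfl, mul_add, mul_left_comm,
    Nat.add_mul_mod_self_left]

theorem fsplit_preFst (x : X.cube) (l : List X.cube) (l' : List Y.cube) :
    fsplit (preFst R) x (Finsupp.single (l, l') 1) =
      pairLeft R l' (fsplit (pre R) x (Finsupp.single l 1)) := by
  rw [map_fsplit (pairLeft R l') (pre R) (preFst R) (fun c m => (preFst_pairLeft R c l' m).symm),
    pairLeft_single]

theorem fsplit_preSnd (y : Y.cube) (l : List X.cube) (l' : List Y.cube) :
    fsplit (preSnd R) y (Finsupp.single (l, l') 1) =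
      (-1 : R) ^ (Y.dim y * X.degree l) •
        pairRight R l (fsplit (pre R) y (Finsupp.single l' 1)) := by
  rw [fsplit_apply, fsplit_apply]
  refine Eq.trans (wsum_congr fun w hw => ?_) (map_wsum
    ((-1 : R) ^ (Y.dim y * X.degree l) • pairRight R l).toAddMonoidHom _ _).symm
  simp only [LinearMap.toAddMonoidHom_coe, LinearMap.smul_apply]
  split_ifs with hp
  · have d1 := dim_lo hw
    have d2 := dim_hi hw
    have d3 := count_add w
    have d4 : 0 < w.count true := List.count_pos_iff.2 hp.1
    have d5 : 0 < w.count false := List.count_pos_iff.2 hp.2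
    rw [preSnd_single, map_smul, preSnd_single, pre_single, pre_single, map_smul,
      pairRight_single, smul_comm]
    simp only [smul_smul]
    congr 1
    rw [mul_left_comm, mul_comm, ← pow_add, ← add_mul]
    congr 1
    refine neg_one_pow_congr ?_
    rw [show Y.dim y = (Y.dim (hi w y) - 1 + (Y.dim (lo w y) - 1)) + 2 * 1 by omega, add_mul _ (2 * 1),
      mul_assoc 2, Nat.add_mul_mod_self_left]
  · simp

/-- The operator by which a cube of `X ⊗ Y` acts on pairs of lists: horizontal cubes are prepended
to the first list, vertical ones to the second list, and mixed ones act as `0`. -/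
noncomputable def letterAct (c : (X.tensor Y).cube) : Module.End R (PairModule R X Y) :=
  if IsHorizontal c then preFst R c.1 else if IsVertical c then preSnd R c.2 else 0

variable {R} in
theorem IsHorizontal.letterAct {c : (X.tensor Y).cube} (h : IsHorizontal c) :
    letterAct R c = preFst R c.1 := if_pos h

variable {R} in
theorem IsVertical.letterAct {c : (X.tensor Y).cube} (h : IsVertical c) :
    letterAct R c = preSnd R c.2 := (if_neg h.not_isHorizontal).trans (if_pos h)

variable {R} in
theorem IsMixed.letterAct {c : (X.tensor Y).cube} (h : IsMixed c) :
    letterAct R c = 0 := (if_neg h.not_isHorizontal).trans (if_neg h.not_isVertical)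

theorem IsHorizontal.fsplit_letterAct {c : (X.tensor Y).cube} (hc : IsHorizontal c) :
    fsplit (X := X.tensor Y) (PrecubicalSet.letterAct R) c = fsplit (preFst R) c.1 := by
  have e : (X.tensor Y).dim c = X.dim c.1 := congrArg (X.dim c.1 + ·) hc.2
  rw [fsplit, fsplit, e]
  refine wsum_congr fun w hw => ?_
  split_ifs with hp
  · have h := hc.split (hw.trans e.symm) hp.1 hp.2
    have h1 : lo (X := X.tensor Y) w c = (lo w c.1, c.2) := lo_append (w₁ := []) c hw
    have h2 : hi (X := X.tensor Y) w c = (hi w c.1, c.2) := hi_append (w₁ := []) c hw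
    rw [h.1.letterAct, h.2.letterAct, h1, h2]
  · rfl

theorem IsVertical.fsplit_letterAct {c : (X.tensor Y).cube} (hc : IsVertical c) :
    fsplit (X := X.tensor Y) (PrecubicalSet.letterAct R) c = fsplit (preSnd R) c.2 := by
  have e : (X.tensor Y).dim c = Y.dim c.2 := (congrArg (· + Y.dim c.2) hc.1).trans (zero_add _)
  rw [fsplit, fsplit, e]
  refine wsum_congr fun w hw => ?_
  split_ifs with hp
  · have h := hc.split (hw.trans e.symm) hp.1 hp.2
    have h1 := lo_append (w₁ := w) (w₂ := []) c hc.1.symm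
    have h2 := hi_append (w₁ := w) (w₂ := []) c hc.1.symm
    rw [List.append_nil] at h1 h2
    rw [h.1.letterAct, h.2.letterAct, h1, h2]
  · rfl

theorem count_false_replicate_true (m n : ℕ) :
    (List.replicate m true ++ List.replicate n false).count false = n := by
  simp [List.count_replicate]

theorem wexp_replicate_false_append (m : ℕ) (w : List Bool) :
    wexp (List.replicate m false ++ w) = wexp w := by
  induction m with
  | zero => rfl
  | succ m ih => exact ih

theorem wexp_replicate_true_append (m n : ℕ) :
    wexp (List.replicate m true ++ List.replicate n false) = m * (n + 1) := by
  induction m with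
  | zero =>
    rw [zero_mul]
    have := wexp_replicate_false_append n []
    rwa [List.append_nil] at this
  | succ m ih =>
    rw [List.replicate_succ, List.cons_append, wexp, ih, count_false_replicate_true]
    ring

/-- A mixed cube has exactly two splittings into non-mixed cubes, namely `(d^0 x, y) (x, d^1 y)` and
`(x, d^0 y) (d^1 x, y)`; their contributions cancel. -/
theorem IsMixed.fsplit_letterAct {c : (X.tensor Y).cube} (hc : IsMixed c) :
    fsplit (X := X.tensor Y) (PrecubicalSet.letterAct R) c = 0 := by
  have hc1 := hc.1
  have hc2 := hc.2
  refine Finsupp.lhom_ext' fun p => LinearMap.ext_ring ?_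
  obtain ⟨l, l'⟩ := p
  simp only [LinearMap.comp_apply, Finsupp.lsingle_apply, LinearMap.zero_apply]
  rw [fsplit_apply]
  set F : List Bool → PairModule R X Y := fun w => if true ∈ w ∧ false ∈ w then
    (-1 : R) ^ wexp w • PrecubicalSet.letterAct R (lo (X := X.tensor Y) w c)
      (PrecubicalSet.letterAct R (hi (X := X.tensor Y) w c) (Finsupp.single (l, l') 1)) else 0
    with hF
  set w₀ : List Bool := List.replicate (Y.dim c.2) false ++ List.replicate (X.dim c.1) true with hw₀
  have hl₀ : w₀.length = (X.tensor Y).dim c := by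
    simp only [hw₀, List.length_append, List.length_replicate]
    exact Nat.add_comm _ _
  have hne : vertHorizWord c ≠ w₀ := fun h => by
    have h1 := congrArg (List.take (Y.dim c.2)) h
    rw [vertHorizWord, List.take_left' (by simp), hw₀, List.take_left' (by simp)] at h1
    have h2 : true ∈ List.replicate (Y.dim c.2) true := List.mem_replicate.2 ⟨by omega, rfl⟩
    rw [h1] at h2
    exact absurd (List.mem_replicate.1 h2).2 (by simp)
  have hl₁ := length_vertHorizWord c
  have hsplit : wsum ((X.tensor Y).dim c) F = F (vertHorizWord c) + F w₀ := by
    have h1 := wsum_eq_single (f := fun w => if w = vertHorizWord c then F w else 0)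
      (vertHorizWord c) hl₁ fun w _ hw => if_neg hw
    have h2 := wsum_eq_single (f := fun w => if w = w₀ then F w else 0) w₀ hl₀
      fun w _ hw => if_neg hw
    simp only [if_true] at h1 h2
    rw [← h1, ← h2, ← wsum_add]
    refine wsum_congr fun w hw => ?_
    by_cases e1 : w = vertHorizWord c
    · rw [if_pos e1, if_neg (e1 ▸ hne), add_zero]
    by_cases e2 : w = w₀
    · rw [if_pos e2, if_neg e1, zero_add]
    rw [if_neg e1, if_neg e2, add_zero, hF]
    simp only
    split_ifs with hp
    · rcases hc.split hw hp.1 e1 with h | h | h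
      · rw [h.letterAct, LinearMap.zero_apply, smul_zero]
      · -- If the first cube is horizontal and the second one is not mixed, then `w = w₀`.
        suffices IsMixed (hi (X := X.tensor Y) w c) by
          rw [this.letterAct, LinearMap.zero_apply, map_zero, smul_zero]
        obtain ⟨w₁, w₂, rfl, h₁, h₂⟩ := exists_append_of_length_eq_dim hw
        have a₁ := count_add w₁
        have a₂ := count_add w₂
        have hl' : Y.dim (lo w₁ c.2) = _ := dim_lo h₁
        have hh : X.dim (hi w₂ c.1) = _ := dim_hi h₂
        have hh' : Y.dim (hi w₁ c.2) = _ := dim_hi h₁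
        rw [lo_append c h₂] at h
        have h0 : Y.dim (lo w₁ c.2) = 0 := h.2
        rw [hl'] at h0
        rw [hi_append c h₂]
        have hne' : w₂.count false ≠ 0 := fun h' => e2 (by
          rw [hw₀, ← eq_replicate_false h₁ h0, ← eq_replicate_true h₂ h'])
        unfold IsMixed
        simp only [hh, hh']
        omega
      · rw [h.2.letterAct, LinearMap.zero_apply, map_zero, smul_zero]
    · rfl
  rw [hsplit, hF]
  simp only
  rw [if_pos, if_pos]
  · have e1 : lo (X := X.tensor Y) w₀ c = (c.1, (Y.endpoint false c.2).1) := by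
      rw [hw₀, lo_append c (by simp), lo_replicate_true, lo_replicate_false]
    have e2 : hi (X := X.tensor Y) w₀ c = ((X.endpoint true c.1).1, c.2) := by
      rw [hw₀, hi_append c (by simp), hi_replicate_true, hi_replicate_false]
    have h1 : IsHorizontal (lo (X := X.tensor Y) w₀ c) := e1 ▸ ⟨hc1, dim_vertex _⟩
    have h2 : IsVertical (hi (X := X.tensor Y) w₀ c) := e2 ▸ ⟨dim_vertex _, hc2⟩
    rw [h1.letterAct, h2.letterAct, e1, e2, lo_vertHorizWord, hi_vertHorizWord,
      hc.isVertical_vertFace.letterAct, hc.isHorizontal_horizFace.letterAct]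
    simp only [vertFace, horizFace]
    rw [preFst_single, preSnd_single, preSnd_single, map_smul, preFst_single, degree_cons]
    simp only [smul_smul, ← pow_add]
    rw [← add_smul]
    have hsum : ∀ a b : ℕ, a % 2 = (b + 1) % 2 → (-1 : R) ^ a + (-1) ^ b = 0 := fun a b hab => by
      rw [neg_one_pow_congr hab, pow_succ]
      ring
    rw [hsum, zero_smul]
    rw [vertHorizWord, wexp_replicate_true_append, hw₀, wexp_replicate_false_append]
    have := wexp_replicate_true_append (X.dim c.1) 0
    rw [List.replicate_zero, List.append_nil, zero_add, mul_one] at this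
    rw [this]
    obtain ⟨p, hp⟩ : ∃ p, X.dim c.1 = p + 1 := ⟨X.dim c.1 - 1, by omega⟩
    obtain ⟨q, hq⟩ : ∃ q, Y.dim c.2 = q + 1 := ⟨Y.dim c.2 - 1, by omega⟩
    rw [hp, hq]
    simp only [Nat.add_sub_cancel]
    rw [show (q + 1) * (p + 1 + 1) + q * (p + X.degree l) =
      p + 1 + q * X.degree l + 1 + 2 * (q * p + q) by ring, Nat.add_mul_mod_self_left]
  · simp only [hw₀, List.mem_append, List.mem_replicate]
    exact ⟨Or.inr ⟨by omega, trivial⟩, Or.inl ⟨by omega, trivial⟩⟩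
  · simp only [vertHorizWord, List.mem_append, List.mem_replicate]
    exact ⟨Or.inl ⟨by omega, trivial⟩, Or.inr ⟨by omega, trivial⟩⟩

theorem pairD_preFst (x : X.cube) :
    pairD R (Y := Y) * preFst R x =
      fsplit (preFst R) x + (-1 : R) ^ (X.dim x - 1) • (preFst R x * pairD R) := by
  refine Finsupp.lhom_ext' fun p => LinearMap.ext_ring ?_
  obtain ⟨l, l'⟩ := p
  simp only [LinearMap.comp_apply, Finsupp.lsingle_apply, Module.End.mul_apply,
    LinearMap.add_apply, LinearMap.smul_apply]
  rw [preFst_single, pairD_single, fsplit_preFst, pairD_single, map_add, map_smul,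
    preFst_pairLeft, preFst_pairRight, rawList, map_add, map_smul, degree_cons, smul_add, smul_smul,
    ← pow_add, add_assoc]

theorem pairD_preSnd (y : Y.cube) (hy : 1 ≤ Y.dim y) :
    pairD R (X := X) * preSnd R y =
      fsplit (preSnd R) y + (-1 : R) ^ (Y.dim y - 1) • (preSnd R y * pairD R) := by
  refine Finsupp.lhom_ext' fun p => LinearMap.ext_ring ?_
  obtain ⟨l, l'⟩ := p
  simp only [LinearMap.comp_apply, Finsupp.lsingle_apply, Module.End.mul_apply,
    LinearMap.add_apply, LinearMap.smul_apply]
  obtain ⟨q, hq⟩ : ∃ q, Y.dim y = q + 1 := ⟨Y.dim y - 1, by omega⟩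
  rw [preSnd_single, map_smul, pairD_single, fsplit_preSnd, pairD_single, map_add, map_smul,
    preSnd_pairLeft R y l' (rawList_mem_degree R l), preSnd_pairRight, rawList, map_add, map_smul,
    hq]
  simp only [Nat.add_sub_cancel, smul_add, smul_smul, ← pow_add]
  rw [add_left_comm]
  refine congrArg₂ (· + ·) ?_ (congrArg₂ (· + ·) ?_ ?_)
  · congr 2
    ring
  · congr 1
    refine neg_one_pow_congr ?_
    rw [show q + q * (X.degree l + 1) = q * X.degree l + 2 * q by ring, Nat.add_mul_mod_self_left]
  · congr 2
    ring

theorem pairD_letterAct (c : (X.tensor Y).cube) (hc : 1 ≤ (X.tensor Y).dim c) :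
    pairD R * letterAct R c = fsplit (X := X.tensor Y) (letterAct R) c +
      (-1 : R) ^ ((X.tensor Y).dim c - 1) • (letterAct R c * pairD R) := by
  rcases letter_trichotomy hc with h | h | h
  · rw [h.letterAct, h.fsplit_letterAct R, pairD_preFst,
      show (X.tensor Y).dim c = X.dim c.1 from congrArg (X.dim c.1 + ·) h.2]
  · rw [h.letterAct, h.fsplit_letterAct R, pairD_preSnd R _ h.2,
      show (X.tensor Y).dim c = Y.dim c.2 from (congrArg (· + Y.dim c.2) h.1).trans (zero_add _)]
  · rw [h.letterAct, h.fsplit_letterAct R, mul_zero, zero_mul, smul_zero, add_zero]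

/-- The image of a list of cubes of `X ⊗ Y` under Milgram's map. -/
noncomputable def milgramList : List (X.tensor Y).cube → PairModule R X Y
  | [] => Finsupp.single ([], []) 1
  | c :: l => letterAct R c (milgramList l)

/-- Milgram's map, on formal linear combinations of lists. -/
noncomputable def milgramRaw : (List (X.tensor Y).cube →₀ R) →ₗ[R] PairModule R X Y :=
  Finsupp.linearCombination R (milgramList R)

theorem milgramRaw_single (l : List (X.tensor Y).cube) :
    milgramRaw R (Finsupp.single l 1) = milgramList R l := by simp [milgramRaw]

theorem milgramRaw_pre (c : (X.tensor Y).cube) (z : List (X.tensor Y).cube →₀ R) :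
    milgramRaw R (pre R c z) = letterAct R c (milgramRaw R z) := by
  suffices milgramRaw R ∘ₗ pre R c = letterAct R c ∘ₗ milgramRaw R from congrArg (· z) this
  refine Finsupp.lhom_ext' fun l => LinearMap.ext_ring ?_
  simp only [LinearMap.comp_apply, Finsupp.lsingle_apply, pre_single, milgramRaw_single]
  rfl

theorem milgramRaw_rawList (l : List (X.tensor Y).cube) (hl : ∀ c ∈ l, 1 ≤ (X.tensor Y).dim c) :
    milgramRaw R (rawList R l) = pairD R (milgramList R l) := by
  induction l with
  | nil =>
    rw [rawList, milgramList, pairD_single, map_zero]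
    simp [rawList]
  | cons c l ih =>
    have h := congrArg (fun f => f (milgramList R l)) (pairD_letterAct R c (hl c (by simp)))
    simp only [Module.End.mul_apply, LinearMap.add_apply, LinearMap.smul_apply] at h
    rw [rawList, milgramList, h, map_add, map_smul, milgramRaw_pre,
      ih fun c hc => hl c (by simp [hc]),
      map_fsplit (milgramRaw R) (pre R) (letterAct R) (milgramRaw_pre R), milgramRaw_single]

/-- Attaching endpoints to a pair of lists. -/
noncomputable def keyPair (v w : X.Vertex) (v' w' : Y.Vertex) :
    PairModule R X Y →ₗ[R] (Key X × Key Y →₀ R) :=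
  Finsupp.lmapDomain R R fun p => ((v, p.1, w), (v', p.2, w'))

theorem keyPair_single (v w : X.Vertex) (v' w' : Y.Vertex) (l : List X.cube) (l' : List Y.cube)
    (r : R) : keyPair R v w v' w' (Finsupp.single (l, l') r) =
      Finsupp.single ((v, l, w), (v', l', w')) r := by simp [keyPair]

theorem finsuppTensor_key_left (v w : X.Vertex) (v' w' : Y.Vertex) (z : List X.cube →₀ R)
    (l' : List Y.cube) :
    finsuppTensorFinsupp' R (Key X) (Key Y) (key R v w z ⊗ₜ key R v' w' (Finsupp.single l' 1)) =
      keyPair R v w v' w' (pairLeft R l' z) := by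
  induction z using Finsupp.induction_linear with
  | zero => simp
  | add f g hf hg => simp only [map_add, TensorProduct.add_tmul, hf, hg]
  | single l r => simp [key, pairLeft_single, keyPair_single]

theorem finsuppTensor_key_right (v w : X.Vertex) (v' w' : Y.Vertex) (l : List X.cube)
    (z : List Y.cube →₀ R) :
    finsuppTensorFinsupp' R (Key X) (Key Y) (key R v w (Finsupp.single l 1) ⊗ₜ key R v' w' z) =
      keyPair R v w v' w' (pairRight R l z) := by
  induction z using Finsupp.induction_linear with
  | zero => simp
  | add f g hf hg => simp only [map_add, TensorProduct.tmul_add, hf, hg]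
  | single l r => simp [key, pairRight_single, keyPair_single]

variable (X Y) in
/-- Milgram's map on lists with endpoints. -/
noncomputable def milgramKey : (Key (X.tensor Y) →₀ R) →ₗ[R] (Key X × Key Y →₀ R) :=
  Finsupp.linearCombination R fun t =>
    keyPair R t.1.fst t.2.2.fst t.1.snd t.2.2.snd (milgramList R t.2.1)

theorem milgramKey_key (v w : (X.tensor Y).Vertex) (z : List (X.tensor Y).cube →₀ R) :
    milgramKey R X Y (key R v w z) = keyPair R v.fst w.fst v.snd w.snd (milgramRaw R z) := by
  suffices milgramKey R X Y ∘ₗ key R v w =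
      keyPair R v.fst w.fst v.snd w.snd ∘ₗ milgramRaw R from congrArg (· z) this
  refine Finsupp.lhom_ext' fun l => LinearMap.ext_ring ?_
  simp [milgramKey, key, milgramRaw_single]

end Milgram

end PrecubicalSet

/-! ### A criterion for quasi-isomorphisms -/

namespace BimoduleComplex

variable {R : Type*} [CommRing R] {A A' B B' : Type*} [Ring A] [Algebra R A] [Ring A']
  [Algebra R A'] [Ring B] [Algebra R B] [Ring B'] [Algebra R B']

/-- A chain map `φ : K → L` is a quasi-isomorphism if it restricts to an isomorphism on a subcomplex
`E` and the quotient `K / E` is acyclic for the following reason: modulo `E` and boundaries, `K` is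
generated by submodules `D n`, on which the differential is injective modulo `E`. -/
theorem ChainMap.homologyMap_bijective {K : BimoduleComplex.{u} R A B}
    {L : BimoduleComplex.{v} R A' B'} (φ : ChainMap K L)
    (E D : ∀ n, Submodule R (K.obj n).carrier)
    (hgen : ∀ n, ⊤ ≤ E n ⊔ D n ⊔ LinearMap.range (K.d n))
    (hD : ∀ n, ∀ x ∈ D (n + 1), K.d n x ∈ E n → x = 0) (hD₀ : ∀ x ∈ D 0, x = 0)
    (hE : ∀ n, ∀ x ∈ E (n + 1), K.d n x ∈ E n)
    (hinj : ∀ n, ∀ x ∈ E n, φ.f n x = 0 → x = 0)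
    (hsurj : ∀ n y, ∃ x ∈ E n, φ.f n x = y) (n : ℕ) :
    Function.Bijective (φ.homologyMap n) := by
  -- Every cycle is homologous to an element of `E`.
  have key : ∀ z ∈ K.cycles n, ∃ x ∈ E n, ∃ k, z = x + K.d n k := by
    intro z hz
    obtain ⟨y, hy, _, ⟨k, rfl⟩, rfl⟩ := Submodule.mem_sup.1 (hgen n (Submodule.mem_top (x := z)))
    obtain ⟨x, hx, d, hd, rfl⟩ := Submodule.mem_sup.1 hy
    refine ⟨x, hx, k, ?_⟩
    suffices d = 0 by rw [this, add_zero]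
    cases n with
    | zero => exact hD₀ d hd
    | succ n =>
      refine hD n d hd ?_
      have hz : K.d n (x + d + K.d (n + 1) k) = 0 := hz
      rw [map_add, map_add, K.d_d, add_zero, add_comm] at hz
      rw [eq_neg_of_add_eq_zero_left hz]
      exact (E n).neg_mem (hE n x hx)
  constructor
  · rw [← LinearMap.ker_eq_bot, LinearMap.ker_eq_bot']
    intro q hq
    obtain ⟨⟨z, hz⟩, rfl⟩ := Submodule.Quotient.mk_surjective _ q
    have hq := (Submodule.Quotient.mk_eq_zero _).1 hq
    obtain ⟨u, hu⟩ : ∃ u, L.d n u = φ.f n z := hq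
    refine (Submodule.Quotient.mk_eq_zero _).2 ?_
    obtain ⟨x, hx, k, rfl⟩ := key z hz
    rw [map_add, φ.comm] at hu
    obtain ⟨y, hy, hyu⟩ := hsurj (n + 1) (u - φ.f (n + 1) k)
    have h0 : x - K.d n y = 0 := by
      refine hinj n _ ((E n).sub_mem hx (hE n y hy)) ?_
      rw [map_sub, φ.comm, hyu, map_sub, hu, add_sub_cancel_right, sub_self]
    refine ⟨y + k, ?_⟩
    rw [map_add, ← sub_eq_zero.1 h0]
    rfl
  · intro q
    obtain ⟨⟨u, hu⟩, rfl⟩ := Submodule.Quotient.mk_surjective _ q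
    obtain ⟨x, hx, rfl⟩ := hsurj n u
    refine ⟨Submodule.Quotient.mk ⟨x, ?_⟩, rfl⟩
    cases n with
    | zero => trivial
    | succ n =>
      refine hinj n _ (hE n x hx) ?_
      rw [φ.comm]
      exact hu

end BimoduleComplex

namespace PrecubicalSet

/-! ### Coefficients of boundaries -/

section BoundaryCoefficients

variable (R : Type v) [CommRing R] {X : PrecubicalSet.{u}}

theorem toKey_apply {n : ℕ} (z : X.Chains R n) (e : X.CubeChain n) :
    toKey R n z (e.src, e.cubes, e.tgt) = z e := by
  refine Finsupp.mapDomain_apply (f := fun c : X.CubeChain n => (c.src, c.cubes, c.tgt))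
    (fun c c' h => ?_) z e
  simp only [Prod.mk.injEq] at h
  exact CubeChain.ext h.1 h.2.2 h.2.1

theorem key_apply (v w : X.Vertex) (z : List X.cube →₀ R) (l : List X.cube) :
    key R v w z (v, l, w) = z l :=
  Finsupp.mapDomain_apply (f := fun l => (v, l, w)) (fun l l' h => by simpa using h) z l

theorem key_apply_of_ne {v w v' w' : X.Vertex} (h : ¬ (v = v' ∧ w = w')) (z : List X.cube →₀ R)
    (l : List X.cube) : key R v w z (v', l, w') = 0 := by
  refine Finsupp.mapDomain_of_notMem_range _ _ ?_
  rintro ⟨l', hl'⟩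
  simp only [Prod.mk.injEq] at hl'
  exact h ⟨hl'.1, hl'.2.2⟩

theorem boundary_single_apply {n : ℕ} (c : X.CubeChain (n + 1)) {e : X.CubeChain n}
    (hs : c.src = e.src) (ht : c.tgt = e.tgt) :
    X.boundary R n (Finsupp.single c 1) e = rawList R c.cubes e.cubes := by
  rw [← toKey_apply, toKey_boundary_single, hs, ht, key_apply]

theorem boundary_single_apply_of_ne {n : ℕ} (c : X.CubeChain (n + 1)) {e : X.CubeChain n}
    (h : ¬ (c.src = e.src ∧ c.tgt = e.tgt)) :
    X.boundary R n (Finsupp.single c 1) e = 0 := by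
  rw [← toKey_apply, toKey_boundary_single, key_apply_of_ne R h]

theorem mem_of_forall_single_mem {α : Type*} (S : Submodule R (α →₀ R)) {z : α →₀ R}
    (h : ∀ a, z a ≠ 0 → Finsupp.single a 1 ∈ S) : z ∈ S := by
  rw [← z.sum_single]
  refine Submodule.sum_mem _ fun a ha => ?_
  rw [← mul_one (z a), ← smul_eq_mul, ← Finsupp.smul_single]
  exact S.smul_mem _ (h a (Finsupp.mem_support_iff.1 ha))

end BoundaryCoefficients

/-! ### The matching on cube chains -/

section Morse

variable (R : Type v) [CommRing R] {X Y : PrecubicalSet.{u}}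

variable (X Y) in
/-- The span of the essential chains. -/
noncomputable def essential (n : ℕ) : Submodule R ((X.tensor Y).Chains R n) :=
  Finsupp.supported R R {c | IsEssential c.cubes}

variable (X Y) in
/-- The span of the collapsible chains. -/
noncomputable def collapsible (n : ℕ) : Submodule R ((X.tensor Y).Chains R n) :=
  Finsupp.supported R R {c | IsCollapsible c.cubes}

theorem boundary_essential {n : ℕ} {z : (X.tensor Y).Chains R (n + 1)}
    (hz : z ∈ essential R X Y (n + 1)) : (X.tensor Y).boundary R n z ∈ essential R X Y n := by
  have h : (essential R X Y (n + 1)) ≤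
      (essential R X Y n).comap ((X.tensor Y).boundary R n) := by
    rw [essential, Finsupp.supported_eq_span_single, Submodule.span_le]
    rintro _ ⟨c, hc, rfl⟩
    change _ ∈ Finsupp.supported R R _
    rw [Finsupp.mem_supported]
    intro e he
    have he := Finsupp.mem_support_iff.1 he
    by_cases h : c.src = e.src ∧ c.tgt = e.tgt
    · rw [boundary_single_apply R c h.1 h.2] at he
      exact rawList_essential_mem R c.cubes hc (Finsupp.mem_support_iff.2 he)
    · exact absurd (boundary_single_apply_of_ne R c h) he
  exact h hz

/-- The redundant face of a collapsible chain. -/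
def CubeChain.redundantFace {n : ℕ} (c : (X.tensor Y).CubeChain (n + 1))
    (hc : IsCollapsible c.cubes) : (X.tensor Y).CubeChain n where
  src := c.src
  tgt := c.tgt
  cubes := PrecubicalSet.redundantFace c.cubes
  isChain := (hc.redundantFace_spec c.isChain).1
  degree_eq := by
    have h1 := (hc.redundantFace_spec c.isChain).2
    have h2 := c.degree_eq
    omega

theorem boundary_collapsible {n : ℕ} (c : (X.tensor Y).CubeChain (n + 1))
    (hc : IsCollapsible c.cubes) : ∃ s : R, (s = 1 ∨ s = -1) ∧
      (X.tensor Y).boundary R n (Finsupp.single c 1) (c.redundantFace hc) = s ∧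
      ∀ e, e ≠ c.redundantFace hc → (X.tensor Y).boundary R n (Finsupp.single c 1) e ≠ 0 →
        IsCollapsible e.cubes ∨ weight e.cubes < weight (c.redundantFace hc).cubes := by
  obtain ⟨s, hs, h⟩ := rawList_collapsible R c.cubes hc
  have key : ∀ l, (rawList R c.cubes - Finsupp.single (redundantFace c.cubes) s) l ≠ 0 →
      IsCollapsible l ∨ weight l < weight (redundantFace c.cubes) := fun l hl =>
    h (Finsupp.mem_support_iff.2 hl)
  refine ⟨s, hs, ?_, fun e hne he => ?_⟩
  · rw [boundary_single_apply R c rfl rfl]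
    by_contra hne
    have := key (redundantFace c.cubes) (by
      rw [Finsupp.sub_apply, Finsupp.single_eq_same]
      exact sub_ne_zero.2 hne)
    exact this.elim hc.redundantFace_not.1 (lt_irrefl _)
  · by_cases h' : c.src = e.src ∧ c.tgt = e.tgt
    · rw [boundary_single_apply R c h'.1 h'.2] at he
      refine key _ ?_
      rw [Finsupp.sub_apply, Finsupp.single_eq_of_ne, sub_zero]
      · exact he
      · exact fun h'' => hne (CubeChain.ext h'.1.symm h'.2.symm h'')
    · exact absurd (boundary_single_apply_of_ne R c h') he

/-- Modulo boundaries, the chains are generated by the essential and the collapsible ones, since a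
redundant chain is homologous to a combination of collapsible chains and chains of smaller weight. -/
theorem top_le_essential_sup_collapsible_sup_range (n : ℕ) :
    ⊤ ≤ essential R X Y n ⊔ collapsible R X Y n ⊔
      LinearMap.range ((X.tensor Y).boundary R n) := by
  set S := essential R X Y n ⊔ collapsible R X Y n ⊔ LinearMap.range ((X.tensor Y).boundary R n)
  have hE : essential R X Y n ≤ S := le_sup_left.trans le_sup_left
  have hC : collapsible R X Y n ≤ S := le_sup_right.trans le_sup_left
  have hR : LinearMap.range ((X.tensor Y).boundary R n) ≤ S := le_sup_right
  suffices h : ∀ (a : ℕ ×ₗ ℕ) (c : (X.tensor Y).CubeChain n), weight c.cubes = a →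
      Finsupp.single c (1 : R) ∈ S from
    fun z _ => mem_of_forall_single_mem R S fun c _ => h _ c rfl
  intro a
  induction a using WellFoundedLT.induction with
  | ind a ih =>
    rintro c rfl
    rcases isEssential_or_isCollapsible_or c.isChain with hc | hc | ⟨l, h1, h2, h3⟩
    · exact hE (Finsupp.single_mem_supported R _ hc)
    · exact hC (Finsupp.single_mem_supported R _ hc)
    · have hdeg := (h2.redundantFace_spec h1).2
      rw [h3, c.degree_eq] at hdeg
      let b : (X.tensor Y).CubeChain (n + 1) := ⟨c.src, c.tgt, l, h1, hdeg.symm⟩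
      have hbc : b.redundantFace h2 = c := CubeChain.ext rfl rfl h3
      obtain ⟨s, hs, h4, h5⟩ := boundary_collapsible R b h2
      rw [hbc] at h4 h5
      have h6 : (X.tensor Y).boundary R n (Finsupp.single b 1) - Finsupp.single c s ∈ S := by
        refine mem_of_forall_single_mem R S fun e he => ?_
        rw [Finsupp.sub_apply] at he
        by_cases hec : e = c
        · rw [hec, h4, Finsupp.single_eq_same, sub_self] at he
          exact absurd rfl he
        · rw [Finsupp.single_eq_of_ne hec, sub_zero] at he
          rcases h5 e hec he with h | h
          · exact hC (Finsupp.single_mem_supported R _ h)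
          · exact ih _ h e rfl
      have h7 := S.smul_mem s (S.sub_mem (hR ⟨Finsupp.single b 1, rfl⟩) h6)
      rw [sub_sub_cancel, Finsupp.smul_single] at h7
      convert h7 using 2
      rcases hs with rfl | rfl <;> simp

/-- The boundary is injective on collapsible chains modulo essential ones: the redundant face of a
collapsible chain of maximal weight cannot cancel. -/
theorem eq_zero_of_boundary_mem_essential {n : ℕ} {z : (X.tensor Y).Chains R (n + 1)}
    (hz : z ∈ collapsible R X Y (n + 1))
    (h : (X.tensor Y).boundary R n z ∈ essential R X Y n) : z = 0 := by
  by_contra hne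
  have hz' : ∀ c ∈ z.support, IsCollapsible c.cubes := fun c hc => hz hc
  obtain ⟨c, hc, hmax⟩ := Finset.exists_max_image z.support
    (fun c => weight (redundantFace c.cubes)) (Finsupp.support_nonempty_iff.2 hne)
  have hcc := hz' c hc
  obtain ⟨s, hs, hs', -⟩ := boundary_collapsible R c hcc
  have hsum : (X.tensor Y).boundary R n z (c.redundantFace hcc) = z c * s := by
    have e : z = ∑ b ∈ z.support, z b • Finsupp.single b 1 := by
      conv_lhs => rw [← z.sum_single]
      exact Finset.sum_congr rfl fun b _ => by simp
    conv_lhs => rw [e]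
    rw [map_sum, Finsupp.finsetSum_apply, Finset.sum_eq_single_of_mem c hc]
    · rw [map_smul, Finsupp.smul_apply, hs', smul_eq_mul]
    · intro b hb hbc
      rw [map_smul, Finsupp.smul_apply]
      obtain ⟨-, -, -, h3⟩ := boundary_collapsible R b (hz' b hb)
      by_contra hb0
      have hb0 := right_ne_zero_of_smul hb0
      have hbne : c.redundantFace hcc ≠ b.redundantFace (hz' b hb) := fun h => hbc
        (CubeChain.ext (congrArg CubeChain.src h).symm (congrArg CubeChain.tgt h).symm
          (IsCollapsible.redundantFace_inj (hz' b hb) hcc (congrArg CubeChain.cubes h).symm))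
      rcases h3 _ hbne hb0 with h | h
      · exact hcc.redundantFace_not.1 h
      · exact absurd h (not_lt.2 (hmax b hb))
  have h' : ∀ e, (X.tensor Y).boundary R n z e ≠ 0 → IsEssential e.cubes := fun e he =>
    h (Finsupp.mem_support_iff.2 he)
  refine hcc.redundantFace_not.2 (h' (c.redundantFace hcc) ?_)
  rw [hsum]
  have := Finsupp.mem_support_iff.1 hc
  rcases hs with rfl | rfl <;> simpa using this

theorem eq_zero_of_mem_collapsible_zero {z : (X.tensor Y).Chains R 0}
    (hz : z ∈ collapsible R X Y 0) : z = 0 := by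
  rw [← Finsupp.support_eq_empty, Finset.eq_empty_iff_forall_notMem]
  intro c hc
  have h := ((hz hc : IsCollapsible c.cubes).redundantFace_spec c.isChain).2
  rw [c.degree_eq] at h
  exact absurd h (Nat.succ_ne_zero _)

end Morse

/-! ### The complex `C(X) ⊗ C(Y)` in terms of lists -/

section TensorChains

open BimoduleComplex

variable (R : Type v) [CommRing R] (X Y : PrecubicalSet.{u}) [Finite X.cube] [Finite Y.cube]

/-- The chains of degree `n` of `C(X) ⊗ C(Y)`. -/
abbrev TensorChains (n : ℕ) : Type (max u v) :=
  (tensorObj (X.cubeComplex R) (Y.cubeComplex R) n).carrier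

variable {X Y}

/-- The basis element `a ⊗ b` of `C(X) ⊗ C(Y)`. -/
noncomputable def tensorBasis {n p q : ℕ} (h : p + q = n) (a : X.CubeChain p)
    (b : Y.CubeChain q) : TensorChains R X Y n :=
  tensorIn (X.cubeComplex R) (Y.cubeComplex R) n p q h
    ((Finsupp.single a 1 : X.Chains R p) ⊗ₜ[R] (Finsupp.single b 1 : Y.Chains R q))

variable {R}

theorem tensorChains_hom_ext {n : ℕ} {M : Type*} [AddCommGroup M] [Module R M]
    {f g : TensorChains R X Y n →ₗ[R] M}
    (h : ∀ p q (hpq : p + q = n) a b, f (tensorBasis R hpq a b) = g (tensorBasis R hpq a b)) :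
    f = g := by
  refine DirectSum.linearMap_ext R fun ⟨⟨p, q⟩, hpq⟩ => TensorProduct.ext ?_
  exact Finsupp.lhom_ext' (R := R) (M := R) fun a => LinearMap.ext_ring
    (Finsupp.lhom_ext' (R := R) (M := R) fun b => LinearMap.ext_ring (h p q hpq a b))

theorem tensorChains_mem {n : ℕ} (S : Submodule R (TensorChains R X Y n))
    (h : ∀ p q (hpq : p + q = n) a b, tensorBasis R hpq a b ∈ S) (z : TensorChains R X Y n) :
    z ∈ S := by
  have : S.mkQ = 0 := tensorChains_hom_ext fun p q hpq a b =>
    (Submodule.Quotient.mk_eq_zero S).2 (h p q hpq a b)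
  exact (Submodule.Quotient.mk_eq_zero S).1 (congrArg (· z) this)

variable (R)

variable (X Y) in
/-- The map from `C(X) ⊗ C(Y)` to formal linear combinations of pairs of lists with endpoints. -/
noncomputable def toKeyPair (n : ℕ) : TensorChains R X Y n →ₗ[R] (Key X × Key Y →₀ R) :=
  DirectSum.toModule R (Bideg n) _ fun pq =>
    ((finsuppTensorFinsupp' R (Key X) (Key Y)).toLinearMap ∘ₗ
      TensorProduct.map (toKey R (X := X) pq.1.1) (toKey R (X := Y) pq.1.2) :
        X.Chains R pq.1.1 ⊗[R] Y.Chains R pq.1.2 →ₗ[R] (Key X × Key Y →₀ R))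

theorem toKeyPair_tensorIn {n p q : ℕ} (h : p + q = n) (x : X.Chains R p) (y : Y.Chains R q) :
    toKeyPair R X Y n (tensorIn (X.cubeComplex R) (Y.cubeComplex R) n p q h (x ⊗ₜ[R] y)) =
      finsuppTensorFinsupp' R (Key X) (Key Y) (toKey R p x ⊗ₜ toKey R q y) :=
  (DirectSum.toModule_lof R _ _).trans rfl

theorem toKeyPair_tensorBasis {n p q : ℕ} (h : p + q = n) (a : X.CubeChain p)
    (b : Y.CubeChain q) : toKeyPair R X Y n (tensorBasis R h a b) =
      keyPair R a.src a.tgt b.src b.tgt (Finsupp.single (a.cubes, b.cubes) 1) := by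
  rw [tensorBasis, toKeyPair_tensorIn, toKey_single, toKey_single, finsuppTensor_key_left,
    pairLeft_single]

theorem toKeyPair_injective (n : ℕ) : Function.Injective (toKeyPair R X Y n) := by
  -- A left inverse extends the map that sends the pair of keys of `a` and `b` to `a ⊗ b`.
  let I := Σ pq : Bideg n, X.CubeChain pq.1.1 × Y.CubeChain pq.1.2
  let keyOf : I → Key X × Key Y := fun s =>
    ((s.2.1.src, s.2.1.cubes, s.2.1.tgt), (s.2.2.src, s.2.2.cubes, s.2.2.tgt))
  have hkey : Function.Injective keyOf := by
    rintro ⟨⟨⟨p, q⟩, h⟩, a, b⟩ ⟨⟨⟨p', q'⟩, h'⟩, a', b'⟩ e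
    simp only [keyOf, Prod.mk.injEq] at e
    obtain ⟨⟨e1, e2, e3⟩, e4, e5, e6⟩ := e
    have hp : p = p' := a.degree_eq.symm.trans ((congrArg X.degree e2).trans a'.degree_eq)
    have hq : q = q' := b.degree_eq.symm.trans ((congrArg Y.degree e5).trans b'.degree_eq)
    subst hp hq
    have ha : a = a' := CubeChain.ext e1 e3 e2
    have hb : b = b' := CubeChain.ext e4 e6 e5
    rw [ha, hb]
  let G : (Key X × Key Y →₀ R) →ₗ[R] TensorChains R X Y n := Finsupp.linearCombination R
    (Function.extend keyOf (fun s => tensorBasis R s.1.2 s.2.1 s.2.2) 0)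
  have hG : G ∘ₗ toKeyPair R X Y n = LinearMap.id := by
    refine tensorChains_hom_ext fun p q h a b => ?_
    rw [LinearMap.comp_apply, toKeyPair_tensorBasis, keyPair_single,
      Finsupp.linearCombination_single, one_smul]
    exact hkey.extend_apply _ _ (⟨⟨(p, q), h⟩, a, b⟩ : I)
  exact Function.LeftInverse.injective (g := G) fun z => congrArg (· z) hG

/-- The differential of `C(X) ⊗ C(Y)` in terms of lists. -/
theorem toKeyPair_tensorD {n p q : ℕ} (h : p + q = n + 1) (a : X.CubeChain p)
    (b : Y.CubeChain q) :
    toKeyPair R X Y n (tensorD (X.cubeComplex R) (Y.cubeComplex R) n (tensorBasis R h a b)) =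
      keyPair R a.src a.tgt b.src b.tgt (pairD R (Finsupp.single (a.cubes, b.cubes) 1)) := by
  rw [tensorBasis, tensorD_in, pairD_single, map_add, map_add, map_smul, map_smul, a.degree_eq]
  congr 1
  · cases p with
    | zero => rw [rawList_of_degree_eq_zero R a.degree_eq]; simp [tensorD₁]
    | succ p =>
      have e : toKeyPair R X Y n (tensorIn (X.cubeComplex R) (Y.cubeComplex R) n p q (by omega)
          ((X.boundary R p (Finsupp.single a 1)) ⊗ₜ[R] (Finsupp.single b 1 : Y.Chains R q))) = _ :=
        toKeyPair_tensorIn R _ _ _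
      rw [toKey_boundary_single, toKey_single, finsuppTensor_key_left] at e
      exact e
  · congr 1
    cases q with
    | zero => rw [rawList_of_degree_eq_zero R b.degree_eq]; simp [tensorD₂]
    | succ q =>
      have e : toKeyPair R X Y n (tensorIn (X.cubeComplex R) (Y.cubeComplex R) n p q (by omega)
          ((Finsupp.single a 1 : X.Chains R p) ⊗ₜ[R] (Y.boundary R q (Finsupp.single b 1)))) = _ :=
        toKeyPair_tensorIn R _ _ _
      rw [toKey_boundary_single, toKey_single, finsuppTensor_key_right] at e
      exact e

end TensorChains

/-! ### Projections of lists without mixed cubes -/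

section Projections

variable {X Y : PrecubicalSet.{u}}

/-- A list without mixed cubes (nor vertices). -/
def IsPure (l : List (X.tensor Y).cube) : Prop := ∀ c ∈ l, IsHorizontal c ∨ IsVertical c

theorem isPure_cons {c : (X.tensor Y).cube} {l : List (X.tensor Y).cube} :
    IsPure (c :: l) ↔ (IsHorizontal c ∨ IsVertical c) ∧ IsPure l := List.forall_mem_cons

theorem isPure_append {l l' : List (X.tensor Y).cube} :
    IsPure (l ++ l') ↔ IsPure l ∧ IsPure l' := List.forall_mem_append

theorem IsHorizontal.listFst_cons {c : (X.tensor Y).cube} (h : IsHorizontal c)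
    (l : List (X.tensor Y).cube) : listFst (c :: l) = c.1 :: listFst l :=
  List.filterMap_cons_some (if_neg (by have := h.1; omega))

theorem IsHorizontal.listSnd_cons {c : (X.tensor Y).cube} (h : IsHorizontal c)
    (l : List (X.tensor Y).cube) : listSnd (c :: l) = listSnd l :=
  List.filterMap_cons_none (if_pos h.2)

theorem IsVertical.listFst_cons {c : (X.tensor Y).cube} (h : IsVertical c)
    (l : List (X.tensor Y).cube) : listFst (c :: l) = listFst l :=
  List.filterMap_cons_none (if_pos h.1)

theorem IsVertical.listSnd_cons {c : (X.tensor Y).cube} (h : IsVertical c)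
    (l : List (X.tensor Y).cube) : listSnd (c :: l) = c.2 :: listSnd l :=
  List.filterMap_cons_some (if_neg (by have := h.2; omega))

/-- The exponent of the Koszul sign for sorting a list without mixed cubes into horizontal cubes
followed by vertical ones. -/
def koszulExp : List (X.tensor Y).cube → ℕ
  | [] => 0
  | c :: l => (if IsVertical c then (Y.dim c.2 - 1) * X.degree (listFst l) else 0) + koszulExp l

theorem IsPure.degree_add {l : List (X.tensor Y).cube} (h : IsPure l) :
    X.degree (listFst l) + Y.degree (listSnd l) = (X.tensor Y).degree l := by
  induction l with
  | nil => rfl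
  | cons c l ih =>
    obtain ⟨hc, h⟩ := isPure_cons.1 h
    have ih := ih h
    have e : (X.tensor Y).dim c = X.dim c.1 + Y.dim c.2 := rfl
    rcases hc with hc | hc
    · rw [hc.listFst_cons, hc.listSnd_cons, degree_cons, degree_cons, e, hc.2]
      omega
    · rw [hc.listFst_cons, hc.listSnd_cons, degree_cons, degree_cons, e, hc.1]
      omega

theorem IsEssential.isPure {l : List (X.tensor Y).cube} (h : IsEssential l) : IsPure l := by
  induction l with
  | nil => exact fun c hc => absurd hc (by simp)
  | cons c l ih =>
    rcases h with h | ⟨hc, h⟩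
    · exact fun d hd => Or.inr (h d hd)
    · exact isPure_cons.2 ⟨Or.inl hc, ih h⟩

theorem listFst_of_forall_isVertical {l : List (X.tensor Y).cube} (h : ∀ d ∈ l, IsVertical d) :
    listFst l = [] :=
  List.filterMap_eq_nil_iff.2 fun d hd => if_pos (h d hd).1

theorem IsEssential.koszulExp_eq {l : List (X.tensor Y).cube} (h : IsEssential l) :
    koszulExp l = 0 := by
  have key : ∀ l : List (X.tensor Y).cube, (∀ d ∈ l, IsVertical d) → koszulExp l = 0 := by
    intro l
    induction l with
    | nil => exact fun _ => rfl
    | cons c l ih =>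
      intro h
      have h' : ∀ d ∈ l, IsVertical d := fun d hd => h d (by simp [hd])
      rw [koszulExp, ih h', listFst_of_forall_isVertical h']
      simp [degree]
  induction l with
  | nil => rfl
  | cons c l ih =>
    rcases h with h | ⟨hc, h⟩
    · exact key _ h
    · rw [koszulExp, if_neg fun h' => h'.not_isHorizontal hc, ih h]

theorem listFst_append (l l' : List (X.tensor Y).cube) :
    listFst (l ++ l') = listFst l ++ listFst l' := List.filterMap_append

theorem listSnd_append (l l' : List (X.tensor Y).cube) :
    listSnd (l ++ l') = listSnd l ++ listSnd l' := List.filterMap_append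

/-! Edge paths have degree `0`, so that they do not contribute to signs. -/

theorem isPure_of_dim_eq_one {l : List (X.tensor Y).cube} (h : ∀ c ∈ l, (X.tensor Y).dim c = 1) :
    IsPure l := fun c hc => by
  have := h c hc
  have h1 : X.dim c.1 + Y.dim c.2 = 1 := this
  unfold IsHorizontal IsVertical
  omega

theorem koszulExp_append_left {p : List (X.tensor Y).cube}
    (hp : ∀ c ∈ p, (X.tensor Y).dim c = 1) (l : List (X.tensor Y).cube) :
    koszulExp (p ++ l) = koszulExp l := by
  induction p with
  | nil => rfl
  | cons c p ih =>
    have h1 : X.dim c.1 + Y.dim c.2 = 1 := hp c (by simp)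
    rw [List.cons_append, koszulExp, ih fun d hd => hp d (by simp [hd])]
    have h2 : Y.dim c.2 - 1 = 0 := by omega
    rw [h2, zero_mul, ite_self, zero_add]

theorem koszulExp_append_right (l : List (X.tensor Y).cube) {p : List (X.tensor Y).cube}
    (hp : ∀ c ∈ p, (X.tensor Y).dim c = 1) : koszulExp (l ++ p) = koszulExp l := by
  induction l with
  | nil =>
    have := koszulExp_append_left hp []
    rwa [List.append_nil] at this
  | cons c l ih =>
    have h0 : X.degree (listFst p) = 0 :=
      degree_eq_zero fun x hx => (dim_mem_listFst hp x hx).le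
    rw [List.cons_append, koszulExp, koszulExp, ih, listFst_append, degree_append, h0, add_zero]

theorem IsHorizontal.map {X' Y' : PrecubicalSet.{u}} (f : Hom X X') (g : Hom Y Y')
    (c : (X.tensor Y).cube) : IsHorizontal ((f.tensor g).toFun c) ↔ IsHorizontal c := by
  change (1 ≤ X'.dim (f.toFun c.1) ∧ Y'.dim (g.toFun c.2) = 0) ↔ _
  rw [f.dim_map, g.dim_map]
  rfl

theorem IsVertical.map {X' Y' : PrecubicalSet.{u}} (f : Hom X X') (g : Hom Y Y')
    (c : (X.tensor Y).cube) : IsVertical ((f.tensor g).toFun c) ↔ IsVertical c := by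
  change (X'.dim (f.toFun c.1) = 0 ∧ 1 ≤ Y'.dim (g.toFun c.2)) ↔ _
  rw [f.dim_map, g.dim_map]
  rfl

theorem isPure_map {X' Y' : PrecubicalSet.{u}} (f : Hom X X') (g : Hom Y Y')
    (l : List (X.tensor Y).cube) : IsPure (l.map (f.tensor g).toFun) ↔ IsPure l := by
  simp only [IsPure, List.forall_mem_map, IsHorizontal.map, IsVertical.map]

theorem degree_map {X' : PrecubicalSet.{u}} (f : Hom X X') (l : List X.cube) :
    X'.degree (l.map f.toFun) = X.degree l := by
  simp only [degree, List.map_map]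
  congr 2
  funext c
  simp [f.dim_map]

theorem listFst_map {X' Y' : PrecubicalSet.{u}} (f : Hom X X') (g : Hom Y Y')
    (l : List (X.tensor Y).cube) :
    listFst (l.map (f.tensor g).toFun) = (listFst l).map f.toFun := by
  refine (List.filterMap_map ..).trans (Eq.trans ?_ (List.map_filterMap ..).symm)
  refine congrArg (fun k => List.filterMap k l) (funext fun c => ?_)
  change (if X'.dim (f.toFun c.1) = 0 then none else some (f.toFun c.1)) =
    (if X.dim c.1 = 0 then none else some c.1).map f.toFun
  rw [f.dim_map]
  split_ifs <;> rfl

theorem listSnd_map {X' Y' : PrecubicalSet.{u}} (f : Hom X X') (g : Hom Y Y')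
    (l : List (X.tensor Y).cube) :
    listSnd (l.map (f.tensor g).toFun) = (listSnd l).map g.toFun := by
  refine (List.filterMap_map ..).trans (Eq.trans ?_ (List.map_filterMap ..).symm)
  refine congrArg (fun k => List.filterMap k l) (funext fun c => ?_)
  change (if Y'.dim (g.toFun c.2) = 0 then none else some (g.toFun c.2)) =
    (if Y.dim c.2 = 0 then none else some c.2).map g.toFun
  rw [g.dim_map]
  split_ifs <;> rfl

theorem koszulExp_map {X' Y' : PrecubicalSet.{u}} (f : Hom X X') (g : Hom Y Y')
    (l : List (X.tensor Y).cube) : koszulExp (l.map (f.tensor g).toFun) = koszulExp l := by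
  induction l with
  | nil => rfl
  | cons c l ih =>
    rw [List.map_cons, koszulExp, koszulExp, ih, listFst_map, degree_map]
    simp only [IsVertical.map]
    have : Y'.dim ((f.tensor g).toFun c).2 = Y.dim c.2 := g.dim_map c.2
    rw [this]

variable (R : Type v) [CommRing R]

theorem IsPure.milgramList {l : List (X.tensor Y).cube} (h : IsPure l) :
    milgramList R l = (-1 : R) ^ koszulExp l • Finsupp.single (listFst l, listSnd l) 1 := by
  induction l with
  | nil =>
    rw [koszulExp, pow_zero, one_smul]
    rfl
  | cons c l ih =>
    obtain ⟨hc, h⟩ := isPure_cons.1 h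
    rw [PrecubicalSet.milgramList, ih h, koszulExp, map_smul]
    rcases hc with hc | hc
    · rw [hc.letterAct, if_neg fun h' => h'.not_isHorizontal hc, preFst_single, hc.listFst_cons,
        hc.listSnd_cons, zero_add]
    · rw [hc.letterAct, if_pos hc, preSnd_single, hc.listFst_cons, hc.listSnd_cons, smul_smul,
        ← pow_add, add_comm]

theorem milgramList_of_not_isPure {l : List (X.tensor Y).cube} (h : ¬ IsPure l) :
    milgramList R l = 0 := by
  induction l with
  | nil => exact absurd (fun c hc => absurd hc (by simp)) h
  | cons c l ih =>
    rw [milgramList]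
    by_cases hl : IsPure l
    · have hc : ¬ (IsHorizontal c ∨ IsVertical c) := fun hc => h (isPure_cons.2 ⟨hc, hl⟩)
      rw [not_or] at hc
      rw [letterAct, if_neg hc.1, if_neg hc.2, LinearMap.zero_apply]
    · rw [ih hl, map_zero]

end Projections

/-! ### Milgram's map on cube chains -/

section MilgramChain

open BimoduleComplex

variable (R : Type v) [CommRing R] {X Y : PrecubicalSet.{u}}

/-- The projection to `X` of a cube chain in `X ⊗ Y`. -/
def CubeChain.projFst {n : ℕ} (c : (X.tensor Y).CubeChain n) :
    X.CubeChain (X.degree (listFst c.cubes)) :=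
  ⟨c.src.fst, c.tgt.fst, listFst c.cubes, isChain_fst c.isChain, rfl⟩

/-- The projection to `Y` of a cube chain in `X ⊗ Y`. -/
def CubeChain.projSnd {n : ℕ} (c : (X.tensor Y).CubeChain n) :
    Y.CubeChain (Y.degree (listSnd c.cubes)) :=
  ⟨c.src.snd, c.tgt.snd, listSnd c.cubes, isChain_snd c.isChain, rfl⟩

variable [Finite X.cube] [Finite Y.cube]

open Classical in
/-- The image of a cube chain of `X ⊗ Y` in `C(X) ⊗ C(Y)`: the tensor product of its projections up
to the Koszul sign if there are no mixed cubes, and `0` otherwise. -/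
noncomputable def milgramChain {n : ℕ} (c : (X.tensor Y).CubeChain n) : TensorChains R X Y n :=
  if h : IsPure c.cubes then
    (-1 : R) ^ koszulExp c.cubes •
      tensorBasis R (h.degree_add.trans c.degree_eq) c.projFst c.projSnd
  else 0

theorem milgramChain_of_not_isPure {n : ℕ} {c : (X.tensor Y).CubeChain n}
    (h : ¬ IsPure c.cubes) : milgramChain R c = 0 := dif_neg h

theorem milgramChain_of_isPure {n p q : ℕ} (h : p + q = n) {c : (X.tensor Y).CubeChain n}
    (hc : IsPure c.cubes) {a : X.CubeChain p} {b : Y.CubeChain q}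
    (ha : a.src = c.src.fst ∧ a.tgt = c.tgt.fst ∧ a.cubes = listFst c.cubes)
    (hb : b.src = c.src.snd ∧ b.tgt = c.tgt.snd ∧ b.cubes = listSnd c.cubes) :
    milgramChain R c = (-1 : R) ^ koszulExp c.cubes • tensorBasis R h a b := by
  have hp : p = X.degree (listFst c.cubes) := by rw [← ha.2.2, a.degree_eq]
  have hq : q = Y.degree (listSnd c.cubes) := by rw [← hb.2.2, b.degree_eq]
  subst hp hq
  rw [show a = c.projFst from CubeChain.ext ha.1 ha.2.1 ha.2.2,
    show b = c.projSnd from CubeChain.ext hb.1 hb.2.1 hb.2.2]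
  exact dif_pos hc

variable (X Y) in
/-- The linear map `C_n(X ⊗ Y) → (C(X) ⊗ C(Y))_n` underlying Milgram's map. -/
noncomputable def milgramLin (n : ℕ) : (X.tensor Y).Chains R n →ₗ[R] TensorChains R X Y n :=
  Finsupp.linearCombination R (milgramChain R)

theorem milgramLin_single {n : ℕ} (c : (X.tensor Y).CubeChain n) :
    milgramLin R X Y n (Finsupp.single c 1) = milgramChain R c := by simp [milgramLin]

theorem toKeyPair_milgramChain {n : ℕ} (c : (X.tensor Y).CubeChain n) :
    toKeyPair R X Y n (milgramChain R c) =
      keyPair R c.src.fst c.tgt.fst c.src.snd c.tgt.snd (milgramList R c.cubes) := by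
  by_cases h : IsPure c.cubes
  · rw [milgramChain, dif_pos h, h.milgramList R, map_smul, map_smul, toKeyPair_tensorBasis]
    rfl
  · rw [milgramChain, dif_neg h, milgramList_of_not_isPure R h, map_zero, map_zero]

theorem toKeyPair_milgramLin {n : ℕ} (z : (X.tensor Y).Chains R n) :
    toKeyPair R X Y n (milgramLin R X Y n z) = milgramKey R X Y (toKey R n z) := by
  suffices toKeyPair R X Y n ∘ₗ milgramLin R X Y n = milgramKey R X Y ∘ₗ toKey R n from
    congrArg (· z) this
  refine Finsupp.lhom_ext' fun c => LinearMap.ext_ring ?_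
  simp only [LinearMap.comp_apply, Finsupp.lsingle_apply]
  rw [milgramLin_single, toKeyPair_milgramChain, toKey_single, milgramKey_key, milgramRaw_single]

theorem toKeyPair_tensorD_milgramChain {n : ℕ} (c : (X.tensor Y).CubeChain (n + 1)) :
    toKeyPair R X Y n (tensorD (X.cubeComplex R) (Y.cubeComplex R) n (milgramChain R c)) =
      keyPair R c.src.fst c.tgt.fst c.src.snd c.tgt.snd (pairD R (milgramList R c.cubes)) := by
  by_cases h : IsPure c.cubes
  · rw [milgramChain, dif_pos h, h.milgramList R, map_smul, map_smul, map_smul, map_smul]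
    exact congrArg _ (toKeyPair_tensorD R _ c.projFst c.projSnd)
  · rw [milgramChain, dif_neg h, milgramList_of_not_isPure R h]
    simp only [map_zero]

variable (X Y) in
/-- Milgram's chain map `C(X ⊗ Y) → C(X) ⊗ C(Y)`. -/
noncomputable def milgramMap :
    ((X.tensor Y).cubeComplex R).ChainMap ((X.cubeComplex R).tensor (Y.cubeComplex R)) where
  f n := milgramLin R X Y n
  comm n x := by
    suffices milgramLin R X Y n ∘ₗ (X.tensor Y).boundary R n =
        tensorD (X.cubeComplex R) (Y.cubeComplex R) n ∘ₗ milgramLin R X Y (n + 1) from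
      congrArg (· x) this
    refine Finsupp.lhom_ext' fun c => LinearMap.ext_ring (toKeyPair_injective R n ?_)
    simp only [LinearMap.comp_apply, Finsupp.lsingle_apply]
    rw [toKeyPair_milgramLin, toKey_boundary_single, milgramKey_key,
      milgramRaw_rawList R _ c.isChain.one_le_dim, milgramLin_single,
      toKeyPair_tensorD_milgramChain]

end MilgramChain

/-! ### Essential chains and `C(X) ⊗ C(Y)` -/

section SortedChains

open BimoduleComplex

variable {X Y : PrecubicalSet.{u}}

/-- The vertex `(v, w)` of `X ⊗ Y`. -/
def tensorVertex (v : X.Vertex) (w : Y.Vertex) : (X.tensor Y).Vertex :=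
  ⟨(v.1, w.1), Nat.add_eq_zero_iff.2 ⟨v.2, w.2⟩⟩

theorem eq_of_fst_eq_of_snd_eq {v w : (X.tensor Y).Vertex} (h1 : v.fst = w.fst)
    (h2 : v.snd = w.snd) : v = w :=
  Subtype.ext (Prod.ext (congrArg Subtype.val h1) (congrArg Subtype.val h2))

theorem tensor_endpoint_eq (ε : Bool) (c : (X.tensor Y).cube) :
    (X.tensor Y).endpoint ε c = tensorVertex (X.endpoint ε c.1) (Y.endpoint ε c.2) :=
  Subtype.ext (tensor_endpoint ε c)

/-- The horizontal cube `(x, w)`. -/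
def horizCube (w : Y.Vertex) (x : X.cube) : (X.tensor Y).cube := (x, w.1)

/-- The vertical cube `(v, y)`. -/
def vertCube (v : X.Vertex) (y : Y.cube) : (X.tensor Y).cube := (v.1, y)

/-- The list of cubes of the concatenation of `a × {w}` and `{v} × b`. -/
def sortedList (v : X.Vertex) (w : Y.Vertex) (a : List X.cube) (b : List Y.cube) :
    List (X.tensor Y).cube :=
  a.map (horizCube w) ++ b.map (vertCube v)

theorem endpoint_vertex (ε : Bool) (v : X.Vertex) : X.endpoint ε v.1 = v :=
  endpoint_of_dim_eq_zero ε v.2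

theorem isChain_vertCube {v : X.Vertex} {w w' : Y.Vertex} {b : List Y.cube}
    (h : Y.IsChain w b w') :
    (X.tensor Y).IsChain (tensorVertex v w) (b.map (vertCube v)) (tensorVertex v w') := by
  induction b generalizing w with
  | nil => exact congrArg (tensorVertex v) h
  | cons y b ih =>
    obtain ⟨h1, h2, h3⟩ := h
    refine ⟨Nat.le_add_left_of_le h1, ?_, ?_⟩
    · rw [tensor_endpoint_eq]
      exact congrArg₂ tensorVertex (endpoint_vertex _ v) h2
    · rw [tensor_endpoint_eq, show X.endpoint true (vertCube v y).1 = v from endpoint_vertex _ v]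
      exact ih h3

theorem isChain_sortedList {v v' : X.Vertex} {w w' : Y.Vertex} {a : List X.cube}
    {b : List Y.cube} (ha : X.IsChain v a v') (hb : Y.IsChain w b w') :
    (X.tensor Y).IsChain (tensorVertex v w) (sortedList v' w a b) (tensorVertex v' w') := by
  refine isChain_append.2 ⟨tensorVertex v' w, ?_, isChain_vertCube hb⟩
  induction a generalizing v with
  | nil => exact congrArg (tensorVertex · w) ha
  | cons x a ih =>
    obtain ⟨h1, h2, h3⟩ := ha
    refine ⟨Nat.le_add_right_of_le h1, ?_, ?_⟩
    · rw [tensor_endpoint_eq]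
      exact congrArg₂ tensorVertex h2 (endpoint_vertex _ w)
    · rw [tensor_endpoint_eq, show Y.endpoint true (horizCube w x).2 = w from endpoint_vertex _ w]
      exact ih h3

theorem isHorizontal_horizCube (w : Y.Vertex) {x : X.cube} (h : 1 ≤ X.dim x) :
    IsHorizontal (horizCube w x) := ⟨h, w.2⟩

theorem isVertical_vertCube (v : X.Vertex) {y : Y.cube} (h : 1 ≤ Y.dim y) :
    IsVertical (vertCube v y) := ⟨v.2, h⟩

theorem sortedList_spec (v : X.Vertex) (w : Y.Vertex) {a : List X.cube} {b : List Y.cube}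
    (ha : ∀ x ∈ a, 1 ≤ X.dim x) (hb : ∀ y ∈ b, 1 ≤ Y.dim y) :
    IsEssential (sortedList v w a b) ∧ listFst (sortedList v w a b) = a ∧
      listSnd (sortedList v w a b) = b := by
  induction a with
  | nil =>
    have hv : ∀ d ∈ b.map (vertCube v), IsVertical d := by
      intro d hd
      obtain ⟨y, hy, rfl⟩ := List.mem_map.1 hd
      exact isVertical_vertCube v (hb y hy)
    refine ⟨?_, listFst_of_forall_isVertical hv, ?_⟩
    · cases b with
      | nil => trivial
      | cons y b => exact Or.inl hv
    · change listSnd (b.map (vertCube v)) = b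
      clear hv
      induction b with
      | nil => rfl
      | cons y b ih =>
        rw [List.map_cons, (isVertical_vertCube v (hb y (by simp))).listSnd_cons,
          ih fun y hy => hb y (by simp [hy])]
        rfl
  | cons x a ih =>
    obtain ⟨h1, h2, h3⟩ := ih fun x hx => ha x (by simp [hx])
    have hx := isHorizontal_horizCube w (ha x (by simp))
    refine ⟨Or.inr ⟨hx, h1⟩, ?_, ?_⟩
    · exact (hx.listFst_cons _).trans (congrArg _ h2)
    · exact (hx.listSnd_cons _).trans h3

theorem eq_map_vertCube {v w : (X.tensor Y).Vertex} {l : List (X.tensor Y).cube}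
    (hl : ∀ d ∈ l, IsVertical d) (h : (X.tensor Y).IsChain v l w) :
    v.fst = w.fst ∧ l = (listSnd l).map (vertCube w.fst) := by
  induction l generalizing v with
  | nil => exact ⟨congrArg Vertex.fst h, rfl⟩
  | cons c l ih =>
    obtain ⟨-, h2, h3⟩ := h
    have hc : IsVertical c := hl c (by simp)
    obtain ⟨e1, e2⟩ := ih (fun d hd => hl d (by simp [hd])) h3
    rw [tensor_endpoint_fst, endpoint_of_dim_eq_zero true hc.1] at e1
    refine ⟨?_, ?_⟩
    · rw [← h2, tensor_endpoint_fst, endpoint_of_dim_eq_zero false hc.1, e1]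
    · rw [hc.listSnd_cons, List.map_cons, ← e2]
      exact congrArg (· :: l) (Prod.ext (congrArg Subtype.val e1) rfl)

/-- An essential chain is determined by its endpoints and its projections. -/
theorem IsEssential.eq_sortedList {v w : (X.tensor Y).Vertex} {l : List (X.tensor Y).cube}
    (hl : IsEssential l) (h : (X.tensor Y).IsChain v l w) :
    l = sortedList w.fst v.snd (listFst l) (listSnd l) := by
  induction l generalizing v with
  | nil => rfl
  | cons c l ih =>
    rcases hl with hl | ⟨hc, hl⟩
    · rw [listFst_of_forall_isVertical hl]
      exact (eq_map_vertCube hl h).2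
    · obtain ⟨-, h2, h3⟩ := h
      have e := ih hl h3
      rw [tensor_endpoint_snd, endpoint_of_dim_eq_zero true hc.2] at e
      rw [hc.listFst_cons, hc.listSnd_cons, ← h2, tensor_endpoint_snd,
        endpoint_of_dim_eq_zero false hc.2]
      refine (congrArg (c :: ·) e).trans ?_
      exact congrArg (· :: _) (Prod.ext rfl rfl)

/-- The cube chain `(a × {w}) · ({v} × b)` in `X ⊗ Y`, where `v` is the end of `a` and `w` the start
of `b`. -/
def sortedChain {n p q : ℕ} (h : p + q = n) (a : X.CubeChain p) (b : Y.CubeChain q) :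
    (X.tensor Y).CubeChain n where
  src := tensorVertex a.src b.src
  tgt := tensorVertex a.tgt b.tgt
  cubes := sortedList a.tgt b.src a.cubes b.cubes
  isChain := isChain_sortedList a.isChain b.isChain
  degree_eq := by
    obtain ⟨h1, h2, h3⟩ := sortedList_spec a.tgt b.src a.isChain.one_le_dim b.isChain.one_le_dim
    rw [← h1.isPure.degree_add, h2, h3, a.degree_eq, b.degree_eq, h]

variable (R : Type v) [CommRing R] [Finite X.cube] [Finite Y.cube]

theorem milgramChain_sortedChain {n p q : ℕ} (h : p + q = n) (a : X.CubeChain p)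
    (b : Y.CubeChain q) : milgramChain R (sortedChain h a b) = tensorBasis R h a b := by
  obtain ⟨h1, h2, h3⟩ := sortedList_spec a.tgt b.src a.isChain.one_le_dim b.isChain.one_le_dim
  have h1 : IsEssential (sortedChain h a b).cubes := h1
  rw [milgramChain_of_isPure R h h1.isPure ⟨rfl, rfl, h2.symm⟩ ⟨rfl, rfl, h3.symm⟩,
    h1.koszulExp_eq, pow_zero, one_smul]

theorem exists_essential_milgramLin_eq (n : ℕ) (z : TensorChains R X Y n) :
    ∃ x ∈ essential R X Y n, milgramLin R X Y n x = z := by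
  refine tensorChains_mem ((essential R X Y n).map (milgramLin R X Y n)) (fun p q h a b => ?_) z
  refine ⟨Finsupp.single (sortedChain h a b) 1, Finsupp.single_mem_supported R _ ?_, ?_⟩
  · exact (sortedList_spec a.tgt b.src a.isChain.one_le_dim b.isChain.one_le_dim).1
  · rw [milgramLin_single, milgramChain_sortedChain]

theorem eq_zero_of_milgramLin_eq_zero {n : ℕ} {x : (X.tensor Y).Chains R n}
    (hx : x ∈ essential R X Y n) (h : milgramLin R X Y n x = 0) : x = 0 := by
  -- The map `a ⊗ b ↦ sortedChain a b` recovers an essential chain from its image, already at the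
  -- level of lists with endpoints.
  let G : (Key X × Key Y →₀ R) →ₗ[R] (Key (X.tensor Y) →₀ R) := Finsupp.lmapDomain R R fun t =>
    (tensorVertex t.1.1 t.2.1, sortedList t.1.2.2 t.2.1 t.1.2.1 t.2.2.1,
      tensorVertex t.1.2.2 t.2.2.2)
  have hG := eq_of_mem_supported (f := G ∘ₗ toKeyPair R X Y n ∘ₗ milgramLin R X Y n)
    (g := toKey R n) (fun c hc => ?_) hx
  · rw [LinearMap.comp_apply, LinearMap.comp_apply, h, map_zero, map_zero] at hG
    exact toKey_injective R n (hG.symm.trans (map_zero _).symm)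
  · have hc : IsEssential c.cubes := hc
    simp only [LinearMap.comp_apply]
    rw [milgramLin_single, toKeyPair_milgramChain, hc.isPure.milgramList R, hc.koszulExp_eq,
      pow_zero, one_smul, keyPair_single, toKey_single]
    simp only [G, key, Finsupp.lmapDomain_apply, Finsupp.mapDomain_single]
    rw [← hc.eq_sortedList c.isChain]
    rfl

variable (X Y) in
/-- Milgram's map is a quasi-isomorphism. -/
theorem milgramMap_bijective (n : ℕ) :
    Function.Bijective ((milgramMap R X Y).homologyMap n) :=
  (milgramMap R X Y).homologyMap_bijective (fun n => essential R X Y n)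
    (fun n => collapsible R X Y n) (top_le_essential_sup_collapsible_sup_range R)
    (fun _ _ hx h => eq_zero_of_boundary_mem_essential R hx h)
    (fun _ hx => eq_zero_of_mem_collapsible_zero R hx) (fun _ _ hx => boundary_essential R hx)
    (fun _ _ hx h => eq_zero_of_milgramLin_eq_zero R hx h) (exists_essential_milgramLin_eq R) n

end SortedChains

/-! ### Bimodule structures and naturality -/

section Compatibility

open BimoduleComplex

variable (R : Type v) [CommRing R] {X Y : PrecubicalSet.{u}} [Finite X.cube] [Finite Y.cube]

theorem pathAlgebraMap_of (p : (X.tensor Y).CubeChain 0) :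
    pathAlgebraMap X Y R (PathAlgebra.of R p) =
      PathAlgebra.of R p.fst ⊗ₜ[R] PathAlgebra.of R p.snd := pathLin_of R p

/-- The element `x ⊗ y` of `C(X) ⊗ C(Y)`. -/
noncomputable def tensorPair {n p q : ℕ} (h : p + q = n) (x : X.Chains R p) (y : Y.Chains R q) :
    TensorChains R X Y n :=
  tensorIn (X.cubeComplex R) (Y.cubeComplex R) n p q h (x ⊗ₜ[R] y)

theorem tensorPair_zero_left {n p q : ℕ} (h : p + q = n) (y : Y.Chains R q) :
    tensorPair R h (0 : X.Chains R p) y = 0 :=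
  (congrArg _ (TensorProduct.zero_tmul _ _)).trans (map_zero _)

theorem tensorPair_zero_right {n p q : ℕ} (h : p + q = n) (x : X.Chains R p) :
    tensorPair R h x (0 : Y.Chains R q) = 0 :=
  (congrArg _ (TensorProduct.tmul_zero _ _)).trans (map_zero _)

theorem tensorObj_left_basis {n p q : ℕ} (h : p + q = n) (a : X.CubeChain p) (b : Y.CubeChain q)
    (s : X.CubeChain 0) (t : Y.CubeChain 0) :
    (tensorObj (X.cubeComplex R) (Y.cubeComplex R) n).left
        (PathAlgebra.of R s ⊗ₜ[R] PathAlgebra.of R t) (tensorBasis R h a b) =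
      tensorPair R h (concatOrZero R (zero_add p) s a) (concatOrZero R (zero_add q) t b) := by
  rw [← concatLin_single, ← concatLin_single]
  exact tensorObj_left_in (K := X.cubeComplex R) (L := Y.cubeComplex R) n p q h _ _ _ _

theorem tensorObj_right_basis {n p q : ℕ} (h : p + q = n) (a : X.CubeChain p) (b : Y.CubeChain q)
    (s : X.CubeChain 0) (t : Y.CubeChain 0) :
    (tensorObj (X.cubeComplex R) (Y.cubeComplex R) n).right
        (MulOpposite.op (PathAlgebra.of R s ⊗ₜ[R] PathAlgebra.of R t)) (tensorBasis R h a b) =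
      tensorPair R h (concatOrZero R (add_zero p) a s) (concatOrZero R (add_zero q) b t) := by
  rw [← concatLin_single, ← concatLin_single]
  exact tensorObj_right_in (K := X.cubeComplex R) (L := Y.cubeComplex R) n p q h _ _ _ _

theorem milgramLin_concat_left {n : ℕ} (p : (X.tensor Y).CubeChain 0)
    (c : (X.tensor Y).CubeChain n) :
    milgramLin R X Y n (concatOrZero R (zero_add n) p c) =
      (tensorObj (X.cubeComplex R) (Y.cubeComplex R) n).left
        (PathAlgebra.of R p.fst ⊗ₜ[R] PathAlgebra.of R p.snd) (milgramChain R c) := by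
  have hp := dim_eq_one p.isChain p.degree_eq
  by_cases hc : IsPure c.cubes
  · rw [milgramChain, dif_pos hc, map_smul, tensorObj_left_basis]
    by_cases h : p.tgt = c.src
    · rw [concatOrZero_pos R _ p c h, milgramLin_single,
        concatOrZero_pos R _ p.fst c.projFst (congrArg Vertex.fst h),
        concatOrZero_pos R _ p.snd c.projSnd (congrArg Vertex.snd h)]
      refine (milgramChain_of_isPure R (hc.degree_add.trans c.degree_eq)
        (isPure_append.2 ⟨isPure_of_dim_eq_one hp, hc⟩)
        (c := p.concat (zero_add n) c h) (a := p.fst.concat (zero_add _) c.projFst (congrArg Vertex.fst h))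
        (b := p.snd.concat (zero_add _) c.projSnd (congrArg Vertex.snd h))
        ⟨rfl, rfl, (listFst_append _ _).symm⟩ ⟨rfl, rfl, (listSnd_append _ _).symm⟩).trans ?_
      rw [show (p.concat (zero_add n) c h).cubes = p.cubes ++ c.cubes from rfl,
        koszulExp_append_left hp]
      rfl
    · rw [concatOrZero_neg R _ p c h, map_zero]
      by_cases h1 : p.fst.tgt = c.projFst.src
      · have h2 : ¬ p.snd.tgt = c.projSnd.src := fun h2 => h (eq_of_fst_eq_of_snd_eq h1 h2)
        rw [concatOrZero_neg R _ p.snd c.projSnd h2, tensorPair_zero_right, smul_zero]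
      · rw [concatOrZero_neg R _ p.fst c.projFst h1, tensorPair_zero_left, smul_zero]
  · rw [milgramChain_of_not_isPure R hc, map_zero]
    by_cases h : p.tgt = c.src
    · rw [concatOrZero_pos R _ p c h, milgramLin_single]
      exact milgramChain_of_not_isPure R fun h' => hc (isPure_append.1 h').2
    · rw [concatOrZero_neg R _ p c h, map_zero]

theorem milgramLin_concat_right {n : ℕ} (p : (X.tensor Y).CubeChain 0)
    (c : (X.tensor Y).CubeChain n) :
    milgramLin R X Y n (concatOrZero R (add_zero n) c p) =
      (tensorObj (X.cubeComplex R) (Y.cubeComplex R) n).right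
        (MulOpposite.op (PathAlgebra.of R p.fst ⊗ₜ[R] PathAlgebra.of R p.snd))
          (milgramChain R c) := by
  have hp := dim_eq_one p.isChain p.degree_eq
  by_cases hc : IsPure c.cubes
  · rw [milgramChain, dif_pos hc, map_smul, tensorObj_right_basis]
    by_cases h : c.tgt = p.src
    · rw [concatOrZero_pos R _ c p h, milgramLin_single,
        concatOrZero_pos R _ c.projFst p.fst (congrArg Vertex.fst h),
        concatOrZero_pos R _ c.projSnd p.snd (congrArg Vertex.snd h)]
      refine (milgramChain_of_isPure R (hc.degree_add.trans c.degree_eq)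
        (isPure_append.2 ⟨hc, isPure_of_dim_eq_one hp⟩)
        (c := c.concat (add_zero n) p h) (a := c.projFst.concat (add_zero _) p.fst (congrArg Vertex.fst h))
        (b := c.projSnd.concat (add_zero _) p.snd (congrArg Vertex.snd h))
        ⟨rfl, rfl, (listFst_append _ _).symm⟩ ⟨rfl, rfl, (listSnd_append _ _).symm⟩).trans ?_
      rw [show (c.concat (add_zero n) p h).cubes = c.cubes ++ p.cubes from rfl,
        koszulExp_append_right _ hp]
      rfl
    · rw [concatOrZero_neg R _ c p h, map_zero]
      by_cases h1 : c.projFst.tgt = p.fst.src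
      · have h2 : ¬ c.projSnd.tgt = p.snd.src := fun h2 => h (eq_of_fst_eq_of_snd_eq h1 h2)
        rw [concatOrZero_neg R _ c.projSnd p.snd h2, tensorPair_zero_right, smul_zero]
      · rw [concatOrZero_neg R _ c.projFst p.fst h1, tensorPair_zero_left, smul_zero]
  · rw [milgramChain_of_not_isPure R hc, map_zero]
    by_cases h : c.tgt = p.src
    · rw [concatOrZero_pos R _ c p h, milgramLin_single]
      exact milgramChain_of_not_isPure R fun h' => hc (isPure_append.1 h').1
    · rw [concatOrZero_neg R _ c p h, map_zero]

/-- Milgram's map is a map of left modules along the algebra map `h`. -/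
theorem milgramLin_left {n : ℕ} (a : PathAlgebra R (X.tensor Y)) (z : (X.tensor Y).Chains R n) :
    milgramLin R X Y n (((X.tensor Y).chainBimodule R n).left a z) =
      (tensorObj (X.cubeComplex R) (Y.cubeComplex R) n).left (pathAlgebraMap X Y R a)
        (milgramLin R X Y n z) := by
  suffices (concatLin R (zero_add n)).compr₂ (milgramLin R X Y n) =
      LinearMap.compl₁₂ ((tensorObj (X.cubeComplex R) (Y.cubeComplex R) n).left.toLinearMap :
        _ →ₗ[R] TensorChains R X Y n →ₗ[R] TensorChains R X Y n)
        (pathAlgebraMap X Y R).toLinearMap (milgramLin R X Y n) from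
    congrArg (fun f => f a z) this
  refine PathAlgebra.lhom_ext R fun p => Finsupp.lhom_ext' fun c => LinearMap.ext_ring ?_
  change milgramLin R X Y n (concatLin R (zero_add n) (Finsupp.single p 1) (Finsupp.single c 1)) =
    (tensorObj (X.cubeComplex R) (Y.cubeComplex R) n).left
      (pathAlgebraMap X Y R (PathAlgebra.of R p)) (milgramLin R X Y n (Finsupp.single c 1))
  rw [concatLin_single, pathAlgebraMap_of, milgramLin_single, milgramLin_concat_left]

/-- Milgram's map is a map of right modules along the algebra map `h`. -/
theorem milgramLin_right {n : ℕ} (a : (PathAlgebra R (X.tensor Y))ᵐᵒᵖ)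
    (z : (X.tensor Y).Chains R n) :
    milgramLin R X Y n (((X.tensor Y).chainBimodule R n).right a z) =
      (tensorObj (X.cubeComplex R) (Y.cubeComplex R) n).right
        (AlgHom.op (pathAlgebraMap X Y R) a) (milgramLin R X Y n z) := by
  induction a using MulOpposite.rec' with | _ a
  let ρ : PathAlgebra R X ⊗[R] PathAlgebra R Y →ₗ[R]
      TensorChains R X Y n →ₗ[R] TensorChains R X Y n :=
    (tensorObj (X.cubeComplex R) (Y.cubeComplex R) n).right.toLinearMap ∘ₗ
      (MulOpposite.opLinearEquiv R).toLinearMap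
  suffices (concatLin R (add_zero n)).flip.compr₂ (milgramLin R X Y n) =
      LinearMap.compl₁₂ ρ (pathAlgebraMap X Y R).toLinearMap (milgramLin R X Y n) from
    congrArg (fun f => f a z) this
  refine PathAlgebra.lhom_ext R fun p => Finsupp.lhom_ext' fun c => LinearMap.ext_ring ?_
  change milgramLin R X Y n (concatLin R (add_zero n) (Finsupp.single c 1) (Finsupp.single p 1)) =
    (tensorObj (X.cubeComplex R) (Y.cubeComplex R) n).right
      (MulOpposite.op (pathAlgebraMap X Y R (PathAlgebra.of R p)))
        (milgramLin R X Y n (Finsupp.single c 1))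
  rw [concatLin_single, pathAlgebraMap_of, milgramLin_single, milgramLin_concat_right]

theorem milgramLin_natural {X' Y' : PrecubicalSet.{u}} [Finite X'.cube] [Finite Y'.cube]
    (f : Hom X X') (g : Hom Y Y') (n : ℕ) (z : (X.tensor Y).Chains R n) :
    milgramLin R X' Y' n (Finsupp.lmapDomain R R (CubeChain.map (f.tensor g)) z) =
      tensorMap (cubeComplexMap R f) (cubeComplexMap R g) n (milgramLin R X Y n z) := by
  suffices milgramLin R X' Y' n ∘ₗ Finsupp.lmapDomain R R (CubeChain.map (f.tensor g)) =
      tensorMap (cubeComplexMap R f) (cubeComplexMap R g) n ∘ₗ milgramLin R X Y n from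
    congrArg (· z) this
  refine Finsupp.lhom_ext' fun c => LinearMap.ext_ring ?_
  simp only [LinearMap.comp_apply, Finsupp.lsingle_apply, Finsupp.lmapDomain_apply,
    Finsupp.mapDomain_single]
  rw [milgramLin_single, milgramLin_single]
  by_cases hc : IsPure c.cubes
  · have e : tensorMap (cubeComplexMap R f) (cubeComplexMap R g) n
        (tensorBasis R (hc.degree_add.trans c.degree_eq) c.projFst c.projSnd) =
        tensorBasis R (hc.degree_add.trans c.degree_eq) (c.projFst.map f) (c.projSnd.map g) := by
      refine (tensorMap_in (cubeComplexMap R f) (cubeComplexMap R g) n _ _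
        (hc.degree_add.trans c.degree_eq) _ _).trans (congrArg _ (congrArg₂ (· ⊗ₜ[R] ·) ?_ ?_))
      · exact Finsupp.mapDomain_single
      · exact Finsupp.mapDomain_single
    rw [milgramChain_of_isPure R (c := c.map (f.tensor g)) (hc.degree_add.trans c.degree_eq)
      ((isPure_map f g _).2 hc) (a := c.projFst.map f) (b := c.projSnd.map g) ⟨rfl, rfl, (listFst_map f g _).symm⟩
      ⟨rfl, rfl, (listSnd_map f g _).symm⟩, milgramChain, dif_pos hc, map_smul, e]
    rw [show (c.map (f.tensor g)).cubes = c.cubes.map (f.tensor g).toFun from rfl, koszulExp_map]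
  · rw [milgramChain_of_not_isPure R hc, map_zero]
    exact milgramChain_of_not_isPure R fun h => hc ((isPure_map f g _).1 h)

end Compatibility

end PrecubicalSet

/-! ### The isomorphism in homology -/

/-- The isomorphism `H_i(X ⊗ Y) ≅ h^* H_i(C(X) ⊗ C(Y))` induced by Milgram's map. -/
noncomputable def Cub.milgramIso (R : Type v) [CommRing R] (X Y : Cub.{u}) (i : ℕ) :
    Bimodule.Iso (((X.tensor Y).C R).homology i)
      ((((X.C R).tensor (Y.C R)).homology i).restrict (Cub.h R X Y) (Cub.h R X Y)) where
  toEquiv := LinearEquiv.ofBijective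
    ((PrecubicalSet.milgramMap R X.toPrecubicalSet Y.toPrecubicalSet).homologyMap i)
    (PrecubicalSet.milgramMap_bijective X.toPrecubicalSet Y.toPrecubicalSet R i)
  map_left a m := by
    obtain ⟨x, rfl⟩ := Submodule.Quotient.mk_surjective _ m
    exact congrArg Submodule.Quotient.mk (Subtype.ext (PrecubicalSet.milgramLin_left R a x.1))
  map_right b m := by
    obtain ⟨x, rfl⟩ := Submodule.Quotient.mk_surjective _ m
    exact congrArg Submodule.Quotient.mk (Subtype.ext (PrecubicalSet.milgramLin_right R b x.1))

theorem theorem6p17 (R : Type v) [CommRing R] :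
    ∃ Φ : ∀ (X Y : Cub.{u}) (i : ℕ),
        Bimodule.Iso (((X.tensor Y).C R).homology i)
          ((((X.C R).tensor (Y.C R)).homology i).restrict (Cub.h R X Y) (Cub.h R X Y)),
      ∀ (X X' Y Y' : Cub.{u}) (f : Cub.Hom X X') (g : Cub.Hom Y Y') (i : ℕ)
        (z : (((X.tensor Y).C R).homology i).carrier),
        (Φ X' Y' i).toEquiv (((f.tensor g).C R).homologyMap i z) =
          ((f.C R).tensor (g.C R)).homologyMap i ((Φ X Y i).toEquiv z) := by
  refine ⟨Cub.milgramIso R, fun X X' Y Y' f g i z => ?_⟩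
  obtain ⟨x, rfl⟩ := Submodule.Quotient.mk_surjective _ z
  exact congrArg Submodule.Quotient.mk
    (Subtype.ext (PrecubicalSet.milgramLin_natural R f.toHom g.toHom i x.1))
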